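/- **Theorem (Exponential convergence along the smooth Wasserstein policy-gradient flow).** Let $\mathcal S$ be a measurable space, $\mathcal A=\mathbb R^d$, $\gamma\in(0,1)$, $\beta,\tau>0$, $\rho_0$ a probability measure on $\mathcal S$, $P(ds'\mid s,a)$ a Markov kernel from $\mathcal S\times\mathcal A$ to $\mathcal S$, and $r:\mathcal S\times\mathcal A\to\mathbb R$ a measurable reward with $|r|\le R_{\max}$. A policy is a jointly measurable map $(s,a)\mapsto\pi(a\mid s)\ge 0$ with $\int\pi(a\mid s)\,da=1$ for every $s$. Put $$V^\pi(s)=\mathbb E_\pi\Big[\sum_{n\ge0}\gamma^n\big(r(s_n,a_n)-\tfrac\beta2\|a_n\|^2-\tau\log\pi(a_n\mid s_n)\big)\,\Big|\,s_0=s\Big],$$ where $a_n\sim\pi(\cdot\mid s_n)$, $s_{n+1}\sim P(\cdot\mid s_n,a_n)$; let $J(\pi)$ be the same expectation with $s_0\sim\rho_0$. For $V:\mathcal S\to\mathbb R$ put $$Q_V(s,a)=r(s,a)-\tfrac\beta2\|a\|^2+\gamma\int V(s')\,P(ds'\mid s,a),\qquad (\mathcal T^\star V)(s)=\sup_\mu\int_{\mathbb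 R^d}\big(Q_V(s,a)-\tau\log\mu(a)\big)\mu(a)\,da,$$ the supremum being over probability densities $\mu$ for which the integrand is integrable, and $\mathcal G[V](a\mid s)=e^{Q_V(s,a)/\tau}\big/\int e^{Q_V(s,b)/\tau}\,db$. Write $Q^\pi=Q_{V^\pi}$, $p^\pi_s=\mathcal G[V^\pi](\cdot\mid s)$, $Z_\beta=(2\pi\tau/\beta)^{d/2}$, $\rho_\beta(a)=Z_\beta^{-1}e^{-\beta\|a\|^2/(2\tau)}$ (here $\pi$ in $Z_\beta$ is the number), and $\|V\|_\infty=\sup_s|V(s)|$. A *smooth WPG flow* is a family of policies $(\pi_t)_{t\ge0}$ such that: 1. $\sup_s\mathrm{KL}(\pi_t(\cdot\mid s)\,\|\,\rho_\beta)<\infty$ for every $t\ge0$; 2. for all $t>0$ and $s$, $\pi_t(\cdot\mid s)$ is positive and $C^2$, and $Q^{\pi_t}(s,\cdot)$ is $C^2$; 3. for all $s,a$, $t\mapsto\pi_t(a\mid s)$ is continuous on $[0,\infty)$, and for $t>0$ it is differentiable with $$\partial_t\pi_t(a\mid s)=-\nabla_a\cdot\big[\pi_t(a\mid s)\,\nabla_a\big(Q^{\pi_t}(s,a)-\tau\log\pi_t(a\mid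 s)\big)\big];$$ 4. for every $s$, $t\mapsto V^{\pi_t}(s)$ is absolutely continuous on every $[0,T]$; 5. (domination, state integral) for a.e. $t>0$ the difference quotients $h^{-1}\big(V^{\pi_{t+h}}(s)-V^{\pi_t}(s)\big)$ are bounded, uniformly in $s\in\mathcal S$ and in all sufficiently small $h\ne0$; 6. (domination, action integral) for all $t>0$ and $s$ there is an integrable $G:\mathbb R^d\to\mathbb R$ with $|\partial_u\pi_u(a\mid s)|\,(1+\|a\|^2+|\log\pi_u(a\mid s)|)\le G(a)$ for all $a$ and all $u$ near $t$; 7. (Fisher information and decay) for all $t>0$ and $s$, with $\varphi=\log(\pi_t(\cdot\mid s)/p_s^{\pi_t})$, the functions $\|\nabla\varphi\|^2\,\pi_t(\cdot\mid s)$ and $\varphi\,\pi_t(\cdot\mid s)\,\nabla\varphi$ are integrable on $\mathbb R^d$. Then $\mathcal T^\star$ has a unique bounded measurable fixed point $V^\star$, and $\pi^\star:=\mathcal G[V^\star]$ is a policy for which $J(\pi^\star)$ and $V^{\pi^\star}$ are expectations of integrable returns. Let $K_0\ge0$ and put $$V_{\max}=\max\Big\{\tfrac{R_{\max}+\tau\log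 Z_\beta}{1-\gamma},\ \tfrac{R_{\max}-\tau\log Z_\beta+\tau K_0}{1-\gamma}\Big\},\quad U_{\max}=R_{\max}+\gamma V_{\max},\quad \alpha=\tfrac\beta\tau\exp\big(-\tfrac{2U_{\max}}\tau\big).$$ For every smooth WPG flow with $\sup_s\mathrm{KL}(\pi_0(\cdot\mid s)\,\|\,\rho_\beta)\le K_0$ and every $t\ge0$, $J(\pi_t)$ and $V^{\pi_t}$ are expectations of integrable returns, $V^\star-V^{\pi_t}$ is bounded, and $$J(\pi^\star)-J(\pi_t)\ \le\ \|V^\star-V^{\pi_t}\|_\infty\ \le\ e^{-2\alpha\tau(1-\gamma)t}\,\|V^\star-V^{\pi_0}\|_\infty .$$ -/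

import Mathlib

open Set Filter Topology MeasureTheory ProbabilityTheory
open scoped ENNReal

/-- The action space `ℝ^d`, with its Euclidean norm and Lebesgue measure. -/
abbrev Act (d : ℕ) : Type := EuclideanSpace ℝ (Fin d)

/-- A discounted Markov decision process with action space `ℝ^d`, quadratic action penalty `β` and
entropy temperature `τ`. -/
structure EntropyMDP (S : Type*) [MeasurableSpace S] (d : ℕ) where
  /-- transition kernel `P(ds' | s, a)` -/
  P : Kernel (S × Act d) S
  markovP : IsMarkovKernel P
  /-- unregularized reward `r(s, a)` -/
  r : S × Act d → ℝ
  measurable_r : Measurable r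
  /-- discount factor -/
  γ : ℝ
  γ_pos : 0 < γ
  γ_lt_one : γ < 1
  /-- quadratic action penalty -/
  β : ℝ
  β_pos : 0 < β
  /-- temperature -/
  τ : ℝ
  τ_pos : 0 < τ
  /-- initial state distribution -/
  ρ₀ : Measure S
  probρ₀ : IsProbabilityMeasure ρ₀

attribute [instance] EntropyMDP.markovP EntropyMDP.probρ₀

/-- A stationary Markov policy given by a jointly measurable probability density `π(a | s)` with
respect to Lebesgue measure. -/
structure Policy (S : Type*) [MeasurableSpace S] (d : ℕ) where
  density : S → Act d → ℝ
  measurable_density : Measurable (Function.uncurry density)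
  density_nonneg : ∀ s a, 0 ≤ density s a
  lintegral_density : ∀ s, ∫⁻ a, ENNReal.ofReal (density s a) = 1

namespace Policy

variable {S : Type*} [MeasurableSpace S] {d : ℕ}

/-- The Markov kernel `π(da | s) = π(a | s) da`. -/
noncomputable def kernel (π : Policy S d) : Kernel S (Act d) :=
  Kernel.withDensity (Kernel.const S (volume : Measure (Act d)))
    (fun s a => ENNReal.ofReal (π.density s a))

theorem kernel_apply (π : Policy S d) (s : S) :
    π.kernel s = volume.withDensity (fun a => ENNReal.ofReal (π.density s a)) := by
  have h : Measurable (Function.uncurry fun s a => ENNReal.ofReal (π.density s a)) :=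
    π.measurable_density.ennreal_ofReal
  rw [kernel, Kernel.withDensity_apply _ h, Kernel.const_apply]

instance (π : Policy S d) : IsMarkovKernel π.kernel :=
  ⟨fun s => ⟨by
    rw [kernel_apply, withDensity_apply _ MeasurableSet.univ, Measure.restrict_univ,
      π.lintegral_density]⟩⟩

end Policy

/-- Divergence `∑ i, ∂ᵢ Fᵢ` of a vector field on `ℝ^d`. -/
noncomputable def divergence {d : ℕ} (F : Act d → Act d) (a : Act d) : ℝ :=
  ∑ i : Fin d, (fderiv ℝ F a (EuclideanSpace.single i 1)) i

namespace EntropyMDP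

variable {S : Type*} [MeasurableSpace S] {d : ℕ}

/-! ### Rollouts and values -/

/-- One step `(s, a) ↦ (s', a')` with `s' ∼ P(· | s, a)` and `a' ∼ π(· | s')`. -/
noncomputable def stepKernel (M : EntropyMDP S d) (π : Policy S d) :
    Kernel (S × Act d) (S × Act d) :=
  (Kernel.id ×ₖ π.kernel) ∘ₖ M.P

instance (M : EntropyMDP S d) (π : Policy S d) : IsMarkovKernel (M.stepKernel π) := by
  unfold stepKernel; infer_instance

/-- The transition kernel from the history up to time `n` to the state-action pair at time
`n + 1`; it depends on the last pair only. -/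
noncomputable def historyKernel (M : EntropyMDP S d) (π : Policy S d) (n : ℕ) :
    Kernel ((_ : Finset.Iic n) → S × Act d) (S × Act d) :=
  (M.stepKernel π).comap (fun h => h ⟨n, Finset.mem_Iic.2 le_rfl⟩) (measurable_pi_apply _)

instance (M : EntropyMDP S d) (π : Policy S d) (n : ℕ) : IsMarkovKernel (M.historyKernel π n) := by
  unfold historyKernel; infer_instance

/-- Law of the trajectory `(s_n, a_n)_{n ≥ 0}` of `π` with `s_0 ∼ μ`. -/
noncomputable def rollout (M : EntropyMDP S d) (π : Policy S d) (μ : Measure S)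
    [IsProbabilityMeasure μ] : Measure (ℕ → S × Act d) :=
  Kernel.trajMeasure (X := fun _ => S × Act d) (μ ⊗ₘ π.kernel) (M.historyKernel π)

/-- One-step regularized reward `r(s, a) - (β / 2) ‖a‖² - τ log π(a | s)`. -/
noncomputable def softReward (M : EntropyMDP S d) (π : Policy S d) (x : S × Act d) : ℝ :=
  M.r x - M.β / 2 * ‖x.2‖ ^ 2 - M.τ * Real.log (π.density x.1 x.2)

/-- Discounted regularized return of a trajectory. -/
noncomputable def softReturn (M : EntropyMDP S d) (π : Policy S d) (ω : ℕ → S × Act d) : ℝ :=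
  ∑' n, M.γ ^ n * M.softReward π (ω n)

/-- The expected return of `π` from the initial law `μ` exists and is finite. -/
def FiniteReturn (M : EntropyMDP S d) (π : Policy S d) (μ : Measure S)
    [IsProbabilityMeasure μ] : Prop :=
  (∀ᵐ ω ∂(M.rollout π μ), Summable fun n => M.γ ^ n * M.softReward π (ω n)) ∧
    Integrable (M.softReturn π) (M.rollout π μ)

/-- The soft value function `V^π`. -/
noncomputable def value (M : EntropyMDP S d) (π : Policy S d) (s : S) : ℝ :=
  ∫ ω, M.softReturn π ω ∂(M.rollout π (Measure.dirac s))

/-- The objective `J(π)`. -/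
noncomputable def J (M : EntropyMDP S d) (π : Policy S d) : ℝ :=
  ∫ ω, M.softReturn π ω ∂(M.rollout π M.ρ₀)

/-- `V^π` and `J(π)` are expectations of integrable returns. -/
def HasFiniteValues (M : EntropyMDP S d) (π : Policy S d) : Prop :=
  (∀ s, M.FiniteReturn π (Measure.dirac s)) ∧ M.FiniteReturn π M.ρ₀

/-- `Q_V(s, a) = r(s, a) - (β / 2) ‖a‖² + γ ∫ V(s') P(ds' | s, a)`. -/
noncomputable def qOf (M : EntropyMDP S d) (V : S → ℝ) (s : S) (a : Act d) : ℝ :=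
  M.r (s, a) - M.β / 2 * ‖a‖ ^ 2 + M.γ * ∫ s', V s' ∂(M.P (s, a))

/-- The state-action value function `Q^π`. -/
noncomputable def Q (M : EntropyMDP S d) (π : Policy S d) : S → Act d → ℝ :=
  M.qOf (M.value π)

/-! ### Soft optimality -/

/-- The soft optimality operator: the supremum over action densities `μ` for which
`(Q_V(s, ·) - τ log μ) μ` is integrable. -/
noncomputable def Tstar (M : EntropyMDP S d) (V : S → ℝ) (s : S) : ℝ :=
  sSup {x : ℝ | ∃ μ : Act d → ℝ, Measurable μ ∧ (∀ a, 0 ≤ μ a) ∧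
    ∫⁻ a, ENNReal.ofReal (μ a) = 1 ∧
    Integrable (fun a => (M.qOf V s a - M.τ * Real.log (μ a)) * μ a) ∧
    x = ∫ a, (M.qOf V s a - M.τ * Real.log (μ a)) * μ a}

/-- The Gibbs density `exp(Q_V(s, a) / τ) / ∫ exp(Q_V(s, b) / τ) db`. -/
noncomputable def gibbs (M : EntropyMDP S d) (V : S → ℝ) (s : S) (a : Act d) : ℝ :=
  Real.exp (M.qOf V s a / M.τ) / ∫ b, Real.exp (M.qOf V s b / M.τ)

/-- `V` is a bounded measurable fixed point of the soft optimality operator. -/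
def IsOptimalValue (M : EntropyMDP S d) (V : S → ℝ) : Prop :=
  Measurable V ∧ (∃ C, ∀ s, |V s| ≤ C) ∧ M.Tstar V = V

/-! ### Gaussian reference and admissible policies -/

/-- `Z_β = (2 π τ / β)^(d/2)`. -/
noncomputable def Zβ (M : EntropyMDP S d) : ℝ :=
  (2 * Real.pi * M.τ / M.β) ^ ((d : ℝ) / 2)

/-- The Gaussian reference measure `ρ_β(da) = Z_β⁻¹ exp(-β ‖a‖² / (2 τ)) da`. -/
noncomputable def gaussRef (M : EntropyMDP S d) : Measure (Act d) :=
  volume.withDensity fun a =>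
    ENNReal.ofReal (M.Zβ⁻¹ * Real.exp (-(M.β / (2 * M.τ)) * ‖a‖ ^ 2))

/-- The admissible class: `sup_s KL(π(· | s) ‖ ρ_β) < ∞`. -/
def Admissible (M : EntropyMDP S d) (π : Policy S d) : Prop :=
  (⨆ s, InformationTheory.klDiv (π.kernel s) M.gaussRef) < ∞

/-! ### The smooth Wasserstein policy-gradient flow -/

/-- `log (π(a | s) / p_s^π(a))`, where `p_s^π` is the Gibbs density of `V^π`. -/
noncomputable def logRatio (M : EntropyMDP S d) (π : Policy S d) (s : S) (a : Act d) : ℝ :=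
  Real.log (π.density s a / M.gibbs (M.value π) s a)

/-- The field `π(a | s) ∇_a (Q^π(s, a) - τ log π(a | s))`, whose negative divergence drives the
flow. -/
noncomputable def flux (M : EntropyMDP S d) (π : Policy S d) (s : S) (a : Act d) : Act d :=
  π.density s a • gradient (fun b => M.Q π s b - M.τ * Real.log (π.density s b)) a

/-- A smooth positive solution `(π_t)_{t ≥ 0}` of the Wasserstein policy-gradient flow
`∂_t π_t = -∇_a · (π_t ∇_a (Q^{π_t} - τ log π_t))`, together with the regularity under which the
flow is considered. Only times `t ≥ 0` matter. -/
structure IsSmoothWPGFlow (M : EntropyMDP S d) (π : ℝ → Policy S d) : Prop where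
  /-- the flow stays in the admissible class -/
  admissible : ∀ t, 0 ≤ t → M.Admissible (π t)
  /-- positivity -/
  density_pos : ∀ t, 0 < t → ∀ s a, 0 < (π t).density s a
  /-- smoothness of the density in the action -/
  contDiff_density : ∀ t, 0 < t → ∀ s, ContDiff ℝ 2 ((π t).density s)
  /-- smoothness of the state-action value in the action -/
  contDiff_Q : ∀ t, 0 < t → ∀ s, ContDiff ℝ 2 (M.Q (π t) s)
  /-- the initial datum is attained -/
  continuousOn_density : ∀ s a, ContinuousOn (fun t => (π t).density s a) (Ici 0)
  /-- the flow equation -/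
  flow_eq : ∀ t, 0 < t → ∀ s a,
    HasDerivAt (fun u => (π u).density s a) (-divergence (M.flux (π t) s) a) t
  /-- `t ↦ V^{π_t}(s)` is locally absolutely continuous, for each state -/
  absolutelyContinuous_value : ∀ s T, 0 ≤ T →
    AbsolutelyContinuousOnInterval (fun t => M.value (π t) s) 0 T
  /-- domination for differentiating in time under the state integral: at almost every time the
  difference quotients of `t ↦ V^{π_t}(s)` are bounded, uniformly in the state -/
  state_domination : ∀ᵐ t ∂(volume.restrict (Ioi (0 : ℝ))), ∃ C : ℝ, ∀ᶠ h in 𝓝 (0 : ℝ), ∀ s,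
    |M.value (π (t + h)) s - M.value (π t) s| ≤ C * |h|
  /-- domination for differentiating in time under the action integral: locally uniformly in time,
  `|∂_t π_t|` is dominated together with its second moment and its entropy term -/
  action_domination : ∀ t, 0 < t → ∀ s, ∃ G : Act d → ℝ, Integrable G ∧ ∀ᶠ u in 𝓝 t, ∀ a,
    |deriv (fun v => (π v).density s a) u| *
      (1 + ‖a‖ ^ 2 + |Real.log ((π u).density s a)|) ≤ G a
  /-- finite relative Fisher information with respect to the Gibbs density -/
  fisher : ∀ t, 0 < t → ∀ s, Integrable fun a =>
    ‖gradient (M.logRatio (π t) s) a‖ ^ 2 * (π t).density s a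
  /-- decay at infinity: the field `log(π_t / p) π_t ∇ log(π_t / p)` is integrable -/
  decay : ∀ t, 0 < t → ∀ s, Integrable fun a =>
    (M.logRatio (π t) s a * (π t).density s a) • gradient (M.logRatio (π t) s) a

/-! ### Constants and norms -/

/-- The supremum distance `‖V - W‖_∞` over all states. -/
noncomputable def supDist (V W : S → ℝ) : ℝ := ⨆ s, |V s - W s|

/-- Uniform bound on the values along the flow. -/
noncomputable def Vmax (M : EntropyMDP S d) (Rmax K₀ : ℝ) : ℝ :=
  max ((Rmax + M.τ * Real.log M.Zβ) / (1 - M.γ))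
    ((Rmax - M.τ * Real.log M.Zβ + M.τ * K₀) / (1 - M.γ))

/-- `U_max = R_max + γ V_max`. -/
noncomputable def Umax (M : EntropyMDP S d) (Rmax K₀ : ℝ) : ℝ :=
  Rmax + M.γ * M.Vmax Rmax K₀

/-- `α = (β / τ) exp(-2 U_max / τ)`. -/
noncomputable def lsiConst (M : EntropyMDP S d) (Rmax K₀ : ℝ) : ℝ :=
  M.β / M.τ * Real.exp (-2 * M.Umax Rmax K₀ / M.τ)

end EntropyMDP

/-!
The value along the flow satisfies a differential inequality that closes in the supremum norm, by
way of a logarithmic Sobolev inequality that is uniform in time and state.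

*Bellman residual.* By the Gibbs variational principle `T⋆ V = τ log ∫ exp (Q_V / τ)`
(`EntropyMDP.isGreatest_Tstar`), so `T⋆` is monotone and a contraction by `γ` of the supremum
distance. For a policy `π` with positive density, put `φ = log (π / p)` with `p` the Gibbs density
of its value. Then `Q - τ log π` is `-τ φ` plus a constant, and the residual `T⋆ V^π - V^π` equals
`τ ∫ φ π`, that is `τ KL(π ‖ p)` (`EntropyMDP.HasBddReward.Tstar_sub_value_eq`).

*Rate of increase.* With the state-action value frozen at time `t`, the one-step objective
increases at the rate `τ² ∫ ‖∇φ‖² π_t`, by integration by parts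
(`EntropyMDP.IsSmoothWPGFlow.hasDerivAt_frozen`). The difference quotients of `V^{π_t}` solve
linear Bellman equations with this forcing in the limit. At almost every time the quotients are
uniformly bounded, and the forcing is nonnegative, so Fatou's lemma and iteration of the Bellman
equation show that the time derivative of `V^{π_t}(s)`, where it exists, is at least
`τ² ∫ ‖∇φ‖² π_t` (`EntropyMDP.eventually_le_of_bellman`). This one-sided bound replaces the exact
policy gradient formula and needs no control of the occupancy measure.

*Logarithmic Sobolev inequality.* In particular the value does not decrease, so `|V^{π_t}| ≤ V_max`
for all times, and the Gibbs density is the Gaussian one times a factor confined to a band of width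
`exp (2 U_max / τ)`. The inequality for the Gaussian measure on the line follows from monotone
transport (`gaussianReal_lsi_of_integral_eq_one`), in dimension `d` by subadditivity of entropy
(`pi_gaussianReal_lsi`), and for unbounded functions by truncation (`EntropyMDP.gaussRef_lsi`). The
Holley–Stroock perturbation (`EntropyMDP.integral_log_div_mul_le_of_perturbation`) then gives
`∫ φ π_t ≤ (2 α)⁻¹ ∫ ‖∇φ‖² π_t`.

*Conclusion.* For `δ_t = V⋆ - V^{π_t} ≥ 0` these facts give
`δ_t' ≤ -2 α τ (T⋆ V^{π_t} - V^{π_t}) ≤ -2 α τ (δ_t - γ ‖δ_t‖)` for each state at almost every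
time. A Grönwall argument for families (`exp_mul_le_of_ae_deriv_le`) turns this into the decay of
`‖δ_t‖` at the rate `2 α τ (1 - γ)`.
-/

/-! ### Distribution functions and monotone transport on the line -/

section Transport

variable {p q : ℝ → ℝ}

theorem hasDerivAt_integral_Iic (hp : Continuous p) (hpi : Integrable p) (x : ℝ) :
    HasDerivAt (fun x => ∫ y in Iic x, p y) (p x) x := by
  have h : (fun x => ∫ y in Iic x, p y) =
      fun x => (∫ y in Iic 0, p y) + ∫ y in (0 : ℝ)..x, p y := by
    funext x
    rw [← intervalIntegral.integral_Iic_sub_Iic hpi.integrableOn hpi.integrableOn]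
    ring
  rw [h]
  exact (intervalIntegral.integral_hasDerivAt_right (hp.intervalIntegrable _ _)
    (hp.stronglyMeasurableAtFilter _ _) hp.continuousAt).const_add _

theorem strictMono_integral_Iic (hp : Continuous p) (hpi : Integrable p) (h0 : ∀ x, 0 < p x) :
    StrictMono fun x => ∫ y in Iic x, p y :=
  strictMono_of_deriv_pos fun x => by
    rw [(hasDerivAt_integral_Iic hp hpi x).deriv]; exact h0 x

theorem integral_Iic_add_integral_Ioi (hpi : Integrable p) (x : ℝ) :
    (∫ y in Iic x, p y) + ∫ y in Ioi x, p y = ∫ y, p y := by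
  rw [← compl_Iic]
  exact integral_add_compl measurableSet_Iic hpi

theorem integral_Iic_mem_Ioo (hp : Continuous p) (hpi : Integrable p) (h0 : ∀ x, 0 < p x)
    (h1 : ∫ x, p x = 1) (x : ℝ) : (∫ y in Iic x, p y) ∈ Ioo (0 : ℝ) 1 := by
  have hm := strictMono_integral_Iic hp hpi h0
  have hnn : ∀ z, 0 ≤ ∫ y in Iic z, p y := fun z => integral_nonneg fun y => (h0 y).le
  have hle : ∀ z, (∫ y in Iic z, p y) ≤ 1 := fun z => by
    have := integral_Iic_add_integral_Ioi hpi z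
    have h2 : 0 ≤ ∫ y in Ioi z, p y := integral_nonneg fun y => (h0 y).le
    linarith
  exact ⟨(hnn (x - 1)).trans_lt (hm (by linarith)),
    (hm (show x < x + 1 by linarith)).trans_le (hle _)⟩

theorem exists_integral_Iic_eq (hp : Continuous p) (hpi : Integrable p)
    (h1 : ∫ x, p x = 1) {u : ℝ} (hu : u ∈ Ioo (0 : ℝ) 1) : ∃ x, ∫ y in Iic x, p y = u := by
  have hc : Continuous fun x => ∫ y in Iic x, p y :=
    continuous_iff_continuousAt.2 fun x => (hasDerivAt_integral_Iic hp hpi x).continuousAt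
  have htop : Tendsto (fun x => ∫ y in Iic x, p y) atTop (𝓝 1) := by
    rw [← h1]
    exact (aecover_Iic tendsto_id).integral_tendsto_of_countably_generated hpi
  have hbot : Tendsto (fun x => ∫ y in Iic x, p y) atBot (𝓝 0) := by
    have h2 : Tendsto (fun x => ∫ y in Ioi x, p y) atBot (𝓝 1) := by
      rw [← h1]
      exact (aecover_Ioi tendsto_id).integral_tendsto_of_countably_generated hpi
    have h3 : (fun x => ∫ y in Iic x, p y) = fun x => 1 - ∫ y in Ioi x, p y := by
      funext x
      rw [← h1, ← integral_Iic_add_integral_Ioi hpi x]; ring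
    rw [h3]
    simpa using h2.const_sub 1
  obtain ⟨a, ha⟩ := (hbot.eventually (gt_mem_nhds hu.1)).exists
  obtain ⟨b, hb⟩ := (htop.eventually (lt_mem_nhds hu.2)).exists
  exact mem_range_of_exists_le_of_exists_ge hc ⟨a, ha.le⟩ ⟨b, hb.le⟩

/-- The monotone transport of one positive continuous probability density on the line to another,
with its Monge–Ampère equation `p = q ∘ T * T'`. -/
theorem exists_monotone_transport (hp : Continuous p) (hpi : Integrable p) (hp0 : ∀ x, 0 < p x)
    (hp1 : ∫ x, p x = 1) (hq : Continuous q) (hqi : Integrable q) (hq0 : ∀ x, 0 < q x)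
    (hq1 : ∫ x, q x = 1) :
    ∃ T : ℝ → ℝ, (∀ x, ∫ y in Iic (T x), q y = ∫ y in Iic x, p y) ∧
      ∀ x, HasDerivAt T (p x / q (T x)) x := by
  choose T hT using fun x =>
    exists_integral_Iic_eq hq hqi hq1 (integral_Iic_mem_Ioo hp hpi hp0 hp1 x)
  refine ⟨T, hT, fun x => ?_⟩
  have hmp := strictMono_integral_Iic hp hpi hp0
  have hmq := strictMono_integral_Iic hq hqi hq0
  have hTm : StrictMono T := fun a b hab => by
    have := hmp hab
    simp only [← hT] at this
    exact hmq.lt_iff_lt.1 this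
  have hTs : Function.Surjective T := fun y => by
    obtain ⟨x, hx⟩ := exists_integral_Iic_eq hp hpi hp1 (integral_Iic_mem_Ioo hq hqi hq0 hq1 y)
    exact ⟨x, hmq.injective (by simp only [hT, hx])⟩
  have hTc : Continuous T := hTm.monotone.continuous_of_surjective hTs
  -- The slope of `T` is the quotient of the slopes of the two distribution functions.
  have hFq := hasDerivAt_integral_Iic hq hqi (T x)
  have hFp := hasDerivAt_integral_Iic hp hpi x
  rw [hasDerivAt_iff_tendsto_slope] at hFp ⊢
  have h2 : Tendsto (slope (fun x => ∫ y in Iic x, q y) (T x)) (𝓝[≠] (T x)) (𝓝 (q (T x))) :=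
    hasDerivAt_iff_tendsto_slope.1 hFq
  have h3 : Tendsto T (𝓝[≠] x) (𝓝[≠] (T x)) :=
    tendsto_nhdsWithin_of_tendsto_nhds_of_eventually_within _
      (hTc.continuousAt.tendsto.mono_left nhdsWithin_le_nhds)
      (eventually_nhdsWithin_of_forall fun y hy => hTm.injective.ne hy)
  have h4 := hFp.div (h2.comp h3) (hq0 _).ne'
  refine h4.congr' (eventually_nhdsWithin_of_forall fun y hy => ?_)
  have hy1 : y - x ≠ 0 := sub_ne_zero.2 hy
  have hy2 : T y - T x ≠ 0 := sub_ne_zero.2 (hTm.injective.ne hy)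
  have hy3 : (∫ z in Iic y, p z) - ∫ z in Iic x, p z ≠ 0 :=
    sub_ne_zero.2 (hmp.injective.ne hy)
  simp only [Function.comp, slope_def_field, hT, Pi.div_apply]
  field_simp

end Transport

/-! ### The logarithmic Sobolev inequality for a Gaussian measure on the line -/

section GaussianLine

open scoped NNReal

variable {v : ℝ≥0}

theorem continuous_gaussianPDFReal (v : ℝ≥0) : Continuous (gaussianPDFReal 0 v) := by
  rw [gaussianPDFReal_def]; fun_prop

theorem hasDerivAt_gaussianPDFReal (hv : v ≠ 0) (x : ℝ) :
    HasDerivAt (gaussianPDFReal 0 v) (-(x / v) * gaussianPDFReal 0 v x) x := by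
  have hv' : (v : ℝ) ≠ 0 := by exact_mod_cast hv
  rw [gaussianPDFReal_def]
  have h : HasDerivAt (fun x : ℝ => -(x - 0) ^ 2 / (2 * v)) (-(x / v)) x := by
    have := (((hasDerivAt_id x).sub_const 0).pow 2).neg.div_const (2 * (v : ℝ))
    refine this.congr_deriv ?_
    simp only [id]; field_simp; ring
  exact (h.exp.const_mul (√(2 * Real.pi * v))⁻¹).congr_deriv (by dsimp only; ring)

theorem integrable_sq_mul_gaussianPDFReal (hv : v ≠ 0) :
    Integrable fun x => x ^ 2 * gaussianPDFReal 0 v x := by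
  have h := (memLp_id_gaussianReal (μ := 0) (v := v) 2).integrable_sq
  rw [gaussianReal_of_var_ne_zero _ hv] at h
  rw [integrable_withDensity_iff (measurable_gaussianPDF _ _)
    (ae_of_all _ fun _ => gaussianPDF_lt_top)] at h
  simpa [toReal_gaussianPDF] using h

/-- The quotient that controls the boundary terms in the transport argument. -/
theorem tendsto_gaussianPDFReal_sq_div (hv : v ≠ 0) :
    Tendsto (fun x => gaussianPDFReal 0 v x ^ 2 / gaussianPDFReal 0 v (x + 1)) atTop (𝓝 0) := by
  have hv' : (0 : ℝ) < v := by positivity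
  have hk : 0 < (√(2 * Real.pi * v))⁻¹ := by positivity
  set k := (√(2 * Real.pi * v))⁻¹
  have h : (fun x => gaussianPDFReal 0 v x ^ 2 / gaussianPDFReal 0 v (x + 1)) =
      fun x => k * Real.exp (-((x * (x - 2) - 1) / (2 * v))) := by
    funext x
    simp only [gaussianPDFReal]
    change (k * _) ^ 2 / (k * _) = _
    rw [mul_pow, ← Real.exp_nat_mul]
    have : Real.exp (((2 : ℕ) : ℝ) * (-(x - 0) ^ 2 / (2 * v))) =
        Real.exp (-((x * (x - 2) - 1) / (2 * v))) * Real.exp (-(x + 1 - 0) ^ 2 / (2 * v)) := by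
      rw [← Real.exp_add]; congr 1; push_cast; field_simp; ring
    rw [this]
    field_simp
  rw [h]
  have h1 : Tendsto (fun x : ℝ => (x * (x - 2) - 1) / (2 * v)) atTop atTop := by
    refine Tendsto.atTop_div_const (by positivity) ?_
    exact tendsto_atTop_add_const_right _ _
      (tendsto_id.atTop_mul_atTop₀ (tendsto_atTop_add_const_right _ _ tendsto_id))
  simpa using (Real.tendsto_exp_neg_atTop_nhds_zero.comp h1).const_mul k

theorem gaussianPDFReal_antitone_abs (hv : v ≠ 0) {x y : ℝ} (h : |x| ≤ |y|) :
    gaussianPDFReal 0 v y ≤ gaussianPDFReal 0 v x := by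
  have hv' : (0 : ℝ) < v := by positivity
  have h2 : (x - 0) ^ 2 ≤ (y - 0) ^ 2 := by simpa using sq_le_sq.2 h
  exact mul_le_mul_of_nonneg_left (Real.exp_le_exp.2 (by gcongr)) (by positivity)

theorem gaussianPDFReal_neg_arg (x : ℝ) :
    gaussianPDFReal 0 v (-x) = gaussianPDFReal 0 v x := by
  simp [gaussianPDFReal]

/-- Tail bound for the transport map of a density bounded below by a multiple of the Gaussian one,
on a set `A` that the transport sends to `B`; below, both are half-lines. -/
theorem sq_mul_gaussianPDFReal_le_of_transport (hv : v ≠ 0) {p : ℝ → ℝ} {ε : ℝ}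
    (hpi : Integrable p) (hp : ∀ x, ε * gaussianPDFReal 0 v x ≤ p x) (hε : 0 < ε) {A B : Set ℝ}
    (hB : MeasurableSet B) (hAB : ∫ z in B, gaussianPDFReal 0 v z = ∫ z in A, p z)
    {y w : ℝ} (hy : ∀ z ∈ B, y ^ 2 ≤ z ^ 2) {a : ℝ} (haA : Ioc a (a + 1) ⊆ A)
    (hw : ∀ z ∈ Ioc a (a + 1), w ≤ gaussianPDFReal 0 v z) :
    y ^ 2 * (ε * w) ≤ ∫ z, z ^ 2 * gaussianPDFReal 0 v z := by
  have hφ0 := gaussianPDFReal_nonneg 0 v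
  have hφi := integrable_gaussianPDFReal 0 v
  have h1 : ε * w ≤ ∫ z in A, p z := by
    have e1 : ε * w = ∫ z in Ioc a (a + 1), ε * w := by simp
    rw [e1]
    refine (setIntegral_mono_on (integrableOn_const (by simp)) hpi.integrableOn
      measurableSet_Ioc fun z hz =>
      (mul_le_mul_of_nonneg_left (hw z hz) hε.le).trans (hp z)).trans ?_
    exact setIntegral_mono_set hpi.integrableOn
      (ae_of_all _ fun z => (mul_nonneg hε.le (hφ0 z)).trans (hp z)) haA.eventuallyLE
  calc y ^ 2 * (ε * w) ≤ y ^ 2 * ∫ z in B, gaussianPDFReal 0 v z := by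
        rw [hAB]; gcongr
    _ = ∫ z in B, y ^ 2 * gaussianPDFReal 0 v z := (integral_const_mul _ _).symm
    _ ≤ ∫ z in B, z ^ 2 * gaussianPDFReal 0 v z :=
        setIntegral_mono_on (hφi.const_mul _).integrableOn
          (integrable_sq_mul_gaussianPDFReal hv).integrableOn hB
          fun z hz => mul_le_mul_of_nonneg_right (hy z hz) (hφ0 z)
    _ ≤ _ := setIntegral_le_integral (integrable_sq_mul_gaussianPDFReal hv)
        (ae_of_all _ fun z => mul_nonneg (sq_nonneg _) (hφ0 z))

/-- The pointwise inequality behind the transport proof of the logarithmic Sobolev inequality: up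
to the total derivative `H'` of `H = f φ (T - id)`, the entropy density is at most the Fisher
information density. Here `t = T x`, `t' = T' x`, `g = f' x` and `l = log f`. -/
theorem entropy_density_le {x t t' f g φ v : ℝ} (hv : 0 < v) (hf : 0 < f) (hφ : 0 < φ)
    (ht' : 0 < t') (hl : Real.log f = (x ^ 2 - t ^ 2) / (2 * v) + Real.log t') :
    f * Real.log f * φ ≤
      ((g * φ + f * (-(x / v) * φ)) * (t - x) + f * φ * (t' - 1)) + v / 2 * (g ^ 2 / f) * φ := by
  have h1 := Real.log_le_sub_one_of_pos ht'
  have h2 : f * Real.log f * φ ≤ f * ((x ^ 2 - t ^ 2) / (2 * v) + (t' - 1)) * φ := by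
    rw [hl]; gcongr
  refine h2.trans (le_of_sub_nonneg ?_)
  have : ((g * φ + f * (-(x / v) * φ)) * (t - x) + f * φ * (t' - 1)) + v / 2 * (g ^ 2 / f) * φ -
      f * ((x ^ 2 - t ^ 2) / (2 * v) + (t' - 1)) * φ =
      φ * (v * g + f * (t - x)) ^ 2 / (2 * v * f) := by
    field_simp; ring
  rw [this]; positivity

/-- Logarithmic Sobolev inequality for a probability density with respect to a Gaussian measure,
by monotone transport. -/
theorem gaussianReal_lsi_of_integral_eq_one (hv : v ≠ 0) {f : ℝ → ℝ} (hf : ContDiff ℝ 1 f)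
    {ε B : ℝ} (hε : 0 < ε) (hfε : ∀ x, ε ≤ f x) (hfB : ∀ x, f x ≤ B)
    (h1 : ∫ x, f x * gaussianPDFReal 0 v x = 1)
    (hI : Integrable fun x => v / 2 * (deriv f x ^ 2 / f x) * gaussianPDFReal 0 v x) :
    ∫ x, f x * Real.log (f x) * gaussianPDFReal 0 v x ≤
      ∫ x, v / 2 * (deriv f x ^ 2 / f x) * gaussianPDFReal 0 v x := by
  have hv' : (0 : ℝ) < v := by positivity
  set φ := gaussianPDFReal 0 v with hφdef
  have hφ0 : ∀ x, 0 < φ x := fun x => gaussianPDFReal_pos 0 v x hv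
  have hφc : Continuous φ := continuous_gaussianPDFReal v
  have hφi : Integrable φ := integrable_gaussianPDFReal 0 v
  have hf0 : ∀ x, 0 < f x := fun x => hε.trans_le (hfε x)
  have hfc : Continuous f := hf.continuous
  have hpc : Continuous fun x => f x * φ x := hfc.mul hφc
  have hpi : Integrable fun x => f x * φ x :=
    hφi.bdd_mul (c := B) hfc.aestronglyMeasurable
      (ae_of_all _ fun x => by rw [Real.norm_of_nonneg (hf0 x).le]; exact hfB x)
  obtain ⟨T, hTF, hT⟩ := exists_monotone_transport hpc hpi (fun x => mul_pos (hf0 x) (hφ0 x)) h1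
    hφc hφi hφ0 (integral_gaussianPDFReal_eq_one 0 hv)
  have hTc : Continuous T := continuous_iff_continuousAt.2 fun x => (hT x).continuousAt
  have hfd : ∀ x, HasDerivAt f (deriv f x) x := fun x =>
    (hf.differentiable one_ne_zero x).hasDerivAt
  have hfdc : Continuous (deriv f) := hf.continuous_deriv le_rfl
  set H : ℝ → ℝ := fun x => f x * φ x * (T x - x) with hH
  set H' : ℝ → ℝ := fun x => (deriv f x * φ x + f x * (-(x / v) * φ x)) * (T x - x) +
    f x * φ x * (f x * φ x / φ (T x) - 1) with hH'
  have hHd : ∀ x, HasDerivAt H (H' x) x := fun x =>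
    ((hfd x).mul (hasDerivAt_gaussianPDFReal hv x)).mul ((hT x).sub (hasDerivAt_id x))
  have hH'c : Continuous H' := by
    have := hφc.comp hTc
    have h2 : Continuous fun x => f x * φ x / φ (T x) := hpc.div₀ this fun x => (hφ0 _).ne'
    simp only [hH']
    fun_prop
  set E : ℝ → ℝ := fun x => f x * Real.log (f x) * φ x with hE
  set I : ℝ → ℝ := fun x => v / 2 * (deriv f x ^ 2 / f x) * φ x with hIdef
  have hlogc : Continuous fun x => Real.log (f x) := hfc.log fun x => (hf0 x).ne'
  have hEc : Continuous E := (hfc.mul hlogc).mul hφc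
  have hIc : Continuous I :=
    (continuous_const.mul ((hfdc.pow 2).div₀ hfc fun x => (hf0 x).ne')).mul hφc
  have hEi : Integrable E := by
    refine hφi.bdd_mul (c := B * (|Real.log ε| + |Real.log B|))
      (hfc.mul hlogc).aestronglyMeasurable (ae_of_all _ fun x => ?_)
    rw [norm_mul, Real.norm_of_nonneg (hf0 x).le, Real.norm_eq_abs]
    have e1 := Real.log_le_log hε (hfε x)
    have e2 := Real.log_le_log (hf0 x) (hfB x)
    refine mul_le_mul (hfB x) ?_ (abs_nonneg _) ((hf0 x).le.trans (hfB x))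
    · rw [abs_le]
      have := neg_abs_le (Real.log ε); have := le_abs_self (Real.log B)
      have := abs_nonneg (Real.log ε); have := abs_nonneg (Real.log B)
      constructor <;> linarith
  have hpt : ∀ x, E x ≤ H' x + I x := fun x => by
    refine entropy_density_le hv' (hf0 x) (hφ0 x)
      (div_pos (mul_pos (hf0 x) (hφ0 x)) (hφ0 (T x))) ?_
    rw [Real.log_div (mul_pos (hf0 x) (hφ0 x)).ne' (hφ0 _).ne',
      Real.log_mul (hf0 x).ne' (hφ0 x).ne']
    have hlog : ∀ y, Real.log (φ y) = Real.log (√(2 * Real.pi * v))⁻¹ + (-y ^ 2 / (2 * v)) := by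
      intro y
      rw [hφdef, gaussianPDFReal, Real.log_mul (by positivity) (Real.exp_pos _).ne', Real.log_exp,
        sub_zero]
    rw [hlog, hlog]; ring
  -- The boundary terms are at most `b R`, which tends to zero.
  set C := ∫ z, z ^ 2 * φ z with hC
  set b : ℝ → ℝ := fun R => 2 * B * √(C / ε * (φ R ^ 2 / φ (R + 1))) with hb
  have hb0 : Tendsto b atTop (𝓝 0) := by
    have := ((tendsto_gaussianPDFReal_sq_div hv).const_mul (C / ε)).sqrt.const_mul (2 * B)
    simpa using this
  have hB0 : 0 < B := (hf0 0).trans_le (hfB 0)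
  have hpε : ∀ x, ε * φ x ≤ f x * φ x := fun x => mul_le_mul_of_nonneg_right (hfε x) (hφ0 x).le
  have key : ∀ R y, y ^ 2 * (ε * φ (R + 1)) ≤ C → φ R * y ≤ √(C / ε * (φ R ^ 2 / φ (R + 1))) := by
    intro R y hy
    refine Real.le_sqrt_of_sq_le ?_
    have e1 := hφ0 (R + 1)
    have e2 : y ^ 2 ≤ C / (ε * φ (R + 1)) := by rwa [le_div_iff₀ (by positivity)]
    calc (φ R * y) ^ 2 = φ R ^ 2 * y ^ 2 := by ring
      _ ≤ φ R ^ 2 * (C / (ε * φ (R + 1))) := by gcongr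
      _ = _ := by field_simp
  have hright : ∀ R, 0 ≤ R → H R ≤ B * √(C / ε * (φ R ^ 2 / φ (R + 1))) := by
    intro R hR
    rcases le_total (T R) 0 with hT0 | hT0
    · exact (mul_nonpos_of_nonneg_of_nonpos (mul_pos (hf0 R) (hφ0 R)).le (by linarith)).trans
        (by positivity)
    · have e1 : T R ^ 2 * (ε * φ (R + 1)) ≤ C := by
        refine sq_mul_gaussianPDFReal_le_of_transport hv hpi hpε hε (A := Ioi R) (B := Ioi (T R))
          measurableSet_Ioi ?_ (fun z hz => ?_) (a := R) Ioc_subset_Ioi_self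
          (fun z hz => ?_)
        · have := integral_Iic_add_integral_Ioi hφi (T R)
          have h4 := integral_Iic_add_integral_Ioi hpi R
          rw [integral_gaussianPDFReal_eq_one 0 hv, hTF] at this
          rw [h1] at h4
          linarith
        · exact pow_le_pow_left₀ hT0 (le_of_lt hz) 2
        · refine gaussianPDFReal_antitone_abs hv ?_
          rw [abs_of_nonneg (hR.trans hz.1.le), abs_of_nonneg (by linarith)]; exact hz.2
      calc H R ≤ f R * φ R * T R := by
            have := hφ0 R; have := hf0 R
            simp only [hH]; gcongr; linarith
        _ = f R * (φ R * T R) := by ring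
        _ ≤ B * (φ R * T R) := by
            have := hφ0 R
            gcongr; exact hfB R
        _ ≤ _ := by gcongr; exact key _ _ e1
  have hleft : ∀ R, 0 ≤ R → - H (-R) ≤ B * √(C / ε * (φ R ^ 2 / φ (R + 1))) := by
    intro R hR
    have eH : - H (-R) = f (-R) * φ R * (- T (-R) - R) := by
      simp only [hH, hφdef, gaussianPDFReal_neg_arg]; ring
    rw [eH]
    rcases le_total 0 (T (-R)) with hT0 | hT0
    · exact (mul_nonpos_of_nonneg_of_nonpos (mul_pos (hf0 _) (hφ0 R)).le (by linarith)).trans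
        (by positivity)
    · have e1 : (-T (-R)) ^ 2 * (ε * φ (R + 1)) ≤ C := by
        refine sq_mul_gaussianPDFReal_le_of_transport hv hpi hpε hε (A := Iic (-R))
          (B := Iic (T (-R))) measurableSet_Iic (hTF _) (fun z hz => ?_)
          (a := -R - 1) (fun z hz => ?_) (fun z hz => ?_)
        · have hz' : z ≤ T (-R) := hz
          nlinarith
        · have := hz.2
          simp only [mem_Iic]; linarith
        · refine gaussianPDFReal_antitone_abs hv ?_
          have := hz.2; have := hz.1
          rw [abs_of_nonpos (by linarith), abs_of_nonneg (by linarith)]; linarith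
      calc f (-R) * φ R * (- T (-R) - R) ≤ f (-R) * φ R * (-T (-R)) := by
            have := hφ0 R; have := hf0 (-R)
            gcongr; linarith
        _ = f (-R) * (φ R * -T (-R)) := by ring
        _ ≤ B * (φ R * -T (-R)) := by
            have := hφ0 R
            have : 0 ≤ -T (-R) := by linarith
            gcongr; exact hfB _
        _ ≤ _ := by gcongr; exact key _ _ e1
  have hR : ∀ R, 0 ≤ R → ∫ x in -R..R, E x ≤ b R + ∫ x in -R..R, I x := by
    intro R hR
    have e1 : ∫ x in -R..R, E x ≤ ∫ x in -R..R, (H' x + I x) :=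
      intervalIntegral.integral_mono_on (by linarith) (hEc.intervalIntegrable _ _)
        ((hH'c.add hIc).intervalIntegrable _ _) fun x _ => hpt x
    rw [intervalIntegral.integral_add (hH'c.intervalIntegrable _ _) (hIc.intervalIntegrable _ _),
      intervalIntegral.integral_eq_sub_of_hasDerivAt (fun x _ => hHd x)
        (hH'c.intervalIntegrable _ _)] at e1
    have e2 := hright R hR
    have e3 := hleft R hR
    simp only [hb]; linarith
  have hlimE := intervalIntegral_tendsto_integral hEi tendsto_neg_atTop_atBot tendsto_id
  have hlimI := intervalIntegral_tendsto_integral hI tendsto_neg_atTop_atBot tendsto_id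
  have := le_of_tendsto_of_tendsto hlimE (hb0.add hlimI)
    ((eventually_ge_atTop 0).mono fun R hR' => hR R hR')
  simpa using this

end GaussianLine

/-! ### Entropy of positive functions and its subadditivity on products -/

section Entropy

/-- The entropy `∫ f log f dμ - (∫ f dμ) log (∫ f dμ)` of a positive function `f`. -/
noncomputable def functionalEntropy {X : Type*} [MeasurableSpace X] (μ : Measure X) (f : X → ℝ) :
    ℝ :=
  ∫ x, f x * Real.log (f x) ∂μ - (∫ x, f x ∂μ) * Real.log (∫ x, f x ∂μ)

theorem ofReal_integral_le_lintegral_ofReal {X : Type*} [MeasurableSpace X] {μ : Measure X}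
    {f : X → ℝ} (hf : Integrable f μ) :
    ENNReal.ofReal (∫ x, f x ∂μ) ≤ ∫⁻ x, ENNReal.ofReal (f x) ∂μ := by
  have h : ∫ x, f x ∂μ ≤ ∫ x, max (f x) 0 ∂μ :=
    integral_mono hf hf.pos_part fun x => le_max_left _ _
  refine (ENNReal.ofReal_le_ofReal h).trans ?_
  rw [ofReal_integral_eq_lintegral_ofReal hf.pos_part (ae_of_all _ fun x => le_max_right _ _)]
  simp

theorem abs_log_le_of_mem_Icc {ε B x : ℝ} (hε : 0 < ε) (h1 : ε ≤ x) (h2 : x ≤ B) :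
    |Real.log x| ≤ |Real.log ε| + |Real.log B| := by
  have e1 := Real.log_le_log hε h1
  have e2 := Real.log_le_log (hε.trans_le h1) h2
  have := neg_abs_le (Real.log ε); have := le_abs_self (Real.log B)
  have := abs_nonneg (Real.log ε); have := abs_nonneg (Real.log B)
  rw [abs_le]
  constructor <;> linarith

theorem abs_mul_log_le_of_mem_Icc {ε B x : ℝ} (hε : 0 < ε) (h1 : ε ≤ x) (h2 : x ≤ B) :
    |x * Real.log x| ≤ B * (|Real.log ε| + |Real.log B|) := by
  rw [abs_mul, abs_of_pos (hε.trans_le h1)]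
  exact mul_le_mul h2 (abs_log_le_of_mem_Icc hε h1 h2) (abs_nonneg _)
    ((hε.trans_le h1).le.trans h2)

theorem integral_mem_Icc_of_forall_mem_Icc {X : Type*} [MeasurableSpace X] {μ : Measure X}
    [IsProbabilityMeasure μ] {f : X → ℝ} (hf : Measurable f) {ε B : ℝ} (h : ∀ x, f x ∈ Icc ε B) :
    ∫ x, f x ∂μ ∈ Icc ε B :=
  (convex_Icc ε B).integral_mem isClosed_Icc (ae_of_all _ h)
    (Integrable.of_mem_Icc ε B hf.aemeasurable (ae_of_all _ h))

theorem integrable_mul_log_of_mem_Icc {X : Type*} [MeasurableSpace X] {μ : Measure X}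
    [IsFiniteMeasure μ] {f : X → ℝ} (hf : Measurable f) {ε B : ℝ} (hε : 0 < ε)
    (h : ∀ x, f x ∈ Icc ε B) : Integrable (fun x => f x * Real.log (f x)) μ :=
  Integrable.of_bound (hf.mul hf.log).aestronglyMeasurable _
    (ae_of_all _ fun x => abs_mul_log_le_of_mem_Icc hε (h x).1 (h x).2)

/-- Young's inequality `a b ≤ a log (a / m) - a + m exp b` for the entropy, with `b = log h`. -/
theorem mul_log_le_sub_add {a h : ℝ} (ha : 0 < a) {m : ℝ} (hm : 0 < m) (hh : 0 < h) :
    a * Real.log h ≤ a * Real.log a - a * Real.log m - a + m * h := by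
  have h1 := Real.log_le_sub_one_of_pos (show 0 < m * h / a by positivity)
  rw [Real.log_div (by positivity) ha.ne', Real.log_mul hm.ne' hh.ne'] at h1
  have h2 := mul_le_mul_of_nonneg_left h1 ha.le
  have h3 : a * (m * h / a - 1) = m * h - a := by field_simp
  linarith

/-- The variational (Gibbs) lower bound for the entropy. -/
theorem integral_mul_log_le_functionalEntropy {X : Type*} [MeasurableSpace X] {μ : Measure X}
    [IsProbabilityMeasure μ] {f h : X → ℝ} (hf : Measurable f) (hh : Measurable h)
    {ε B ε' B' : ℝ} (hε : 0 < ε) (hfB : ∀ x, f x ∈ Icc ε B) (hε' : 0 < ε')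
    (hhB : ∀ x, h x ∈ Icc ε' B') (h1 : ∫ x, h x ∂μ = 1) :
    ∫ x, f x * Real.log (h x) ∂μ ≤ functionalEntropy μ f := by
  have hfi : Integrable f μ := Integrable.of_mem_Icc ε B hf.aemeasurable (ae_of_all _ hfB)
  have hhi : Integrable h μ := Integrable.of_mem_Icc ε' B' hh.aemeasurable (ae_of_all _ hhB)
  have hm := integral_mem_Icc_of_forall_mem_Icc (μ := μ) hf hfB
  set m := ∫ x, f x ∂μ with hmdef
  have hm0 : 0 < m := hε.trans_le hm.1
  have hfl := integrable_mul_log_of_mem_Icc (μ := μ) hf hε hfB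
  have i1 : Integrable (fun x => f x * Real.log (h x)) μ :=
    hfi.mul_bdd (c := |Real.log ε'| + |Real.log B'|) hh.log.aestronglyMeasurable
      (ae_of_all _ fun x => abs_log_le_of_mem_Icc hε' (hhB x).1 (hhB x).2)
  have i2 : Integrable (fun x => f x * Real.log (f x) - f x * Real.log m) μ :=
    hfl.sub (hfi.mul_const _)
  have i3 : Integrable (fun x => f x * Real.log (f x) - f x * Real.log m - f x) μ := i2.sub hfi
  have e : ∫ x, (f x * Real.log (f x) - f x * Real.log m - f x + m * h x) ∂μ =
      functionalEntropy μ f := by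
    rw [integral_add i3 (hhi.const_mul _), integral_sub i2 hfi,
      integral_sub hfl (hfi.mul_const _), integral_mul_const, integral_const_mul, h1,
      functionalEntropy]
    ring
  rw [← e]
  exact integral_mono i1 (i3.add (hhi.const_mul _)) fun x =>
    mul_log_le_sub_add (hε.trans_le (hfB x).1) hm0 (hε'.trans_le (hhB x).1)

theorem measurable_functionalEntropy_section {X Y : Type*} [MeasurableSpace X] [MeasurableSpace Y]
    {μ : Measure X} [IsProbabilityMeasure μ] {f : Y × X → ℝ} (hf : Measurable f) :
    Measurable fun y => functionalEntropy μ fun x => f (y, x) := by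
  have h1 : Measurable fun y => ∫ x, f (y, x) ∂μ :=
    (hf.stronglyMeasurable.integral_prod_right' (ν := μ)).measurable
  have h2 : Measurable fun y => ∫ x, f (y, x) * Real.log (f (y, x)) ∂μ :=
    ((hf.mul hf.log).stronglyMeasurable.integral_prod_right' (ν := μ)).measurable
  exact h2.sub (h1.mul h1.log)

theorem integrable_functionalEntropy_section {X Y : Type*} [MeasurableSpace X] [MeasurableSpace Y]
    {μ : Measure X} [IsProbabilityMeasure μ] {ν : Measure Y} [IsProbabilityMeasure ν]
    {f : Y × X → ℝ} (hf : Measurable f) {ε B : ℝ} (hε : 0 < ε) (hfB : ∀ z, f z ∈ Icc ε B) :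
    Integrable (fun y => functionalEntropy μ fun x => f (y, x)) ν := by
  refine Integrable.of_bound (measurable_functionalEntropy_section hf).aestronglyMeasurable
    (B * (|Real.log ε| + |Real.log B|) + B * (|Real.log ε| + |Real.log B|))
    (ae_of_all _ fun y => ?_)
  have hfy : Measurable fun x => f (y, x) := hf.comp measurable_prodMk_left
  have hm := integral_mem_Icc_of_forall_mem_Icc (μ := μ) hfy fun x => hfB (y, x)
  refine (norm_sub_le _ _).trans (add_le_add ?_ (abs_mul_log_le_of_mem_Icc hε hm.1 hm.2))
  refine (norm_integral_le_of_norm_le_const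
    (ae_of_all _ fun x => abs_mul_log_le_of_mem_Icc hε (hfB (y, x)).1 (hfB (y, x)).2)).trans ?_
  simp

/-- Subadditivity of entropy on a product of two probability spaces. -/
theorem functionalEntropy_prod_le {X Y : Type*} [MeasurableSpace X] [MeasurableSpace Y]
    {μ : Measure X} [IsProbabilityMeasure μ] {ν : Measure Y} [IsProbabilityMeasure ν]
    {f : X × Y → ℝ} (hf : Measurable f) {ε B : ℝ} (hε : 0 < ε) (hfB : ∀ z, f z ∈ Icc ε B) :
    functionalEntropy (μ.prod ν) f ≤ ∫ y, functionalEntropy μ (fun x => f (x, y)) ∂ν +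
      ∫ x, functionalEntropy ν (fun y => f (x, y)) ∂μ := by
  have hfx : ∀ x, Measurable fun y => f (x, y) := fun x => hf.comp measurable_prodMk_left
  have hfy : ∀ y, Measurable fun x => f (x, y) := fun y => hf.comp measurable_prodMk_right
  have hfs : Measurable fun z : Y × X => f (z.2, z.1) := hf.comp measurable_swap
  have hfi : Integrable f (μ.prod ν) :=
    Integrable.of_mem_Icc ε B hf.aemeasurable (ae_of_all _ hfB)
  have hfl := integrable_mul_log_of_mem_Icc (μ := μ.prod ν) hf hε hfB
  set g : Y → ℝ := fun y => ∫ x, f (x, y) ∂μ with hg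
  have hgm : Measurable g := (hfs.stronglyMeasurable.integral_prod_right' (ν := μ)).measurable
  have hgB : ∀ y, g y ∈ Icc ε B := fun y =>
    integral_mem_Icc_of_forall_mem_Icc (hfy y) fun x => hfB (x, y)
  have hgi : Integrable g ν := Integrable.of_mem_Icc ε B hgm.aemeasurable (ae_of_all _ hgB)
  have hgl := integrable_mul_log_of_mem_Icc (μ := ν) hgm hε hgB
  set c := ∫ y, g y ∂ν with hc
  have hcB : c ∈ Icc ε B := integral_mem_Icc_of_forall_mem_Icc hgm hgB
  have hc0 : 0 < c := hε.trans_le hcB.1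
  have hcf : ∫ z, f z ∂(μ.prod ν) = c := integral_prod_symm f hfi
  have hA : ∫ y, functionalEntropy μ (fun x => f (x, y)) ∂ν =
      ∫ z, f z * Real.log (f z) ∂(μ.prod ν) - ∫ y, g y * Real.log (g y) ∂ν := by
    rw [integral_prod_symm _ hfl, ← integral_sub hfl.integral_prod_right hgl]
    rfl
  have hB0 : 0 < B := hc0.trans_le hcB.2
  have hhB : ∀ y, g y / c ∈ Icc (ε / c) (B / c) := fun y =>
    ⟨div_le_div_of_nonneg_right (hgB y).1 hc0.le, div_le_div_of_nonneg_right (hgB y).2 hc0.le⟩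
  have hhm : Measurable fun y => g y / c := hgm.div_const c
  have hhl : Integrable (fun z : X × Y => f z * Real.log (g z.2 / c)) (μ.prod ν) :=
    hfi.mul_bdd (c := |Real.log (ε / c)| + |Real.log (B / c)|)
      (hhm.comp measurable_snd).log.aestronglyMeasurable
      (ae_of_all _ fun z => abs_log_le_of_mem_Icc (div_pos hε hc0) (hhB z.2).1 (hhB z.2).2)
  have hBd : ∫ z, f z * Real.log (g z.2 / c) ∂(μ.prod ν) ≤
      ∫ x, functionalEntropy ν (fun y => f (x, y)) ∂μ := by
    rw [integral_prod _ hhl]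
    refine integral_mono hhl.integral_prod_left (integrable_functionalEntropy_section hf hε hfB)
      fun x => integral_mul_log_le_functionalEntropy (hfx x) hhm hε (fun y => hfB (x, y))
        (div_pos hε hc0) hhB ?_
    rw [integral_div, ← hc, div_self hc0.ne']
  have hC : ∫ z, f z * Real.log (g z.2 / c) ∂(μ.prod ν) =
      ∫ y, g y * Real.log (g y) ∂ν - c * Real.log c := by
    rw [integral_prod_symm _ hhl]
    have : ∀ y, ∫ x, f (x, y) * Real.log (g y / c) ∂μ =
        g y * Real.log (g y) - g y * Real.log c := fun y => by
      rw [integral_mul_const, Real.log_div (hε.trans_le (hgB y).1).ne' hc0.ne']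
      ring
    simp only [this]
    rw [integral_sub hgl (hgi.mul_const _), integral_mul_const]
  rw [hA, functionalEntropy, hcf]
  linarith

end Entropy

/-! ### The logarithmic Sobolev inequality for the standard product Gaussian measure -/

section GaussianPi

open scoped NNReal

variable {v : ℝ≥0}

/-- The inequality without normalization, with the Fisher information as a lower integral so that it
needs no integrability; in this form it tensorizes. -/
theorem gaussianReal_lsi (hv : v ≠ 0) {f : ℝ → ℝ} (hf : ContDiff ℝ 1 f) {ε B : ℝ} (hε : 0 < ε)
    (hfB : ∀ x, f x ∈ Icc ε B) :
    ENNReal.ofReal (functionalEntropy (gaussianReal 0 v) f) ≤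
      ∫⁻ x, ENNReal.ofReal (v / 2 * (deriv f x ^ 2 / f x)) ∂(gaussianReal 0 v) := by
  have hfm : Measurable f := hf.continuous.measurable
  have hf0 : ∀ x, 0 < f x := fun x => hε.trans_le (hfB x).1
  have hfi : Integrable f (gaussianReal 0 v) :=
    Integrable.of_mem_Icc ε B hfm.aemeasurable (ae_of_all _ hfB)
  have hfl := integrable_mul_log_of_mem_Icc (μ := gaussianReal 0 v) hfm hε hfB
  have hm := integral_mem_Icc_of_forall_mem_Icc (μ := gaussianReal 0 v) hfm hfB
  set m := ∫ x, f x ∂(gaussianReal 0 v) with hmdef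
  have hm0 : 0 < m := hε.trans_le hm.1
  have hdm : Measurable fun x => v / 2 * (deriv f x ^ 2 / f x) :=
    (((measurable_deriv f).pow_const 2).div hfm).const_mul _
  have hd0 : ∀ x, 0 ≤ v / 2 * (deriv f x ^ 2 / f x) := fun x => by
    have := hf0 x; positivity
  by_cases hI : ∫⁻ x, ENNReal.ofReal (v / 2 * (deriv f x ^ 2 / f x)) ∂(gaussianReal 0 v) = ∞
  · simp [hI]
  have hIi : Integrable (fun x => v / 2 * (deriv f x ^ 2 / f x)) (gaussianReal 0 v) :=
    (lintegral_ofReal_ne_top_iff_integrable hdm.aestronglyMeasurable (ae_of_all _ hd0)).1 hI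
  rw [← ofReal_integral_eq_lintegral_ofReal hIi (ae_of_all _ hd0)]
  refine ENNReal.ofReal_le_ofReal ?_
  have hdd : ∀ x, deriv (fun x => f x / m) x = deriv f x / m := fun x => deriv_div_const m
  have hsc : ∀ x, v / 2 * (deriv (fun x => f x / m) x ^ 2 / (f x / m)) =
      m⁻¹ * (v / 2 * (deriv f x ^ 2 / f x)) := fun x => by
    have := hf0 x
    rw [hdd]; field_simp
  have hpdf : ∀ g : ℝ → ℝ, ∫ x, g x * gaussianPDFReal 0 v x = ∫ x, g x ∂(gaussianReal 0 v) :=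
    fun g => by
      rw [integral_gaussianReal_eq_integral_smul hv]
      exact integral_congr_ae (ae_of_all _ fun x => by simp [mul_comm])
  have key := gaussianReal_lsi_of_integral_eq_one hv (f := fun x => f x / m) (hf.div_const m)
    (ε := ε / m) (B := B / m) (div_pos hε hm0)
    (fun x => div_le_div_of_nonneg_right (hfB x).1 hm0.le)
    (fun x => div_le_div_of_nonneg_right (hfB x).2 hm0.le)
    (by rw [hpdf, integral_div, div_self hm0.ne'])
    (by
      simp only [hsc]
      rw [gaussianReal_of_var_ne_zero _ hv, integrable_withDensity_iff (measurable_gaussianPDF _ _)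
        (ae_of_all _ fun _ => gaussianPDF_lt_top)] at hIi
      simpa only [toReal_gaussianPDF, mul_assoc] using hIi.const_mul m⁻¹)
  rw [hpdf, hpdf] at key
  simp only [hsc] at key
  rw [integral_const_mul] at key
  have e : ∫ x, f x / m * Real.log (f x / m) ∂(gaussianReal 0 v) =
      m⁻¹ * functionalEntropy (gaussianReal 0 v) f := by
    have : ∀ x, f x / m * Real.log (f x / m) =
        m⁻¹ * (f x * Real.log (f x) - f x * Real.log m) := fun x => by
      rw [Real.log_div (hf0 x).ne' hm0.ne']; field_simp
    simp only [this]
    rw [integral_const_mul, integral_sub hfl (hfi.mul_const _), integral_mul_const,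
      functionalEntropy]
  rw [e] at key
  exact le_of_mul_le_mul_left key (inv_pos.2 hm0)

/-- Logarithmic Sobolev inequality for the centred Gaussian measure of covariance `v • 1` on
`Fin d → ℝ`, for positive `C¹` functions bounded away from zero and infinity. -/
theorem pi_gaussianReal_lsi (hv : v ≠ 0) {ε B : ℝ} (hε : 0 < ε) (d : ℕ) {f : (Fin d → ℝ) → ℝ}
    (hf : ContDiff ℝ 1 f) (hfB : ∀ x, f x ∈ Icc ε B) :
    ENNReal.ofReal (functionalEntropy (Measure.pi fun _ => gaussianReal 0 v) f) ≤
      ∫⁻ x, ENNReal.ofReal (v / 2 * ((∑ i, fderiv ℝ f x (Pi.single i 1) ^ 2) / f x))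
        ∂(Measure.pi fun _ => gaussianReal 0 v) := by
  induction d with
  | zero =>
    have hc : ∀ x, f x = f 0 := fun x => by rw [Subsingleton.elim x 0]
    have : functionalEntropy (Measure.pi fun _ : Fin 0 => gaussianReal 0 v) f = 0 := by
      simp only [functionalEntropy, hc]
      simp
    simp [this]
  | succ d ih =>
    set γ := gaussianReal 0 v
    set ν : Measure (Fin d → ℝ) := Measure.pi fun _ => γ
    set e := MeasurableEquiv.piFinSuccAbove (fun _ : Fin (d + 1) => ℝ) 0
    have he : MeasurePreserving e (Measure.pi fun _ => γ) (γ.prod ν) :=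
      measurePreserving_piFinSuccAbove (fun _ : Fin (d + 1) => γ) 0
    have hes : ∀ t y, e.symm (t, y) = (Fin.cons t y : Fin (d + 1) → ℝ) := fun t y => by
      simp [e, MeasurableEquiv.piFinSuccAbove, Fin.consEquiv]
    have hf0 : ∀ x, 0 < f x := fun x => hε.trans_le (hfB x).1
    have hfd : ∀ x, HasFDerivAt f (fderiv ℝ f x) x := fun x =>
      (hf.differentiable one_ne_zero x).hasFDerivAt
    -- The two families of sections of `f`.
    set L : (Fin d → ℝ) →L[ℝ] (Fin (d + 1) → ℝ) :=
      ContinuousLinearMap.pi (Fin.cases 0 fun i => ContinuousLinearMap.proj i) with hL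
    have hcons1 : ∀ t (y : Fin d → ℝ), (Fin.cons t y : Fin (d + 1) → ℝ) = Fin.cons t 0 + L y :=
      fun t y => by
        ext i; refine Fin.cases ?_ (fun j => ?_) i <;> simp [hL]
    have hcons2 : ∀ t (y : Fin d → ℝ), (Fin.cons t y : Fin (d + 1) → ℝ) =
        Fin.cons 0 y + t • Pi.single 0 1 := fun t y => by
      ext i; refine Fin.cases ?_ (fun j => ?_) i <;> simp
    have hLs : ∀ i, L (Pi.single i 1) = Pi.single i.succ 1 := fun i => by
      ext j; refine Fin.cases ?_ (fun j => ?_) j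
      · simp [hL]
      · simp [hL, Pi.single_apply]
    have hs1 : ∀ t, ContDiff ℝ 1 fun y : Fin d → ℝ => f (Fin.cons t y) := fun t => by
      rw [funext fun y => congrArg f (hcons1 t y)]
      exact hf.comp (contDiff_const.add L.contDiff)
    have hs2 : ∀ y : Fin d → ℝ, ContDiff ℝ 1 fun t => f (Fin.cons t y) := fun y => by
      rw [funext fun t => congrArg f (hcons2 t y)]
      exact hf.comp (contDiff_const.add (contDiff_id.smul contDiff_const))
    have hd1 : ∀ t (y : Fin d → ℝ) i, fderiv ℝ (fun y : Fin d → ℝ => f (Fin.cons t y)) y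
        (Pi.single i 1) = fderiv ℝ f (Fin.cons t y) (Pi.single i.succ 1) := fun t y i => by
      have h1 : HasFDerivAt (fun y : Fin d → ℝ => (Fin.cons t y : Fin (d + 1) → ℝ)) L y := by
        rw [funext (hcons1 t)]; exact L.hasFDerivAt.const_add _
      have h2 := (hfd (Fin.cons t y)).comp y h1
      rw [show (fun y : Fin d → ℝ => f (Fin.cons t y)) =
        f ∘ fun y : Fin d → ℝ => (Fin.cons t y : Fin (d + 1) → ℝ) from rfl, h2.fderiv]
      simp [hLs]
    have hd2 : ∀ t (y : Fin d → ℝ), deriv (fun t => f (Fin.cons t y)) t =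
        fderiv ℝ f (Fin.cons t y) (Pi.single 0 1) := fun t y => by
      have h1 : HasDerivAt (fun t : ℝ => (Fin.cons t y : Fin (d + 1) → ℝ)) (Pi.single 0 1) t := by
        rw [funext fun t => hcons2 t y]
        simpa using ((hasDerivAt_id t).smul_const (Pi.single 0 1 : Fin (d + 1) → ℝ)).const_add
          (Fin.cons 0 y)
      exact ((hfd (Fin.cons t y)).comp_hasDerivAt t h1).deriv
    have hfm : Measurable f := hf.continuous.measurable
    have hFm : Measurable fun z : ℝ × (Fin d → ℝ) => f (e.symm z) := hfm.comp e.symm.measurable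
    have hEnt : functionalEntropy (Measure.pi fun _ => γ) f =
        functionalEntropy (γ.prod ν) fun z => f (e.symm z) := by
      have hi : ∀ g : (Fin (d + 1) → ℝ) → ℝ, ∫ x, g x ∂(Measure.pi fun _ => γ) =
          ∫ z, g (e.symm z) ∂(γ.prod ν) := fun g => by
        rw [← he.integral_comp' (g := fun z => g (e.symm z))]; simp
      rw [functionalEntropy, functionalEntropy, hi, hi]
    have hdm : ∀ i, Measurable fun x => fderiv ℝ f x (Pi.single i 1) := fun i =>
      measurable_fderiv_apply_const ℝ f _
    set D : Fin (d + 1) → (Fin (d + 1) → ℝ) → ℝ := fun i x => fderiv ℝ f x (Pi.single i 1)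
    have hRHS : ∫⁻ x, ENNReal.ofReal (v / 2 * ((∑ i, D i x ^ 2) / f x))
          ∂(Measure.pi fun _ => γ) =
        ∫⁻ z, ENNReal.ofReal (v / 2 * (D 0 (e.symm z) ^ 2 / f (e.symm z))) ∂(γ.prod ν) +
        ∫⁻ z, ENNReal.ofReal (v / 2 * ((∑ i : Fin d, D i.succ (e.symm z) ^ 2) / f (e.symm z)))
          ∂(γ.prod ν) := by
      have m1 : Measurable fun z => ENNReal.ofReal (v / 2 * (D 0 (e.symm z) ^ 2 / f (e.symm z))) :=
        (((((hdm 0).comp e.symm.measurable).pow_const 2).div hFm).const_mul _).ennreal_ofReal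
      rw [← lintegral_add_left m1, ← he.lintegral_comp_emb e.measurableEmbedding]
      refine lintegral_congr fun x => ?_
      have := hf0 x
      rw [MeasurableEquiv.symm_apply_apply, Fin.sum_univ_succ, add_div, mul_add,
        ENNReal.ofReal_add (by positivity) (by positivity)]
    rw [hEnt, hRHS]
    refine (ENNReal.ofReal_le_ofReal (functionalEntropy_prod_le hFm hε fun z => hfB _)).trans
      (ENNReal.ofReal_add_le.trans (add_le_add ?_ ?_))
    · have hFm' : Measurable fun z : (Fin d → ℝ) × ℝ => f (e.symm (z.2, z.1)) :=
        hFm.comp measurable_swap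
      refine (ofReal_integral_le_lintegral_ofReal
        (integrable_functionalEntropy_section hFm' hε fun z => hfB _)).trans ?_
      rw [lintegral_prod_symm]
      · refine lintegral_mono fun y => ?_
        refine (gaussianReal_lsi hv (f := fun t => f (e.symm (t, y))) ?_ hε fun t => hfB _).trans ?_
        · simp only [hes]; exact hs2 y
        · simp only [hes, hd2]; exact le_rfl
      · exact ((((((hdm 0).comp e.symm.measurable).pow_const 2).div hFm).const_mul _).ennreal_ofReal
          ).aemeasurable
    · refine (ofReal_integral_le_lintegral_ofReal
        (integrable_functionalEntropy_section hFm hε fun z => hfB _)).trans ?_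
      rw [lintegral_prod]
      · refine lintegral_mono fun t => ?_
        refine (ih (f := fun y => f (e.symm (t, y))) ?_ fun t => hfB _).trans ?_
        · simp only [hes]; exact hs1 t
        · simp only [hes, hd1]; exact le_rfl
      · refine Measurable.aemeasurable (Measurable.ennreal_ofReal (Measurable.const_mul
          (Measurable.div ?_ hFm) _))
        exact Finset.measurable_sum _ fun i _ =>
          ((hdm i.succ).comp e.symm.measurable).pow_const 2

end GaussianPi

/-! ### The Gaussian reference measure on `ℝ^d` and its logarithmic Sobolev inequality -/

section Gradient

variable {d : ℕ}

theorem sum_sq_fderiv_single (f : Act d → ℝ) (a : Act d) :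
    ∑ i, fderiv ℝ f a (EuclideanSpace.single i 1) ^ 2 = ‖gradient f a‖ ^ 2 := by
  rw [EuclideanSpace.norm_sq_eq]
  refine Finset.sum_congr rfl fun i _ => ?_
  rw [← inner_gradient_left, EuclideanSpace.inner_single_right]
  simp

theorem HasDerivAt.gradient_comp {f : Act d → ℝ} {g : ℝ → ℝ} {g' : ℝ} {a : Act d}
    (hg : HasDerivAt g g' (f a)) (hf : DifferentiableAt ℝ f a) :
    gradient (fun b => g (f b)) a = g' • gradient f a := by
  have h : HasFDerivAt (fun b => g (f b)) (g' • fderiv ℝ f a) a :=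
    hg.comp_hasFDerivAt a hf.hasFDerivAt
  have h2 := hasFDerivAt_iff_hasGradientAt.1 h
  rw [h2.gradient]
  simp [gradient]

end Gradient

theorem pi_gaussianReal_eq_withDensity {v : NNReal} (hv : v ≠ 0) (d : ℕ) :
    Measure.pi (fun _ : Fin d => gaussianReal 0 v) =
      volume.withDensity fun x => ENNReal.ofReal (∏ i, gaussianPDFReal 0 v (x i)) := by
  refine Measure.pi_eq fun s hs => ?_
  rw [withDensity_apply _ (MeasurableSet.univ_pi hs), volume_pi, Measure.restrict_pi_pi]
  have hnn : ∀ x : Fin d → ℝ, 0 ≤ ∏ i, gaussianPDFReal 0 v (x i) := fun x =>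
    Finset.prod_nonneg fun i _ => gaussianPDFReal_nonneg _ _ _
  rw [← ofReal_integral_eq_lintegral_ofReal
    (Integrable.fintype_prod fun i => (integrable_gaussianPDFReal 0 v).integrableOn)
    (ae_of_all _ hnn),
    integral_fintype_prod_eq_prod (f := fun _ : Fin d => gaussianPDFReal 0 v),
    ENNReal.ofReal_prod_of_nonneg fun i _ => integral_nonneg fun x => gaussianPDFReal_nonneg _ _ _]
  exact Finset.prod_congr rfl fun i _ => (gaussianReal_apply_eq_integral 0 hv (s i)).symm

namespace EntropyMDP

variable {S : Type*} [MeasurableSpace S] {d : ℕ} (M : EntropyMDP S d)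

/-- The density of the Gaussian reference measure. -/
noncomputable def gaussDens (a : Act d) : ℝ :=
  M.Zβ⁻¹ * Real.exp (-(M.β / (2 * M.τ)) * ‖a‖ ^ 2)

theorem Zβ_pos : 0 < M.Zβ := by
  have := M.τ_pos; have := M.β_pos; have := Real.pi_pos
  unfold Zβ; positivity

theorem gaussDens_pos (a : Act d) : 0 < M.gaussDens a :=
  mul_pos (inv_pos.2 M.Zβ_pos) (Real.exp_pos _)

theorem contDiff_gaussDens {n : WithTop ℕ∞} : ContDiff ℝ n M.gaussDens :=
  contDiff_const.mul (contDiff_const.mul (contDiff_norm_sq ℝ)).exp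

theorem measurable_gaussDens : Measurable M.gaussDens :=
  (M.contDiff_gaussDens (n := 0)).continuous.measurable

theorem log_gaussDens (a : Act d) :
    Real.log (M.gaussDens a) = -Real.log M.Zβ - M.β / (2 * M.τ) * ‖a‖ ^ 2 := by
  rw [gaussDens, Real.log_mul (inv_pos.2 M.Zβ_pos).ne' (Real.exp_pos _).ne', Real.log_exp,
    Real.log_inv]
  ring

/-- The variance `τ / β` of the coordinates of the Gaussian reference measure. -/
noncomputable def gaussVar : NNReal := ⟨M.τ / M.β, (div_pos M.τ_pos M.β_pos).le⟩

theorem gaussVar_ne_zero : M.gaussVar ≠ 0 := by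
  intro h
  exact (div_pos M.τ_pos M.β_pos).ne' (congrArg NNReal.toReal h)

theorem prod_gaussianPDFReal (x : Fin d → ℝ) :
    ∏ i, gaussianPDFReal 0 M.gaussVar (x i) = M.gaussDens (WithLp.toLp 2 x) := by
  have hv : (M.gaussVar : ℝ) = M.τ / M.β := rfl
  have hτ := M.τ_pos; have hβ := M.β_pos; have := Real.pi_pos
  simp only [gaussianPDFReal, hv, Finset.prod_mul_distrib, Finset.prod_const, Finset.card_univ,
    Fintype.card_fin, ← Real.exp_sum]
  rw [gaussDens, Zβ, EuclideanSpace.norm_sq_eq]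
  congr 1
  · rw [inv_pow, Real.sqrt_eq_rpow, ← Real.rpow_natCast, ← Real.rpow_mul (by positivity)]
    congr 2 <;> ring
  · congr 1
    rw [Finset.mul_sum]
    refine Finset.sum_congr rfl fun i _ => ?_
    simp only [sub_zero, Real.norm_eq_abs, sq_abs]
    field_simp

theorem measurePreserving_toLp_gaussRef :
    MeasurePreserving (WithLp.toLp 2) (Measure.pi fun _ : Fin d => gaussianReal 0 M.gaussVar)
      M.gaussRef := by
  have hp := PiLp.volume_preserving_toLp (Fin d)
  refine ⟨hp.measurable, ?_⟩
  ext A hA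
  rw [Measure.map_apply hp.measurable hA, pi_gaussianReal_eq_withDensity M.gaussVar_ne_zero,
    withDensity_apply _ (hp.measurable hA), gaussRef, withDensity_apply _ hA]
  simp only [M.prod_gaussianPDFReal]
  exact hp.setLIntegral_comp_preimage hA M.measurable_gaussDens.ennreal_ofReal

instance : IsProbabilityMeasure M.gaussRef :=
  ⟨by
    rw [← M.measurePreserving_toLp_gaussRef.measure_preimage MeasurableSet.univ.nullMeasurableSet]
    simp⟩

theorem lintegral_gaussRef {f : Act d → ℝ≥0∞} (hf : Measurable f) :
    ∫⁻ a, f a ∂M.gaussRef = ∫⁻ a, ENNReal.ofReal (M.gaussDens a) * f a :=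
  lintegral_withDensity_eq_lintegral_mul _ M.measurable_gaussDens.ennreal_ofReal hf

theorem integrable_gaussRef_iff {f : Act d → ℝ} :
    Integrable f M.gaussRef ↔ Integrable fun a => f a * M.gaussDens a := by
  have h : Integrable f M.gaussRef ↔ _ := integrable_withDensity_iff
    (μ := (volume : Measure (Act d))) M.measurable_gaussDens.ennreal_ofReal
    (ae_of_all _ fun _ => ENNReal.ofReal_lt_top) (g := f)
  rw [h]
  simp only [ENNReal.toReal_ofReal (M.gaussDens_pos _).le]

theorem integral_gaussRef (f : Act d → ℝ) :
    ∫ a, f a ∂M.gaussRef = ∫ a, f a * M.gaussDens a := by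
  have h := integral_withDensity_eq_integral_toReal_smul (μ := (volume : Measure (Act d)))
    M.measurable_gaussDens.ennreal_ofReal (ae_of_all _ fun _ => ENNReal.ofReal_lt_top) f
  refine h.trans (integral_congr_ae (ae_of_all _ fun a => ?_))
  simp only [ENNReal.toReal_ofReal (M.gaussDens_pos _).le, smul_eq_mul, mul_comm]

theorem integrable_gaussDens : Integrable M.gaussDens := by
  simpa using M.integrable_gaussRef_iff.1 (integrable_const (1 : ℝ))

theorem integral_gaussDens : ∫ a, M.gaussDens a = 1 := by
  simpa using (M.integral_gaussRef fun _ => 1).symm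

theorem gaussRef_lsi_of_mem_Icc {f : Act d → ℝ} (hf : ContDiff ℝ 1 f) {ε B : ℝ} (hε : 0 < ε)
    (hfB : ∀ x, f x ∈ Icc ε B) :
    ENNReal.ofReal (functionalEntropy M.gaussRef f) ≤
      ∫⁻ a, ENNReal.ofReal (M.τ / (2 * M.β) * (‖gradient f a‖ ^ 2 / f a)) ∂M.gaussRef := by
  have hp := M.measurePreserving_toLp_gaussRef
  have he : MeasurableEmbedding (WithLp.toLp 2 : (Fin d → ℝ) → Act d) :=
    (MeasurableEquiv.toLp 2 (Fin d → ℝ)).measurableEmbedding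
  set L : (Fin d → ℝ) ≃L[ℝ] Act d := (EuclideanSpace.equiv (Fin d) ℝ).symm
  have hL : ∀ x, L x = WithLp.toLp 2 x := fun x => rfl
  have hfL : ContDiff ℝ 1 fun x : Fin d → ℝ => f (WithLp.toLp 2 x) := hf.comp L.contDiff
  have key := pi_gaussianReal_lsi M.gaussVar_ne_zero hε d hfL fun x => hfB _
  have hd : ∀ x i, fderiv ℝ (fun x : Fin d → ℝ => f (WithLp.toLp 2 x)) x (Pi.single i 1) =
      fderiv ℝ f (WithLp.toLp 2 x) (EuclideanSpace.single i 1) := fun x i => by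
    have h1 := ((hf.differentiable one_ne_zero (L x)).hasFDerivAt).comp x L.hasFDerivAt
    have h2 : fderiv ℝ (fun x : Fin d → ℝ => f (WithLp.toLp 2 x)) x = _ := h1.fderiv
    rw [h2]
    rfl
  have hE : functionalEntropy (Measure.pi fun _ : Fin d => gaussianReal 0 M.gaussVar)
      (fun x => f (WithLp.toLp 2 x)) = functionalEntropy M.gaussRef f := by
    rw [functionalEntropy, functionalEntropy, ← hp.integral_comp he, ← hp.integral_comp he]
  rw [hE] at key
  refine key.trans (le_of_eq ?_)
  rw [← hp.lintegral_comp_emb he]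
  refine lintegral_congr fun x => ?_
  simp only [hd, sum_sq_fderiv_single]
  have hv : (M.gaussVar : ℝ) = M.τ / M.β := rfl
  rw [hv, div_div, mul_comm M.β 2]

theorem entropy_integrand_nonneg {a c : ℝ} (ha : 0 < a) (hc : 0 < c) :
    0 ≤ a * Real.log a - a * Real.log c - a + c := by
  have := mul_log_le_sub_add ha hc one_pos
  simp only [Real.log_one, mul_zero, mul_one] at this
  exact this

theorem measurable_norm_sq_gradient (f : Act d → ℝ) : Measurable fun a => ‖gradient f a‖ ^ 2 := by
  simp only [← sum_sq_fderiv_single]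
  exact Finset.measurable_sum _ fun i _ => (measurable_fderiv_apply_const ℝ f _).pow_const 2

/-- The logarithmic Sobolev inequality of the Gaussian reference measure for positive `C¹`
functions without any bounds. The function is truncated to `1 / N + N f / (N + f)`, which does not
increase `‖∇f‖² / f`, and Fatou's lemma applies to the nonnegative entropy integrand. -/
theorem gaussRef_lsi {f : Act d → ℝ} (hf : ContDiff ℝ 1 f) (hf0 : ∀ a, 0 < f a)
    (hfi : Integrable f M.gaussRef) :
    ∫⁻ a, ENNReal.ofReal (f a * Real.log (f a) - f a * Real.log (∫ b, f b ∂M.gaussRef) - f a +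
        ∫ b, f b ∂M.gaussRef) ∂M.gaussRef ≤
      ∫⁻ a, ENNReal.ofReal (M.τ / (2 * M.β) * (‖gradient f a‖ ^ 2 / f a)) ∂M.gaussRef := by
  have hτ := M.τ_pos; have hβ := M.β_pos
  have hN : ∀ n : ℕ, (0 : ℝ) < n + 1 := fun n => by positivity
  set g : ℕ → Act d → ℝ := fun n a => 1 / ((n : ℝ) + 1) + (n + 1) * f a / (n + 1 + f a) with hg
  have hgc : ∀ n, ContDiff ℝ 1 (g n) := fun n =>
    contDiff_const.add ((contDiff_const.mul hf).div (contDiff_const.add hf)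
      fun a => (add_pos (hN n) (hf0 a)).ne')
  have hquot : ∀ (n : ℕ) a, (n + 1) * f a / (n + 1 + f a) ≤ f a := fun n a => by
    have := hf0 a; have := hN n
    rw [div_le_iff₀ (by positivity)]; nlinarith
  have hg1 : ∀ (n : ℕ) a, 1 / ((n : ℝ) + 1) ≤ g n a := fun n a => by
    have := hf0 a; have := hN n
    have : 0 ≤ ((n : ℝ) + 1) * f a / (n + 1 + f a) := by positivity
    simp only [hg]; linarith
  have hg2 : ∀ (n : ℕ) a, g n a ≤ 1 / ((n : ℝ) + 1) + (n + 1) := fun n a => by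
    have := hf0 a; have := hN n
    have : ((n : ℝ) + 1) * f a / (n + 1 + f a) ≤ n + 1 := by
      rw [div_le_iff₀ (by positivity)]; nlinarith
    simp only [hg]; linarith
  have hg0 : ∀ n a, 0 < g n a := fun n a => (one_div_pos.2 (hN n)).trans_le (hg1 n a)
  have hgm : ∀ n, Measurable (g n) := fun n => (hgc n).continuous.measurable
  have hgle : ∀ n a, g n a ≤ 1 + f a := fun n a => by
    have : 1 / ((n : ℝ) + 1) ≤ 1 := by
      rw [div_le_iff₀ (hN n)]; linarith [(Nat.cast_nonneg n : (0 : ℝ) ≤ n)]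
    exact add_le_add this (hquot n a)
  have hlim : ∀ a, Tendsto (fun n => g n a) atTop (𝓝 (f a)) := fun a => by
    have h1 := tendsto_one_div_add_atTop_nhds_zero_nat (𝕜 := ℝ)
    have h2 : Tendsto (fun n : ℕ => f a / (1 + f a * (1 / ((n : ℝ) + 1)))) atTop
        (𝓝 (f a / (1 + f a * 0))) :=
      Tendsto.div tendsto_const_nhds (tendsto_const_nhds.add (h1.const_mul _)) (by simp)
    have h3 := h1.add h2
    simp only [mul_zero, add_zero, div_one, zero_add] at h3
    refine h3.congr fun n => ?_
    have := hN n; have := hf0 a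
    simp only [hg]
    congr 1
    field_simp
  set c := ∫ b, f b ∂M.gaussRef with hc
  set cn : ℕ → ℝ := fun n => ∫ b, g n b ∂M.gaussRef with hcn
  have hclim : Tendsto cn atTop (𝓝 c) := by
    refine tendsto_integral_of_dominated_convergence (fun a => 1 + f a)
      (fun n => (hgm n).aestronglyMeasurable) ((integrable_const _).add hfi)
      (fun n => ae_of_all _ fun a => ?_) (ae_of_all _ hlim)
    rw [Real.norm_of_nonneg (hg0 n a).le]; exact hgle n a
  have hcn0 : ∀ n, 0 < cn n := fun n =>
    (one_div_pos.2 (hN n)).trans_le (integral_mem_Icc_of_forall_mem_Icc (hgm n)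
      fun a => ⟨hg1 n a, hg2 n a⟩).1
  have hc0 : 0 < c := by
    rw [hc, integral_pos_iff_support_of_nonneg (fun a => (hf0 a).le) hfi]
    have : Function.support f = univ := eq_univ_of_forall fun a => (hf0 a).ne'
    simp [this]
  set E : ℕ → Act d → ℝ := fun n a =>
    g n a * Real.log (g n a) - g n a * Real.log (cn n) - g n a + cn n with hE
  have hEm : ∀ n, Measurable (E n) := fun n =>
    ((((hgm n).mul (hgm n).log).sub ((hgm n).mul_const _)).sub (hgm n)).add_const _
  have hstep : ∀ n, ∫⁻ a, ENNReal.ofReal (E n a) ∂M.gaussRef ≤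
      ∫⁻ a, ENNReal.ofReal (M.τ / (2 * M.β) * (‖gradient f a‖ ^ 2 / f a)) ∂M.gaussRef := by
    intro n
    have hgi : Integrable (g n) M.gaussRef := Integrable.of_mem_Icc _ _ (hgm n).aemeasurable
      (ae_of_all _ fun a => ⟨hg1 n a, hg2 n a⟩)
    have hgl := integrable_mul_log_of_mem_Icc (μ := M.gaussRef) (hgm n) (one_div_pos.2 (hN n))
      fun a => ⟨hg1 n a, hg2 n a⟩
    have i2 : Integrable (fun a => g n a * Real.log (g n a) - g n a * Real.log (cn n)) M.gaussRef :=
      hgl.sub (hgi.mul_const _)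
    have i3 : Integrable (fun a => g n a * Real.log (g n a) - g n a * Real.log (cn n) - g n a)
        M.gaussRef := i2.sub hgi
    have i4 : Integrable (E n) M.gaussRef := i3.add (integrable_const _)
    rw [← ofReal_integral_eq_lintegral_ofReal i4
      (ae_of_all _ fun a => entropy_integrand_nonneg (hg0 n a) (hcn0 n))]
    have e : ∫ a, E n a ∂M.gaussRef = functionalEntropy M.gaussRef (g n) := by
      simp only [hE]
      rw [integral_add i3 (integrable_const _), integral_sub i2 hgi,
        integral_sub hgl (hgi.mul_const _), integral_mul_const, functionalEntropy]
      simp [hcn]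
    refine (ENNReal.ofReal_le_ofReal e.le).trans ((M.gaussRef_lsi_of_mem_Icc (hgc n)
      (one_div_pos.2 (hN n)) fun a => ⟨hg1 n a, hg2 n a⟩).trans ?_)
    refine lintegral_mono fun a => ENNReal.ofReal_le_ofReal
      (mul_le_mul_of_nonneg_left ?_ (by positivity))
    have hfa := hf0 a; have hn := hN n
    set N : ℝ := n + 1
    have hder : HasDerivAt (fun x : ℝ => 1 / N + N * x / (N + x)) ((N / (N + f a)) ^ 2) (f a) := by
      have h1 := (((hasDerivAt_id (f a)).const_mul N).div ((hasDerivAt_id (f a)).const_add N)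
        (by simp only [id]; positivity)).const_add (1 / N)
      refine h1.congr_deriv ?_
      simp only [id]; field_simp; ring
    have hgr := hder.gradient_comp (hf.differentiable one_ne_zero a)
    have hga : N * f a / (N + f a) ≤ g n a := by
      have : 0 < 1 / N := by positivity
      simp only [hg]; linarith
    have hga' : 0 < N * f a / (N + f a) := by positivity
    change ‖gradient (fun b => 1 / N + N * f b / (N + f b)) a‖ ^ 2 / g n a ≤ _
    rw [hgr, norm_smul, Real.norm_of_nonneg (by positivity), mul_pow]
    have hq0 : 0 ≤ N / (N + f a) := by positivity
    have hq : N / (N + f a) ≤ 1 := by rw [div_le_one (by positivity)]; linarith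
    calc _ ≤ ((N / (N + f a)) ^ 2) ^ 2 * ‖gradient f a‖ ^ 2 / (N * f a / (N + f a)) := by gcongr
      _ = (N / (N + f a)) ^ 3 * (‖gradient f a‖ ^ 2 / f a) := by field_simp
      _ ≤ 1 * (‖gradient f a‖ ^ 2 / f a) := by
          gcongr; exact pow_le_one₀ hq0 hq
      _ = _ := one_mul _
  have hElim : ∀ a, Tendsto (fun n => ENNReal.ofReal (E n a)) atTop
      (𝓝 (ENNReal.ofReal (f a * Real.log (f a) - f a * Real.log c - f a + c))) := fun a => by
    refine ENNReal.tendsto_ofReal ?_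
    have h1 := (Real.continuousAt_log (hf0 a).ne').tendsto.comp (hlim a)
    have h2 := (Real.continuousAt_log hc0.ne').tendsto.comp hclim
    exact ((((hlim a).mul h1).sub ((hlim a).mul h2)).sub (hlim a)).add hclim
  calc _ = ∫⁻ a, liminf (fun n => ENNReal.ofReal (E n a)) atTop ∂M.gaussRef :=
        lintegral_congr fun a => (hElim a).liminf_eq.symm
    _ ≤ liminf (fun n => ∫⁻ a, ENNReal.ofReal (E n a) ∂M.gaussRef) atTop :=
        lintegral_liminf_le fun n => (hEm n).ennreal_ofReal
    _ ≤ _ := liminf_le_of_le (by isBoundedDefault) fun b hb => by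
        obtain ⟨n, hn⟩ := hb.exists
        exact hn.trans (hstep n)

/-- Holley–Stroock perturbation: a probability density `p = w ρ_β` with `m ≤ w ≤ B` satisfies the
logarithmic Sobolev inequality of `ρ_β` up to the factor `B / m`. -/
theorem integral_log_div_mul_le_of_perturbation {w q : Act d → ℝ} {m B : ℝ} (hm : 0 < m)
    (hw : ∀ a, w a ∈ Icc m B) (hwc : ContDiff ℝ 1 w) (hw1 : ∫ a, w a * M.gaussDens a = 1)
    (hq : ContDiff ℝ 1 q) (hq0 : ∀ a, 0 < q a) (hqi : Integrable q) (hq1 : ∫ a, q a = 1)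
    (hE : Integrable fun a => Real.log (q a / (w a * M.gaussDens a)) * q a)
    (hI : Integrable fun a =>
      ‖gradient (fun b => Real.log (q b / (w b * M.gaussDens b))) a‖ ^ 2 * q a) :
    ∫ a, Real.log (q a / (w a * M.gaussDens a)) * q a ≤
      B / m * (M.τ / (2 * M.β)) *
        ∫ a, ‖gradient (fun b => Real.log (q b / (w b * M.gaussDens b))) a‖ ^ 2 * q a := by
  have hτ := M.τ_pos; have hβ := M.β_pos
  have hρ0 := M.gaussDens_pos
  have hw0 : ∀ a, 0 < w a := fun a => hm.trans_le (hw a).1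
  have hB0 : 0 < B := (hw0 0).trans_le (hw 0).2
  set f : Act d → ℝ := fun a => q a / (w a * M.gaussDens a) with hfdef
  have hf0 : ∀ a, 0 < f a := fun a => div_pos (hq0 a) (mul_pos (hw0 a) (hρ0 a))
  have hfc : ContDiff ℝ 1 f := hq.div (hwc.mul M.contDiff_gaussDens)
    fun a => (mul_pos (hw0 a) (hρ0 a)).ne'
  have hwm : Measurable w := hwc.continuous.measurable
  have hfm : Measurable f := hfc.continuous.measurable
  have hfρ : ∀ a, f a * M.gaussDens a = q a / w a := fun a => by
    have := hw0 a; have := hρ0 a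
    simp only [hfdef]; field_simp
  have hfi : Integrable f M.gaussRef := by
    rw [integrable_gaussRef_iff]
    simp only [hfρ]
    refine Integrable.mono' (hqi.const_mul m⁻¹)
      (hq.continuous.measurable.div hwm).aestronglyMeasurable (ae_of_all _ fun a => ?_)
    have := hw0 a; have := hq0 a
    rw [Real.norm_of_nonneg (by positivity), div_eq_inv_mul]
    gcongr; exact (hw a).1
  have hlsi := M.gaussRef_lsi hfc hf0 hfi
  set c := ∫ b, f b ∂M.gaussRef with hc
  have hc0 : 0 < c := by
    rw [hc, integral_pos_iff_support_of_nonneg (fun a => (hf0 a).le) hfi]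
    have : Function.support f = univ := eq_univ_of_forall fun a => (hf0 a).ne'
    simp [this]
  set e : Act d → ℝ := fun a => f a * Real.log (f a) - f a * Real.log c - f a + c with he
  have he0 : ∀ a, 0 ≤ e a := fun a => entropy_integrand_nonneg (hf0 a) hc0
  have hem : Measurable e :=
    (((hfm.mul hfm.log).sub (hfm.mul_const _)).sub hfm).add_const _
  have hgrad : ∀ a, ‖gradient f a‖ ^ 2 / f a * (w a * M.gaussDens a) =
      ‖gradient (fun b => Real.log (f b)) a‖ ^ 2 * q a := fun a => by
    have h1 := hw0 a; have h2 := hρ0 a; have h3 := hf0 a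
    rw [(Real.hasDerivAt_log h3.ne').gradient_comp (hfc.differentiable one_ne_zero a), norm_smul,
      Real.norm_of_nonneg (by positivity)]
    have : q a = f a * (w a * M.gaussDens a) := by simp only [hfdef]; field_simp
    rw [this]; field_simp
  have hgm := measurable_norm_sq_gradient f
  have hwi : Integrable fun a => w a * M.gaussDens a := by
    -- a non-integrable function would have integral zero
    by_contra h
    rw [integral_undef h] at hw1
    exact zero_ne_one hw1
  -- The entropy with respect to `p` is at most the integral of the nonnegative integrand `e`.
  have hew : ∀ a, e a * (w a * M.gaussDens a) = Real.log (f a) * q a - q a * Real.log c - q a +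
      c * (w a * M.gaussDens a) := fun a => by
    have h1 := hw0 a; have h2 := hρ0 a
    have : q a = f a * (w a * M.gaussDens a) := by simp only [hfdef]; field_simp
    rw [this]; simp only [he]; ring
  have i2 : Integrable (fun a => Real.log (f a) * q a - q a * Real.log c) :=
    hE.sub (hqi.mul_const _)
  have i3 : Integrable (fun a => Real.log (f a) * q a - q a * Real.log c - q a) := i2.sub hqi
  have hei : Integrable fun a => e a * (w a * M.gaussDens a) := by
    simp only [hew]; exact i3.add (hwi.const_mul c)
  have h1 : ∫ a, Real.log (f a) * q a ≤ ∫ a, e a * (w a * M.gaussDens a) := by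
    simp only [hew]
    rw [integral_add i3 (hwi.const_mul c), integral_sub i2 hqi, integral_sub hE (hqi.mul_const _),
      integral_mul_const, integral_const_mul, hq1, hw1]
    have := Real.log_le_sub_one_of_pos hc0
    linarith
  refine h1.trans ?_
  rw [← integral_const_mul]
  have hrhs0 : ∀ a, 0 ≤ B / m * (M.τ / (2 * M.β)) *
      (‖gradient (fun b => Real.log (f b)) a‖ ^ 2 * q a) := fun a => by
    have := hq0 a; positivity
  rw [← ENNReal.ofReal_le_ofReal_iff (integral_nonneg hrhs0),
    ofReal_integral_eq_lintegral_ofReal hei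
      (ae_of_all _ fun a => mul_nonneg (he0 a) (mul_pos (hw0 a) (hρ0 a)).le),
    ofReal_integral_eq_lintegral_ofReal (hI.const_mul _) (ae_of_all _ hrhs0)]
  calc ∫⁻ a, ENNReal.ofReal (e a * (w a * M.gaussDens a))
      ≤ ∫⁻ a, ENNReal.ofReal B * (ENNReal.ofReal (M.gaussDens a) * ENNReal.ofReal (e a)) := by
        refine lintegral_mono fun a => ?_
        rw [← ENNReal.ofReal_mul (hρ0 a).le, ← ENNReal.ofReal_mul hB0.le]
        refine ENNReal.ofReal_le_ofReal ?_
        have := he0 a; have := hρ0 a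
        calc e a * (w a * M.gaussDens a) ≤ e a * (B * M.gaussDens a) := by
              gcongr; exact (hw a).2
          _ = _ := by ring
    _ = ENNReal.ofReal B * ∫⁻ a, ENNReal.ofReal (e a) ∂M.gaussRef := by
        have hm' : Measurable fun a => ENNReal.ofReal (M.gaussDens a) * ENNReal.ofReal (e a) :=
          M.measurable_gaussDens.ennreal_ofReal.mul hem.ennreal_ofReal
        rw [lintegral_const_mul _ hm', ← M.lintegral_gaussRef hem.ennreal_ofReal]
    _ ≤ ENNReal.ofReal B *
        ∫⁻ a, ENNReal.ofReal (M.τ / (2 * M.β) * (‖gradient f a‖ ^ 2 / f a)) ∂M.gaussRef := by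
        gcongr
    _ = ∫⁻ a, ENNReal.ofReal B * (ENNReal.ofReal (M.gaussDens a) *
        ENNReal.ofReal (M.τ / (2 * M.β) * (‖gradient f a‖ ^ 2 / f a))) := by
        have hm' : Measurable fun a => ENNReal.ofReal (M.τ / (2 * M.β) *
          (‖gradient f a‖ ^ 2 / f a)) := ((hgm.div hfm).const_mul _).ennreal_ofReal
        have hm2 : Measurable fun a => ENNReal.ofReal (M.gaussDens a) *
            ENNReal.ofReal (M.τ / (2 * M.β) * (‖gradient f a‖ ^ 2 / f a)) :=
          M.measurable_gaussDens.ennreal_ofReal.mul hm'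
        rw [lintegral_const_mul _ hm2, ← M.lintegral_gaussRef hm']
    _ ≤ _ := by
        refine lintegral_mono fun a => ?_
        rw [← ENNReal.ofReal_mul (hρ0 a).le, ← ENNReal.ofReal_mul hB0.le]
        refine ENNReal.ofReal_le_ofReal ?_
        rw [← hgrad]
        have := hf0 a; have := hρ0 a
        have h5 : 1 ≤ w a / m := by rw [le_div_iff₀ hm, one_mul]; exact (hw a).1
        calc B * (M.gaussDens a * (M.τ / (2 * M.β) * (‖gradient f a‖ ^ 2 / f a)))
            = B * (M.gaussDens a * (M.τ / (2 * M.β) * (‖gradient f a‖ ^ 2 / f a))) * 1 :=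
              (mul_one _).symm
          _ ≤ B * (M.gaussDens a * (M.τ / (2 * M.β) * (‖gradient f a‖ ^ 2 / f a))) * (w a / m) := by
              gcongr
          _ = _ := by field_simp

end EntropyMDP

/-! ### Bounded measurable functions and contractions on them -/

section Contraction

variable {S : Type*} [MeasurableSpace S]

/-- Bounded measurable real functions. -/
def IsBddMeasurable (V : S → ℝ) : Prop := Measurable V ∧ ∃ C, ∀ s, |V s| ≤ C

theorem IsBddMeasurable.integrable {V : S → ℝ} (hV : IsBddMeasurable V) (μ : Measure S)
    [IsFiniteMeasure μ] : Integrable V μ := by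
  obtain ⟨hm, C, hC⟩ := hV
  exact Integrable.of_bound hm.aestronglyMeasurable C (ae_of_all _ hC)

theorem IsBddMeasurable.abs_sub_le {V W : S → ℝ} (hV : IsBddMeasurable V)
    (hW : IsBddMeasurable W) : ∃ C, ∀ s, |V s - W s| ≤ C := by
  obtain ⟨-, C, hC⟩ := hV
  obtain ⟨-, D, hD⟩ := hW
  exact ⟨C + D, fun s => (abs_sub _ _).trans (add_le_add (hC s) (hD s))⟩

/-- A map of functions on `S` that preserves bounded measurable functions and contracts the
supremum distance between them by the factor `γ`. -/
structure IsSupContraction (Φ : (S → ℝ) → S → ℝ) (γ : ℝ) : Prop where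
  maps : ∀ V, IsBddMeasurable V → IsBddMeasurable (Φ V)
  contract : ∀ V W, IsBddMeasurable V → IsBddMeasurable W → ∀ C, (∀ s, |V s - W s| ≤ C) →
    ∀ s, |Φ V s - Φ W s| ≤ γ * C

theorem IsSupContraction.eq_of_fixed {Φ : (S → ℝ) → S → ℝ} {γ : ℝ} (h : IsSupContraction Φ γ)
    (h0 : 0 ≤ γ) (h1 : γ < 1) {V W : S → ℝ} (hV : IsBddMeasurable V) (hW : IsBddMeasurable W)
    (hVf : Φ V = V) (hWf : Φ W = W) : V = W := by
  obtain ⟨C, hC⟩ := hV.abs_sub_le hW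
  have hn : ∀ n : ℕ, ∀ s, |V s - W s| ≤ γ ^ n * C := by
    intro n
    induction n with
    | zero => simpa using hC
    | succ n ih =>
      intro s
      have := h.contract V W hV hW _ ih s
      rw [hVf, hWf] at this
      rw [pow_succ']; linarith
  funext s
  have hlim : Tendsto (fun n => γ ^ n * C) atTop (𝓝 0) := by
    simpa using (tendsto_pow_atTop_nhds_zero_of_lt_one h0 h1).mul_const C
  have := ge_of_tendsto' hlim fun n => hn n s
  exact sub_eq_zero.1 (abs_nonpos_iff.1 this)

/-- Picard iteration, with pointwise limits to preserve measurability. -/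
theorem IsSupContraction.exists_fixed {Φ : (S → ℝ) → S → ℝ} {γ : ℝ} (h : IsSupContraction Φ γ)
    (h0 : 0 ≤ γ) (h1 : γ < 1) : ∃ V, IsBddMeasurable V ∧ Φ V = V := by
  set u : ℕ → S → ℝ := fun n => Φ^[n] 0 with hu
  have hus : ∀ n, u (n + 1) = Φ (u n) := fun n => Function.iterate_succ_apply' Φ n 0
  have hub : ∀ n, IsBddMeasurable (u n) := by
    intro n
    induction n with
    | zero => exact ⟨measurable_const, 0, fun s => by simp [hu]⟩
    | succ n ih => rw [hus]; exact h.maps _ ih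
  obtain ⟨C, hC⟩ := (hub 0).abs_sub_le (hub 1)
  have hd : ∀ n s, dist (u n s) (u (n + 1) s) ≤ C * γ ^ n := by
    intro n
    induction n with
    | zero => simpa [Real.dist_eq] using hC
    | succ n ih =>
      intro s
      rw [Real.dist_eq, hus n, hus (n + 1)]
      have := h.contract _ _ (hub n) (hub (n + 1)) (C * γ ^ n) ih s
      rw [hus n] at this
      rw [pow_succ']; rw [hus n]; linarith
  have hcs : ∀ s, ∃ l, Tendsto (fun n => u n s) atTop (𝓝 l) := fun s =>
    cauchySeq_tendsto_of_complete (cauchySeq_of_le_geometric γ C h1 fun n => hd n s)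
  choose V hV using hcs
  have hdist : ∀ n s, |u n s - V s| ≤ C * γ ^ n / (1 - γ) := fun n s =>
    dist_le_of_le_geometric_of_tendsto γ C h1 (fun n => hd n s) (hV s) n
  have hVb : IsBddMeasurable V := by
    refine ⟨measurable_of_tendsto_metrizable (fun n => (hub n).1) (tendsto_pi_nhds.2 hV),
      C * γ ^ 0 / (1 - γ), fun s => ?_⟩
    have := hdist 0 s
    simpa [hu] using this
  refine ⟨V, hVb, funext fun s => ?_⟩
  have h2 : ∀ n, |Φ V s - u (n + 1) s| ≤ γ * (C * γ ^ n / (1 - γ)) := fun n => by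
    rw [hus]
    exact h.contract _ _ hVb (hub n) _ (fun s => by rw [abs_sub_comm]; exact hdist n s) s
  have hlim : Tendsto (fun n : ℕ => γ * (C * γ ^ n / (1 - γ))) atTop (𝓝 0) := by
    have := (((tendsto_pow_atTop_nhds_zero_of_lt_one h0 h1).const_mul C).div_const
      (1 - γ)).const_mul γ
    simpa using this
  have h3 : Tendsto (fun n => |Φ V s - u (n + 1) s|) atTop (𝓝 0) :=
    squeeze_zero (fun n => abs_nonneg _) h2 hlim
  have h4 : Tendsto (fun n => u (n + 1) s) atTop (𝓝 (Φ V s)) := by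
    rw [tendsto_iff_dist_tendsto_zero]
    simpa [Real.dist_eq, abs_sub_comm] using h3
  exact tendsto_nhds_unique h4 ((tendsto_add_atTop_iff_nat 1).2 (hV s))

end Contraction

theorem abs_integral_le_of_abs_le {X : Type*} [MeasurableSpace X] {μ : Measure X}
    [IsProbabilityMeasure μ] {f : X → ℝ} {C : ℝ} (h : ∀ x, |f x| ≤ C) : |∫ x, f x ∂μ| ≤ C := by
  have := norm_integral_le_of_norm_le_const (μ := μ) (f := f) (ae_of_all _ h)
  simpa using this

/-- A series of functions whose `L¹` norms are dominated by a convergent geometric series converges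
almost everywhere to an integrable function and may be integrated termwise. -/
theorem hasSum_integral_of_geometric {Ω : Type*} [MeasurableSpace Ω] {μ : Measure Ω}
    {F : ℕ → Ω → ℝ} {r C : ℝ} (hr0 : 0 ≤ r) (hr1 : r < 1) (hFm : ∀ n, Measurable (F n))
    (hFi : ∀ n, Integrable (F n) μ) (hF : ∀ n, ∫ ω, ‖F n ω‖ ∂μ ≤ r ^ n * C) :
    (∀ᵐ ω ∂μ, Summable fun n => F n ω) ∧ Integrable (fun ω => ∑' n, F n ω) μ ∧
      HasSum (fun n => ∫ ω, F n ω ∂μ) (∫ ω, ∑' n, F n ω ∂μ) := by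
  have hsum : Summable fun n => ∫ ω, ‖F n ω‖ ∂μ :=
    Summable.of_nonneg_of_le (fun n => integral_nonneg fun ω => norm_nonneg _) hF
      ((summable_geometric_of_lt_one hr0 hr1).mul_right C)
  have hlt : ∫⁻ ω, ∑' n, ‖F n ω‖ₑ ∂μ ≠ ∞ := by
    rw [lintegral_tsum fun n => (hFm n).enorm.aemeasurable]
    have : ∀ n, ∫⁻ ω, ‖F n ω‖ₑ ∂μ = ENNReal.ofReal (∫ ω, ‖F n ω‖ ∂μ) := fun n =>
      (ofReal_integral_norm_eq_lintegral_enorm (hFi n)).symm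
    simp only [this]
    exact hsum.tsum_ofReal_ne_top
  have hae : ∀ᵐ ω ∂μ, Summable fun n => F n ω := by
    filter_upwards [ae_lt_top (Measurable.tsum fun n => (hFm n).enorm) hlt] with ω hω
    refine Summable.of_norm ?_
    have := ENNReal.summable_toReal hω.ne
    simpa using this
  refine ⟨hae, ⟨aestronglyMeasurable_of_tendsto_ae atTop
      (f := fun n ω => ∑ i ∈ Finset.range n, F i ω)
      (fun n => (Finset.measurable_sum _ fun i _ => hFm i).aestronglyMeasurable)
      (hae.mono fun ω hω => hω.hasSum.tendsto_sum_nat), ?_⟩,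
    hasSum_integral_of_summable_integral_norm hFi hsum⟩
  exact (lintegral_mono fun ω => enorm_tsum_le_tsum_enorm).trans_lt (lt_top_iff_ne_top.2 hlt)

theorem integral_measure_comp {X Y : Type*} [MeasurableSpace X] [MeasurableSpace Y]
    {μ : Measure X} {κ : Kernel X Y} {f : Y → ℝ} (hf : Integrable f (κ ∘ₘ μ)) :
    ∫ y, f y ∂(κ ∘ₘ μ) = ∫ x, ∫ y, f y ∂κ x ∂μ := by
  rw [Measure.comp_eq_comp_const_apply] at hf ⊢
  rw [Kernel.integral_comp hf, Kernel.const_apply]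

namespace Policy

variable {S : Type*} [MeasurableSpace S] {d : ℕ} (π : Policy S d)

theorem measurable_density_right (s : S) : Measurable (π.density s) :=
  π.measurable_density.comp measurable_prodMk_left

theorem integrable_kernel_iff (s : S) {f : Act d → ℝ} :
    Integrable f (π.kernel s) ↔ Integrable fun a => f a * π.density s a := by
  rw [kernel_apply, integrable_withDensity_iff (π.measurable_density_right s).ennreal_ofReal
    (ae_of_all _ fun _ => ENNReal.ofReal_lt_top)]
  simp only [ENNReal.toReal_ofReal (π.density_nonneg s _)]

theorem integral_kernel (s : S) (f : Act d → ℝ) :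
    ∫ a, f a ∂(π.kernel s) = ∫ a, f a * π.density s a := by
  rw [kernel_apply, integral_withDensity_eq_integral_toReal_smul
    (π.measurable_density_right s).ennreal_ofReal (ae_of_all _ fun _ => ENNReal.ofReal_lt_top)]
  simp only [ENNReal.toReal_ofReal (π.density_nonneg s _), smul_eq_mul, mul_comm]

theorem integrable_density (s : S) : Integrable (π.density s) := by
  simpa using (π.integrable_kernel_iff s (f := fun _ => 1)).1 (integrable_const _)

theorem integral_density (s : S) : ∫ a, π.density s a = 1 := by
  simpa using (π.integral_kernel s fun _ => 1).symm

theorem ae_kernel_density_pos (s : S) : ∀ᵐ a ∂(π.kernel s), 0 < π.density s a := by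
  rw [kernel_apply, ae_withDensity_iff (π.measurable_density_right s).ennreal_ofReal]
  exact ae_of_all _ fun a ha => by simpa using ha

end Policy

namespace EntropyMDP

variable {S : Type*} [MeasurableSpace S] {d : ℕ} (M : EntropyMDP S d)

/-! ### Rollouts, values and the policy evaluation equation -/

/-- The law of the state at time `n` under the policy `π`, started from `μ`. -/
noncomputable def stateLaw (π : Policy S d) (μ : Measure S) : ℕ → Measure S
  | 0 => μ
  | n + 1 => M.P ∘ₘ (stateLaw π μ n ⊗ₘ π.kernel)

instance isProbabilityMeasure_stateLaw (π : Policy S d) (μ : Measure S) [IsProbabilityMeasure μ]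
    (n : ℕ) : IsProbabilityMeasure (M.stateLaw π μ n) := by
  induction n with
  | zero => assumption
  | succ n ih => unfold stateLaw; infer_instance

/-- The state-action pair at time `n` of a rollout has law `stateLaw n ⊗ π`. -/
theorem map_rollout (π : Policy S d) (μ : Measure S) [IsProbabilityMeasure μ] (n : ℕ) :
    (M.rollout π μ).map (fun ω => ω n) = M.stateLaw π μ n ⊗ₘ π.kernel := by
  induction n with
  | zero =>
    have h : (fun ω : ℕ → S × Act d => ω 0) =
        (fun x : (_ : Finset.Iic 0) → S × Act d => x ⟨0, Finset.mem_Iic.2 le_rfl⟩) ∘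
          Preorder.frestrictLe 0 := rfl
    rw [h, ← Measure.map_map (by fun_prop) (by fun_prop), rollout, Kernel.trajMeasure,
      Measure.map_comp _ _ (by fun_prop), Kernel.traj_map_frestrictLe, Kernel.partialTraj_self,
      Measure.id_comp, Measure.map_map (by fun_prop) (by fun_prop)]
    exact Measure.map_id
  | succ n ih =>
    have key := Kernel.map_frestrictLe_trajMeasure_compProd_eq_map_trajMeasure
      (X := fun _ => S × Act d) (μ₀ := μ ⊗ₘ π.kernel) (κ := M.historyKernel π) (a := n)
    have h1 := congrArg Measure.snd key
    rw [Measure.snd_compProd, Measure.snd_map_prodMk (by fun_prop)] at h1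
    change _ = (M.rollout π μ).map (fun ω => ω (n + 1)) at h1
    rw [← h1, historyKernel, ← Kernel.comp_deterministic_eq_comap, ← Measure.comp_assoc,
      Measure.deterministic_comp_eq_map, Measure.map_map (by fun_prop) (by fun_prop)]
    change M.stepKernel π ∘ₘ (M.rollout π μ).map (fun ω => ω n) = _
    rw [ih, stepKernel, ← Measure.comp_assoc, ← Measure.compProd_eq_comp_prod]
    rfl

/-- The expectation of `V` at the next state. -/
noncomputable def next (V : S → ℝ) (x : S × Act d) : ℝ := ∫ s', V s' ∂(M.P x)

theorem measurable_next {V : S → ℝ} (hV : Measurable V) : Measurable (M.next V) :=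
  (hV.stronglyMeasurable.integral_kernel (κ := M.P)).measurable

theorem abs_next_le {V : S → ℝ} {C : ℝ} (hV : ∀ s, |V s| ≤ C) (x : S × Act d) :
    |M.next V x| ≤ C :=
  abs_integral_le_of_abs_le hV

theorem next_sub {V W : S → ℝ} (hV : IsBddMeasurable V) (hW : IsBddMeasurable W)
    (x : S × Act d) : M.next V x - M.next W x = M.next (fun s => V s - W s) x :=
  (integral_sub (hV.integrable _) (hW.integrable _)).symm

/-- The policy evaluation operator of `π`. -/
noncomputable def policyOp (π : Policy S d) (V : S → ℝ) (s : S) : ℝ :=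
  ∫ a, (M.softReward π (s, a) + M.γ * M.next V (s, a)) ∂(π.kernel s)

theorem measurable_softReward (π : Policy S d) : Measurable (M.softReward π) := by
  unfold softReward
  exact (M.measurable_r.sub ((measurable_snd.norm.pow_const 2).const_mul _)).sub
    (π.measurable_density.log.const_mul _)

/-- The regularized reward is integrable against `π(· | s)`, uniformly in the state. -/
def HasBddReward (π : Policy S d) : Prop :=
  ∃ C, ∀ s, Integrable (fun a => M.softReward π (s, a)) (π.kernel s) ∧
    ∫ a, ‖M.softReward π (s, a)‖ ∂(π.kernel s) ≤ C

variable {M} {π : Policy S d}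

theorem HasBddReward.integrable_compProd (h : M.HasBddReward π) (ν : Measure S)
    [IsProbabilityMeasure ν] : Integrable (M.softReward π) (ν ⊗ₘ π.kernel) := by
  obtain ⟨C, hC⟩ := h
  rw [Measure.integrable_compProd_iff (M.measurable_softReward π).aestronglyMeasurable]
  refine ⟨ae_of_all _ fun s => (hC s).1, Integrable.of_bound
    (((M.measurable_softReward π).norm.stronglyMeasurable.integral_kernel_prod_right'
      (κ := π.kernel)).aestronglyMeasurable) C (ae_of_all _ fun s => ?_)⟩
  rw [Real.norm_of_nonneg (integral_nonneg fun a => norm_nonneg _)]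
  exact (hC s).2

theorem integrable_next_kernel {V : S → ℝ} (hV : IsBddMeasurable V) (s : S) :
    Integrable (fun a => M.next V (s, a)) (π.kernel s) := by
  obtain ⟨hm, C, hC⟩ := hV
  exact Integrable.of_bound
    ((M.measurable_next hm).comp measurable_prodMk_left).aestronglyMeasurable C
    (ae_of_all _ fun a => M.abs_next_le hC _)

theorem HasBddReward.isSupContraction_policyOp (h : M.HasBddReward π) :
    IsSupContraction (M.policyOp π) M.γ where
  maps V hV := by
    obtain ⟨C, hC⟩ := h
    obtain ⟨D, hD⟩ := hV.2
    refine ⟨?_, C + M.γ * D, fun s => ?_⟩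
    · exact (((M.measurable_softReward π).add
        ((M.measurable_next hV.1).const_mul M.γ)).stronglyMeasurable.integral_kernel_prod_right'
          (κ := π.kernel)).measurable
    · have hγ := M.γ_pos
      rw [policyOp, integral_add (hC s).1 ((integrable_next_kernel hV s).const_mul _)]
      refine (abs_add_le _ _).trans
        (add_le_add ((norm_integral_le_integral_norm _).trans (hC s).2) ?_)
      rw [integral_const_mul, abs_mul, abs_of_pos hγ]
      gcongr
      exact abs_integral_le_of_abs_le fun a => M.abs_next_le hD (s, a)
  contract V W hV hW C hC s := by
    obtain ⟨B, hB⟩ := h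
    have hγ := M.γ_pos
    have hV' := (integrable_next_kernel (π := π) (M := M) hV s)
    have hW' := (integrable_next_kernel (π := π) (M := M) hW s)
    rw [policyOp, policyOp, integral_add (hB s).1 (hV'.const_mul _),
      integral_add (hB s).1 (hW'.const_mul _), add_sub_add_left_eq_sub, integral_const_mul,
      integral_const_mul, ← mul_sub, abs_mul, abs_of_pos hγ, ← integral_sub hV' hW']
    gcongr
    simp only [M.next_sub hV hW]
    exact abs_integral_le_of_abs_le fun a => M.abs_next_le hC (s, a)

/-- The expected regularized reward at time `n`, for a bounded fixed point of policy evaluation. -/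
theorem HasBddReward.integral_softReward_stateLaw (h : M.HasBddReward π) {W : S → ℝ}
    (hW : IsBddMeasurable W) (hWf : M.policyOp π W = W) (μ : Measure S) [IsProbabilityMeasure μ]
    (n : ℕ) : ∫ x, M.softReward π x ∂(M.stateLaw π μ n ⊗ₘ π.kernel) =
      ∫ s, W s ∂(M.stateLaw π μ n) - M.γ * ∫ s, W s ∂(M.stateLaw π μ (n + 1)) := by
  set ν := M.stateLaw π μ n
  have i1 := h.integrable_compProd ν
  have i2 : Integrable (fun x => M.γ * M.next W x) (ν ⊗ₘ π.kernel) := by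
    obtain ⟨C, hC⟩ := hW.2
    exact (Integrable.of_bound (M.measurable_next hW.1).aestronglyMeasurable C
      (ae_of_all _ fun x => M.abs_next_le hC x)).const_mul _
  have e1 : ∫ x, (M.softReward π x + M.γ * M.next W x) ∂(ν ⊗ₘ π.kernel) = ∫ s, W s ∂ν := by
    rw [Measure.integral_compProd (f := fun x => M.softReward π x + M.γ * M.next W x) (i1.add i2)]
    exact integral_congr_ae (ae_of_all _ fun s => congrFun hWf s)
  have e2 : ∫ s, W s ∂(M.stateLaw π μ (n + 1)) = ∫ x, M.next W x ∂(ν ⊗ₘ π.kernel) :=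
    integral_measure_comp (hW.integrable _)
  rw [integral_add i1 i2, integral_const_mul] at e1
  rw [e2]; linarith

theorem measurePreserving_rollout (μ : Measure S) [IsProbabilityMeasure μ] (n : ℕ) :
    MeasurePreserving (fun ω : ℕ → S × Act d => ω n) (M.rollout π μ)
      (M.stateLaw π μ n ⊗ₘ π.kernel) :=
  ⟨measurable_pi_apply n, M.map_rollout π μ n⟩

theorem HasBddReward.integrable_softReward_rollout (h : M.HasBddReward π) (μ : Measure S)
    [IsProbabilityMeasure μ] (n : ℕ) :
    Integrable (fun ω => M.softReward π (ω n)) (M.rollout π μ) := by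
  have h1 := h.integrable_compProd (M.stateLaw π μ n)
  rw [← (measurePreserving_rollout μ n).map_eq] at h1
  exact (integrable_map_measure (M.measurable_softReward π).aestronglyMeasurable
    (measurable_pi_apply n).aemeasurable).1 h1

theorem integral_rollout_eval {f : S × Act d → ℝ} (hf : Measurable f) (μ : Measure S)
    [IsProbabilityMeasure μ] (n : ℕ) :
    ∫ ω, f (ω n) ∂(M.rollout π μ) = ∫ x, f x ∂(M.stateLaw π μ n ⊗ₘ π.kernel) := by
  rw [← (measurePreserving_rollout μ n).map_eq, integral_map (measurable_pi_apply n).aemeasurable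
    hf.aestronglyMeasurable]

theorem HasBddReward.exists_integral_norm_rollout_le (h : M.HasBddReward π) (μ : Measure S)
    [IsProbabilityMeasure μ] :
    ∃ C, ∀ n, ∫ ω, ‖M.softReward π (ω n)‖ ∂(M.rollout π μ) ≤ C := by
  obtain ⟨C, hC⟩ := id h
  refine ⟨C, fun n => ?_⟩
  rw [integral_rollout_eval (M.measurable_softReward π).norm,
    Measure.integral_compProd (h.integrable_compProd _).norm]
  have hle : ∀ s, |∫ a, ‖M.softReward π (s, a)‖ ∂(π.kernel s)| ≤ C := fun s => by
    rw [abs_of_nonneg (integral_nonneg fun a => norm_nonneg _)]; exact (hC s).2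
  exact (le_abs_self _).trans (abs_integral_le_of_abs_le hle)

/-- A bounded fixed point of policy evaluation gives the expected returns from every initial law. -/
theorem HasBddReward.return_eq (h : M.HasBddReward π) {W : S → ℝ} (hW : IsBddMeasurable W)
    (hWf : M.policyOp π W = W) (μ : Measure S) [IsProbabilityMeasure μ] :
    M.FiniteReturn π μ ∧ ∫ ω, M.softReturn π ω ∂(M.rollout π μ) = ∫ s, W s ∂μ := by
  have hγ := M.γ_pos
  have hγ1 := M.γ_lt_one
  obtain ⟨C, hC⟩ := h.exists_integral_norm_rollout_le μ
  have hFn : ∀ n, ∫ ω, ‖M.γ ^ n * M.softReward π (ω n)‖ ∂(M.rollout π μ) ≤ M.γ ^ n * C :=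
    fun n => by
      simp only [norm_mul, norm_pow, Real.norm_of_nonneg hγ.le]
      rw [integral_const_mul]
      exact mul_le_mul_of_nonneg_left (hC n) (pow_nonneg hγ.le n)
  have key := hasSum_integral_of_geometric (μ := M.rollout π μ)
    (F := fun n ω => M.γ ^ n * M.softReward π (ω n)) hγ.le hγ1
    (fun n => ((M.measurable_softReward π).comp (measurable_pi_apply n)).const_mul _)
    (fun n => (h.integrable_softReward_rollout μ n).const_mul _) hFn
  refine ⟨⟨key.1, key.2.1⟩, ?_⟩
  -- The series of expected rewards telescopes.
  set w : ℕ → ℝ := fun n => ∫ s, W s ∂(M.stateLaw π μ n) with hw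
  have hterm : ∀ n, ∫ ω, M.γ ^ n * M.softReward π (ω n) ∂(M.rollout π μ) =
      M.γ ^ n * w n - M.γ ^ (n + 1) * w (n + 1) := fun n => by
    rw [integral_const_mul, integral_rollout_eval (M.measurable_softReward π),
      h.integral_softReward_stateLaw hW hWf, pow_succ]
    ring
  have hpart : ∀ N, ∑ n ∈ Finset.range N,
      ∫ ω, M.γ ^ n * M.softReward π (ω n) ∂(M.rollout π μ) = w 0 - M.γ ^ N * w N := fun N => by
    rw [Finset.sum_congr rfl fun n _ => hterm n,
      Finset.sum_range_sub' (fun n => M.γ ^ n * w n), pow_zero, one_mul]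
  obtain ⟨D, hD⟩ := hW.2
  have hwb : ∀ n, |w n| ≤ D := fun n => abs_integral_le_of_abs_le hD
  have hlim : Tendsto (fun N => w 0 - M.γ ^ N * w N) atTop (𝓝 (w 0 - 0)) := by
    refine tendsto_const_nhds.sub ?_
    refine squeeze_zero_norm (a := fun N => M.γ ^ N * D) (fun N => ?_) ?_
    · rw [norm_mul, norm_pow, Real.norm_of_nonneg hγ.le]
      exact mul_le_mul_of_nonneg_left (hwb N) (pow_nonneg hγ.le N)
    · simpa using (tendsto_pow_atTop_nhds_zero_of_lt_one hγ.le hγ1).mul_const D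
  rw [sub_zero] at hlim
  exact tendsto_nhds_unique (key.2.2.tendsto_sum_nat.congr hpart) hlim

theorem HasBddReward.hasFiniteValues (h : M.HasBddReward π) : M.HasFiniteValues π := by
  obtain ⟨W, hW, hWf⟩ := h.isSupContraction_policyOp.exists_fixed M.γ_pos.le M.γ_lt_one
  exact ⟨fun s => (h.return_eq hW hWf _).1, (h.return_eq hW hWf _).1⟩

theorem HasBddReward.value_eq (h : M.HasBddReward π) {W : S → ℝ} (hW : IsBddMeasurable W)
    (hWf : M.policyOp π W = W) : M.value π = W :=
  funext fun s => by
    rw [value, (h.return_eq hW hWf _).2, integral_dirac' _ _ hW.1.stronglyMeasurable]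

theorem HasBddReward.isBddMeasurable_value (h : M.HasBddReward π) :
    IsBddMeasurable (M.value π) := by
  obtain ⟨W, hW, hWf⟩ := h.isSupContraction_policyOp.exists_fixed M.γ_pos.le M.γ_lt_one
  rwa [h.value_eq hW hWf]

theorem HasBddReward.policyOp_value (h : M.HasBddReward π) :
    M.policyOp π (M.value π) = M.value π := by
  obtain ⟨W, hW, hWf⟩ := h.isSupContraction_policyOp.exists_fixed M.γ_pos.le M.γ_lt_one
  rwa [h.value_eq hW hWf]

theorem HasBddReward.J_eq (h : M.HasBddReward π) : M.J π = ∫ s, M.value π s ∂M.ρ₀ :=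
  (h.return_eq h.isBddMeasurable_value h.policyOp_value M.ρ₀).2

end EntropyMDP

/-! ### Admissible policies have bounded values -/

/-- A bounded function that is at most `A + γ C` whenever it is at most `C` is at most
`A / (1 - γ)`. -/
theorem le_div_one_sub_of_forall_le {S : Type*} [Nonempty S] {f : S → ℝ} {A γ : ℝ}
    (hγ1 : γ < 1) (hb : BddAbove (range f))
    (h : ∀ C, (∀ s, f s ≤ C) → ∀ s, f s ≤ A + γ * C) (s : S) : f s ≤ A / (1 - γ) := by
  have h1 : ∀ s, f s ≤ ⨆ s, f s := le_ciSup hb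
  have h2 : ⨆ s, f s ≤ A + γ * ⨆ s, f s := ciSup_le (h _ h1)
  refine (h1 s).trans ?_
  rw [le_div_iff₀ (by linarith)]
  linarith

namespace EntropyMDP

variable {S : Type*} [MeasurableSpace S] {d : ℕ} (M : EntropyMDP S d)

theorem nonempty_state (M : EntropyMDP S d) : Nonempty S := nonempty_of_isProbabilityMeasure M.ρ₀

/-- The logarithm of the density of `π(· | s)` with respect to the Gaussian reference measure. -/
noncomputable def gaussLogRatio (π : Policy S d) (s : S) (a : Act d) : ℝ :=
  Real.log (π.density s a / M.gaussDens a)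

theorem measurable_ofReal_density_div (π : Policy S d) (s : S) :
    Measurable fun a => ENNReal.ofReal (π.density s a / M.gaussDens a) :=
  ((π.measurable_density_right s).div M.measurable_gaussDens).ennreal_ofReal

theorem kernel_eq_withDensity_gaussRef (π : Policy S d) (s : S) :
    π.kernel s = M.gaussRef.withDensity fun a =>
      ENNReal.ofReal (π.density s a / M.gaussDens a) := by
  have h : M.gaussRef = volume.withDensity fun a => ENNReal.ofReal (M.gaussDens a) := rfl
  rw [π.kernel_apply, h, ← withDensity_mul _ M.measurable_gaussDens.ennreal_ofReal
    (M.measurable_ofReal_density_div π s)]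
  congr 1
  funext a
  have := M.gaussDens_pos a
  rw [Pi.mul_apply, ← ENNReal.ofReal_mul this.le, mul_div_cancel₀ _ this.ne']

theorem kernel_absolutelyContinuous (π : Policy S d) (s : S) : π.kernel s ≪ M.gaussRef := by
  rw [M.kernel_eq_withDensity_gaussRef]
  exact withDensity_absolutelyContinuous _ _

theorem llr_ae_eq (π : Policy S d) (s : S) :
    llr (π.kernel s) M.gaussRef =ᵐ[π.kernel s] M.gaussLogRatio π s := by
  refine (M.kernel_absolutelyContinuous π s).ae_eq ?_
  have h := Measure.rnDeriv_withDensity M.gaussRef (M.measurable_ofReal_density_div π s)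
  rw [← M.kernel_eq_withDensity_gaussRef π s] at h
  filter_upwards [h] with a ha
  rw [llr, ha, gaussLogRatio,
    ENNReal.toReal_ofReal (div_nonneg (π.density_nonneg s a) (M.gaussDens_pos a).le)]

theorem integrable_gaussLogRatio {π : Policy S d} {s : S}
    (h : InformationTheory.klDiv (π.kernel s) M.gaussRef ≠ ∞) :
    Integrable (M.gaussLogRatio π s) (π.kernel s) :=
  (InformationTheory.klDiv_ne_top_iff.1 h).2.congr (M.llr_ae_eq π s)

theorem integral_gaussLogRatio (π : Policy S d) (s : S) :
    ∫ a, M.gaussLogRatio π s a ∂(π.kernel s) =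
      (InformationTheory.klDiv (π.kernel s) M.gaussRef).toReal := by
  rw [InformationTheory.toReal_klDiv_of_measure_eq (M.kernel_absolutelyContinuous π s) (by simp)]
  exact (integral_congr_ae (M.llr_ae_eq π s)).symm

/-- The `L¹` norm of the log-density exceeds the relative entropy by at most `2`, because the
negative part of `π log (π / ρ_β)` is at most `ρ_β`. -/
theorem integral_norm_gaussLogRatio_le {π : Policy S d} {s : S}
    (h : Integrable (M.gaussLogRatio π s) (π.kernel s)) :
    ∫ a, ‖M.gaussLogRatio π s a‖ ∂(π.kernel s) ≤ ∫ a, M.gaussLogRatio π s a ∂(π.kernel s) + 2 := by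
  have hn := h.norm
  rw [π.integrable_kernel_iff] at h hn
  rw [π.integral_kernel, π.integral_kernel]
  have hρ := M.integrable_gaussDens.const_mul 2
  calc ∫ a, ‖M.gaussLogRatio π s a‖ * π.density s a
      ≤ ∫ a, (M.gaussLogRatio π s a * π.density s a + 2 * M.gaussDens a) := by
        refine integral_mono hn (h.add hρ) fun a => ?_
        have hρ0 := M.gaussDens_pos a
        rcases (π.density_nonneg s a).eq_or_lt with h0 | h0
        · simp [← h0, hρ0.le]
        · have h1 := mul_log_le_sub_add h0 one_pos hρ0
          simp only [Real.log_one, mul_zero, one_mul, sub_zero] at h1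
          have h2 : M.gaussLogRatio π s a = Real.log (π.density s a) - Real.log (M.gaussDens a) :=
            Real.log_div h0.ne' hρ0.ne'
          dsimp only
          rw [Real.norm_eq_abs]
          rcases abs_cases (M.gaussLogRatio π s a) with ⟨h3, -⟩ | ⟨h3, -⟩ <;> rw [h3]
          · linarith
          · rw [h2]
            nlinarith
    _ = _ := by
        rw [integral_add h hρ, integral_const_mul, M.integral_gaussDens, mul_one]

/-- Relative to the Gaussian reference, the quadratic penalty is absorbed by the entropy. -/
theorem softReward_ae_eq (π : Policy S d) (s : S) :
    (fun a => M.softReward π (s, a)) =ᵐ[π.kernel s]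
      fun a => M.r (s, a) + M.τ * Real.log M.Zβ - M.τ * M.gaussLogRatio π s a := by
  filter_upwards [π.ae_kernel_density_pos s] with a ha
  have hτ := M.τ_pos
  rw [softReward, gaussLogRatio, Real.log_div ha.ne' (M.gaussDens_pos a).ne', M.log_gaussDens]
  field_simp
  ring

variable {M} {Rmax : ℝ}

theorem integrable_reward (hr : ∀ x, |M.r x| ≤ Rmax) (π : Policy S d) (s : S) :
    Integrable (fun a => M.r (s, a)) (π.kernel s) :=
  Integrable.of_bound (M.measurable_r.comp measurable_prodMk_left).aestronglyMeasurable Rmax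
    (ae_of_all _ fun _ => hr _)

theorem integrable_softReward (hr : ∀ x, |M.r x| ≤ Rmax) {π : Policy S d} {s : S}
    (h : Integrable (M.gaussLogRatio π s) (π.kernel s)) :
    Integrable (fun a => M.softReward π (s, a)) (π.kernel s) :=
  (((integrable_reward hr π s).add (integrable_const _)).sub (h.const_mul _)).congr
    (M.softReward_ae_eq π s).symm

theorem integral_softReward (hr : ∀ x, |M.r x| ≤ Rmax) {π : Policy S d} {s : S}
    (h : Integrable (M.gaussLogRatio π s) (π.kernel s)) :
    ∫ a, M.softReward π (s, a) ∂(π.kernel s) = ∫ a, M.r (s, a) ∂(π.kernel s) +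
      M.τ * Real.log M.Zβ - M.τ * ∫ a, M.gaussLogRatio π s a ∂(π.kernel s) := by
  have hi := integrable_reward hr π s
  rw [integral_congr_ae (M.softReward_ae_eq π s),
    integral_sub (f := fun a => M.r (s, a) + M.τ * Real.log M.Zβ) (hi.add (integrable_const _))
      (h.const_mul _), integral_add hi (integrable_const _),
    integral_const_mul M.τ (M.gaussLogRatio π s)]
  simp

theorem hasBddReward_of_klDiv_le (hr : ∀ x, |M.r x| ≤ Rmax) {π : Policy S d} {K : ℝ} (hK : 0 ≤ K)
    (h : ∀ s, InformationTheory.klDiv (π.kernel s) M.gaussRef ≤ ENNReal.ofReal K) :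
    M.HasBddReward π := by
  have hτ := M.τ_pos
  refine ⟨Rmax + M.τ * |Real.log M.Zβ| + M.τ * (K + 2), fun s => ?_⟩
  have hi := M.integrable_gaussLogRatio ((h s).trans_lt ENNReal.ofReal_lt_top).ne
  refine ⟨integrable_softReward hr hi, ?_⟩
  have h1 := M.integral_norm_gaussLogRatio_le hi
  rw [M.integral_gaussLogRatio] at h1
  have h2 := ENNReal.toReal_le_of_le_ofReal hK (h s)
  calc ∫ a, ‖M.softReward π (s, a)‖ ∂(π.kernel s)
      ≤ ∫ a, (Rmax + M.τ * |Real.log M.Zβ| + M.τ * ‖M.gaussLogRatio π s a‖) ∂(π.kernel s) := by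
        refine integral_mono_ae (integrable_softReward hr hi).norm
          ((integrable_const _).add (hi.norm.const_mul _)) ?_
        filter_upwards [M.softReward_ae_eq π s] with a ha
        rw [ha]
        refine (norm_sub_le _ _).trans (add_le_add ((norm_add_le _ _).trans
          (add_le_add (hr _) ?_)) ?_)
        · rw [norm_mul, Real.norm_of_nonneg hτ.le, Real.norm_eq_abs]
        · rw [norm_mul, Real.norm_of_nonneg hτ.le]
    _ = Rmax + M.τ * |Real.log M.Zβ| + M.τ * ∫ a, ‖M.gaussLogRatio π s a‖ ∂(π.kernel s) := by
        rw [integral_add (integrable_const _) (hi.norm.const_mul _), integral_const_mul]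
        simp
    _ ≤ _ := by gcongr; linarith

theorem Admissible.exists_klDiv_le {π : Policy S d} (h : M.Admissible π) :
    ∃ K : ℝ, 0 ≤ K ∧ ∀ s, InformationTheory.klDiv (π.kernel s) M.gaussRef ≤ ENNReal.ofReal K := by
  refine ⟨(⨆ s, InformationTheory.klDiv (π.kernel s) M.gaussRef).toReal, ENNReal.toReal_nonneg,
    fun s => ?_⟩
  rw [ENNReal.ofReal_toReal (ne_of_lt h)]
  exact le_iSup (fun s => InformationTheory.klDiv (π.kernel s) M.gaussRef) s

theorem Admissible.hasBddReward (hr : ∀ x, |M.r x| ≤ Rmax) {π : Policy S d}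
    (h : M.Admissible π) : M.HasBddReward π := by
  obtain ⟨K, hK, hle⟩ := h.exists_klDiv_le
  exact hasBddReward_of_klDiv_le hr hK hle

theorem HasBddReward.value_apply {π : Policy S d} (h : M.HasBddReward π) (s : S) :
    M.value π s = ∫ a, M.softReward π (s, a) ∂(π.kernel s) +
      M.γ * ∫ a, M.next (M.value π) (s, a) ∂(π.kernel s) := by
  have hi := integrable_next_kernel (M := M) (π := π) h.isBddMeasurable_value s
  obtain ⟨C, hC⟩ := id h
  have := congrFun h.policyOp_value s
  rw [policyOp, integral_add (hC s).1 (hi.const_mul _), integral_const_mul] at this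
  exact this.symm

theorem next_le_of_forall_le {V : S → ℝ} (hV : IsBddMeasurable V) {C : ℝ} (h : ∀ s, V s ≤ C)
    (x : S × Act d) : M.next V x ≤ C := by
  have := integral_mono (hV.integrable (M.P x)) (integrable_const C) h
  simpa [next] using this

theorem le_next_of_forall_le {V : S → ℝ} (hV : IsBddMeasurable V) {C : ℝ} (h : ∀ s, C ≤ V s)
    (x : S × Act d) : C ≤ M.next V x := by
  have := integral_mono (integrable_const C) (hV.integrable (M.P x)) h
  simpa [next] using this

theorem value_le_of_klDiv_le (hr : ∀ x, |M.r x| ≤ Rmax) {π : Policy S d} {K : ℝ} (hK : 0 ≤ K)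
    (h : ∀ s, InformationTheory.klDiv (π.kernel s) M.gaussRef ≤ ENNReal.ofReal K) (s : S) :
    M.value π s ≤ (Rmax + M.τ * Real.log M.Zβ) / (1 - M.γ) := by
  have := nonempty_state M
  have hτ := M.τ_pos
  have hb := hasBddReward_of_klDiv_le hr hK h
  have hbv := hb.isBddMeasurable_value
  refine le_div_one_sub_of_forall_le M.γ_lt_one ?_ (fun C hC s => ?_) s
  · obtain ⟨C, hC⟩ := hbv.2
    exact ⟨C, by rintro _ ⟨s, rfl⟩; exact (le_abs_self _).trans (hC s)⟩
  · have hi := M.integrable_gaussLogRatio ((h s).trans_lt ENNReal.ofReal_lt_top).ne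
    rw [hb.value_apply s, integral_softReward hr hi, M.integral_gaussLogRatio]
    have h1 : ∫ a, M.r (s, a) ∂(π.kernel s) ≤ Rmax :=
      (le_abs_self _).trans (abs_integral_le_of_abs_le fun a => hr (s, a))
    have h2 : 0 ≤ M.τ * (InformationTheory.klDiv (π.kernel s) M.gaussRef).toReal := by positivity
    have h3 : ∫ a, M.next (M.value π) (s, a) ∂(π.kernel s) ≤ C := by
      have := integral_mono (integrable_next_kernel (M := M) (π := π) hbv s) (integrable_const C)
        fun a => next_le_of_forall_le hbv hC (s, a)
      simpa using this
    have h4 := mul_le_mul_of_nonneg_left h3 M.γ_pos.le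
    linarith

theorem neg_value_le_of_klDiv_le (hr : ∀ x, |M.r x| ≤ Rmax) {π : Policy S d} {K : ℝ} (hK : 0 ≤ K)
    (h : ∀ s, InformationTheory.klDiv (π.kernel s) M.gaussRef ≤ ENNReal.ofReal K) (s : S) :
    -M.value π s ≤ (Rmax - M.τ * Real.log M.Zβ + M.τ * K) / (1 - M.γ) := by
  have := nonempty_state M
  have hτ := M.τ_pos
  have hb := hasBddReward_of_klDiv_le hr hK h
  have hbv := hb.isBddMeasurable_value
  refine le_div_one_sub_of_forall_le (f := fun s => -M.value π s) M.γ_lt_one ?_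
    (fun C hC s => ?_) s
  · obtain ⟨C, hC⟩ := hbv.2
    exact ⟨C, by rintro _ ⟨s, rfl⟩; exact (neg_le_abs _).trans (hC s)⟩
  · have hi := M.integrable_gaussLogRatio ((h s).trans_lt ENNReal.ofReal_lt_top).ne
    rw [hb.value_apply s, integral_softReward hr hi, M.integral_gaussLogRatio]
    have h1 : -∫ a, M.r (s, a) ∂(π.kernel s) ≤ Rmax :=
      (neg_le_abs _).trans (abs_integral_le_of_abs_le fun a => hr (s, a))
    have h2 := mul_le_mul_of_nonneg_left (ENNReal.toReal_le_of_le_ofReal hK (h s)) hτ.le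
    have h3 : -C ≤ ∫ a, M.next (M.value π) (s, a) ∂(π.kernel s) := by
      have := integral_mono (integrable_const (-C))
        (integrable_next_kernel (M := M) (π := π) hbv s)
        fun a => le_next_of_forall_le hbv (fun s => neg_le.1 (hC s)) (s, a)
      simpa using this
    have h4 := mul_le_mul_of_nonneg_left h3 M.γ_pos.le
    linarith

/-! ### Gibbs densities and the soft optimality operator -/

theorem qOf_eq (V : S → ℝ) (s : S) (a : Act d) :
    M.qOf V s a = M.r (s, a) - M.β / 2 * ‖a‖ ^ 2 + M.γ * M.next V (s, a) := rfl

/-- The perturbation `exp ((r + γ P V) / τ)` that turns the Gaussian reference density into the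
unnormalized Gibbs density. -/
noncomputable def tilt (M : EntropyMDP S d) (V : S → ℝ) (s : S) (a : Act d) : ℝ :=
  Real.exp ((M.r (s, a) + M.γ * M.next V (s, a)) / M.τ)

/-- The normalization `∫ exp (Q_V(s, b) / τ) db` of the Gibbs density. -/
noncomputable def partition (M : EntropyMDP S d) (V : S → ℝ) (s : S) : ℝ :=
  ∫ b, Real.exp (M.qOf V s b / M.τ)

theorem exp_qOf_div (V : S → ℝ) (s : S) (a : Act d) :
    Real.exp (M.qOf V s a / M.τ) = M.Zβ * (M.tilt V s a * M.gaussDens a) := by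
  have hτ := M.τ_pos
  have hZ := M.Zβ_pos
  rw [tilt, gaussDens, mul_left_comm, ← mul_assoc M.Zβ, mul_inv_cancel₀ hZ.ne', one_mul,
    ← Real.exp_add, qOf_eq]
  congr 1
  field_simp
  ring

theorem measurable_qOf {V : S → ℝ} (hV : Measurable V) :
    Measurable fun x : S × Act d => M.qOf V x.1 x.2 :=
  (M.measurable_r.sub ((measurable_snd.norm.pow_const 2).const_mul _)).add
    ((M.measurable_next hV).const_mul _)

theorem measurable_exp_qOf {V : S → ℝ} (hV : Measurable V) :
    Measurable fun x : S × Act d => Real.exp (M.qOf V x.1 x.2 / M.τ) :=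
  ((M.measurable_qOf hV).div_const _).exp

theorem measurable_tilt {V : S → ℝ} (hV : Measurable V) (s : S) : Measurable (M.tilt V s) :=
  (((M.measurable_r.add ((M.measurable_next hV).const_mul _)).comp
    measurable_prodMk_left).div_const _).exp

theorem abs_reward_add_next_le (hr : ∀ x, |M.r x| ≤ Rmax) {V : S → ℝ} {C : ℝ}
    (hC : ∀ s, |V s| ≤ C) (x : S × Act d) : |M.r x + M.γ * M.next V x| ≤ Rmax + M.γ * C := by
  refine (abs_add_le _ _).trans (add_le_add (hr x) ?_)
  rw [abs_mul, abs_of_pos M.γ_pos]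
  exact mul_le_mul_of_nonneg_left (M.abs_next_le hC x) M.γ_pos.le

theorem tilt_mem_Icc (hr : ∀ x, |M.r x| ≤ Rmax) {V : S → ℝ} {C : ℝ} (hC : ∀ s, |V s| ≤ C) (s : S)
    (a : Act d) : M.tilt V s a ∈ Icc (Real.exp (-((Rmax + M.γ * C) / M.τ)))
      (Real.exp ((Rmax + M.γ * C) / M.τ)) := by
  have h := abs_le.1 (abs_reward_add_next_le hr hC (s, a))
  have hτ := M.τ_pos
  rw [← neg_div]
  exact ⟨Real.exp_le_exp.2 (div_le_div_of_nonneg_right h.1 hτ.le),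
    Real.exp_le_exp.2 (div_le_div_of_nonneg_right h.2 hτ.le)⟩

theorem integrable_tilt_mul_gaussDens (hr : ∀ x, |M.r x| ≤ Rmax) {V : S → ℝ}
    (hV : IsBddMeasurable V) (s : S) : Integrable fun a => M.tilt V s a * M.gaussDens a := by
  obtain ⟨hm, C, hC⟩ := hV
  refine M.integrable_gaussDens.bdd_mul (c := Real.exp ((Rmax + M.γ * C) / M.τ))
    (M.measurable_tilt hm s).aestronglyMeasurable (ae_of_all _ fun a => ?_)
  rw [Real.norm_of_nonneg (show 0 ≤ M.tilt V s a from (Real.exp_pos _).le)]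
  exact (tilt_mem_Icc hr hC s a).2

theorem integrable_exp_qOf (hr : ∀ x, |M.r x| ≤ Rmax) {V : S → ℝ} (hV : IsBddMeasurable V)
    (s : S) : Integrable fun a => Real.exp (M.qOf V s a / M.τ) := by
  simp only [exp_qOf_div]
  exact (integrable_tilt_mul_gaussDens hr hV s).const_mul _

theorem partition_mem_Icc (hr : ∀ x, |M.r x| ≤ Rmax) {V : S → ℝ} (hV : IsBddMeasurable V) {C : ℝ}
    (hC : ∀ s, |V s| ≤ C) (s : S) :
    M.partition V s ∈ Icc (M.Zβ * Real.exp (-((Rmax + M.γ * C) / M.τ)))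
      (M.Zβ * Real.exp ((Rmax + M.γ * C) / M.τ)) := by
  have hi := integrable_tilt_mul_gaussDens hr hV s
  have hZ := M.Zβ_pos
  have e : M.partition V s = M.Zβ * ∫ a, M.tilt V s a * M.gaussDens a := by
    rw [partition, ← integral_const_mul]; simp only [exp_qOf_div]
  rw [e]
  have hcm : ∀ c : ℝ, ∫ a, c * M.gaussDens a = c := fun c => by
    rw [integral_const_mul, M.integral_gaussDens, mul_one]
  constructor
  · refine mul_le_mul_of_nonneg_left ?_ hZ.le
    rw [← hcm (Real.exp _)]
    exact integral_mono (M.integrable_gaussDens.const_mul _) hi fun a =>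
      mul_le_mul_of_nonneg_right (tilt_mem_Icc hr hC s a).1 (M.gaussDens_pos a).le
  · refine mul_le_mul_of_nonneg_left ?_ hZ.le
    rw [← hcm (Real.exp _)]
    exact integral_mono hi (M.integrable_gaussDens.const_mul _) fun a =>
      mul_le_mul_of_nonneg_right (tilt_mem_Icc hr hC s a).2 (M.gaussDens_pos a).le

theorem partition_pos (hr : ∀ x, |M.r x| ≤ Rmax) {V : S → ℝ} (hV : IsBddMeasurable V) (s : S) :
    0 < M.partition V s := by
  obtain ⟨C, hC⟩ := hV.2
  exact (mul_pos M.Zβ_pos (Real.exp_pos _)).trans_le (partition_mem_Icc hr hV hC s).1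

theorem gibbs_eq (V : S → ℝ) (s : S) (a : Act d) :
    M.gibbs V s a = Real.exp (M.qOf V s a / M.τ) / M.partition V s := rfl

theorem gibbs_pos (hr : ∀ x, |M.r x| ≤ Rmax) {V : S → ℝ} (hV : IsBddMeasurable V) (s : S)
    (a : Act d) : 0 < M.gibbs V s a :=
  div_pos (Real.exp_pos _) (partition_pos hr hV s)

theorem measurable_partition {V : S → ℝ} (hV : Measurable V) : Measurable (M.partition V) :=
  ((M.measurable_exp_qOf hV).stronglyMeasurable.integral_prod_right' (ν := volume)).measurable

theorem integrable_gibbs (hr : ∀ x, |M.r x| ≤ Rmax) {V : S → ℝ} (hV : IsBddMeasurable V) (s : S) :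
    Integrable (M.gibbs V s) :=
  (integrable_exp_qOf hr hV s).div_const _

theorem integral_gibbs (hr : ∀ x, |M.r x| ≤ Rmax) {V : S → ℝ} (hV : IsBddMeasurable V) (s : S) :
    ∫ a, M.gibbs V s a = 1 := by
  simp only [gibbs_eq]
  rw [integral_div]
  exact div_self (partition_pos hr hV s).ne'

theorem log_gibbs (hr : ∀ x, |M.r x| ≤ Rmax) {V : S → ℝ} (hV : IsBddMeasurable V) (s : S)
    (a : Act d) : Real.log (M.gibbs V s a) = M.qOf V s a / M.τ - Real.log (M.partition V s) := by
  rw [gibbs_eq, Real.log_div (Real.exp_pos _).ne' (partition_pos hr hV s).ne', Real.log_exp]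

/-- The policy with the Gibbs densities of a bounded measurable function `V`. -/
noncomputable def gibbsPolicy (hr : ∀ x, |M.r x| ≤ Rmax) {V : S → ℝ} (hV : IsBddMeasurable V) :
    Policy S d where
  density := M.gibbs V
  measurable_density :=
    (M.measurable_exp_qOf hV.1).div ((measurable_partition hV.1).comp measurable_fst)
  density_nonneg s a := (gibbs_pos hr hV s a).le
  lintegral_density s := by
    rw [← ofReal_integral_eq_lintegral_ofReal (integrable_gibbs hr hV s)
      (ae_of_all _ fun a => (gibbs_pos hr hV s a).le), integral_gibbs hr hV, ENNReal.ofReal_one]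

/-- The Gibbs variational principle: the supremum that defines `Tstar` is attained by the Gibbs
density and equals `τ` times the logarithm of the partition function. -/
theorem isGreatest_Tstar (hr : ∀ x, |M.r x| ≤ Rmax) {V : S → ℝ} (hV : IsBddMeasurable V) (s : S) :
    IsGreatest {x : ℝ | ∃ μ : Act d → ℝ, Measurable μ ∧ (∀ a, 0 ≤ μ a) ∧
      ∫⁻ a, ENNReal.ofReal (μ a) = 1 ∧
      Integrable (fun a => (M.qOf V s a - M.τ * Real.log (μ a)) * μ a) ∧
      x = ∫ a, (M.qOf V s a - M.τ * Real.log (μ a)) * μ a}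
      (M.τ * Real.log (M.partition V s)) := by
  have hτ := M.τ_pos
  refine ⟨?_, ?_⟩
  · have e : ∀ a, (M.qOf V s a - M.τ * Real.log (M.gibbs V s a)) * M.gibbs V s a =
        M.τ * Real.log (M.partition V s) * M.gibbs V s a := fun a => by
      rw [log_gibbs hr hV]; field_simp; ring
    refine ⟨M.gibbs V s, (gibbsPolicy hr hV).measurable_density_right s,
      (gibbsPolicy hr hV).density_nonneg s, (gibbsPolicy hr hV).lintegral_density s, ?_, ?_⟩
    · simp only [e]
      exact (integrable_gibbs hr hV s).const_mul _
    · simp only [e]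
      rw [integral_const_mul, integral_gibbs hr hV, mul_one]
  · rintro x ⟨μ, hμm, hμ0, hμ1, hμi, rfl⟩
    have hμint : Integrable μ := by
      rw [← lintegral_ofReal_ne_top_iff_integrable hμm.aestronglyMeasurable (ae_of_all _ hμ0), hμ1]
      exact ENNReal.one_ne_top
    have hμ1' : ∫ a, μ a = 1 := by
      rw [integral_eq_lintegral_of_nonneg_ae (ae_of_all _ hμ0) hμm.aestronglyMeasurable, hμ1,
        ENNReal.toReal_one]
    have hg := integrable_gibbs hr hV s
    calc ∫ a, (M.qOf V s a - M.τ * Real.log (μ a)) * μ a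
        ≤ ∫ a, (M.τ * (M.gibbs V s a - μ a) + M.τ * Real.log (M.partition V s) * μ a) := by
          refine integral_mono hμi (((hg.sub hμint).const_mul _).add (hμint.const_mul _))
            fun a => ?_
          have hga := gibbs_pos hr hV s a
          dsimp only
          rcases (hμ0 a).eq_or_lt with h0 | h0
          · rw [← h0]; simp only [mul_zero, sub_zero, add_zero]; positivity
          · have h1 := mul_log_le_sub_add h0 one_pos hga
            simp only [Real.log_one, mul_zero, one_mul, sub_zero] at h1
            have h2 := log_gibbs hr hV s a
            have h3 : M.qOf V s a = M.τ * (Real.log (M.gibbs V s a) +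
                Real.log (M.partition V s)) := by rw [h2]; field_simp; ring
            rw [h3]
            have h4 := mul_le_mul_of_nonneg_left h1 hτ.le
            linarith
      _ = M.τ * Real.log (M.partition V s) := by
          rw [integral_add (f := fun a => M.τ * (M.gibbs V s a - μ a))
            ((hg.sub hμint).const_mul _) (hμint.const_mul _), integral_const_mul,
            integral_const_mul, integral_sub hg hμint, integral_gibbs hr hV, hμ1']
          ring

theorem Tstar_eq (hr : ∀ x, |M.r x| ≤ Rmax) {V : S → ℝ} (hV : IsBddMeasurable V) (s : S) :
    M.Tstar V s = M.τ * Real.log (M.partition V s) :=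
  (isGreatest_Tstar hr hV s).csSup_eq

theorem Tstar_le_add (hr : ∀ x, |M.r x| ≤ Rmax) {V W : S → ℝ} (hV : IsBddMeasurable V)
    (hW : IsBddMeasurable W) {C : ℝ} (h : ∀ s, V s ≤ W s + C) (s : S) :
    M.Tstar V s ≤ M.Tstar W s + M.γ * C := by
  have hτ := M.τ_pos
  have hγ := M.γ_pos
  rw [Tstar_eq hr hV, Tstar_eq hr hW]
  have h1 : ∀ a, M.qOf V s a ≤ M.qOf W s a + M.γ * C := fun a => by
    have h2 : M.next V (s, a) ≤ M.next W (s, a) + C := by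
      have := integral_mono (hV.integrable (M.P (s, a)))
        ((hW.integrable (M.P (s, a))).add (integrable_const C)) h
      rw [integral_add' (hW.integrable _) (integrable_const C)] at this
      simpa [next] using this
    have h3 := mul_le_mul_of_nonneg_left h2 hγ.le
    rw [qOf_eq, qOf_eq]; linarith
  have h2 : M.partition V s ≤ Real.exp (M.γ * C / M.τ) * M.partition W s := by
    rw [partition, partition, ← integral_const_mul]
    refine integral_mono (integrable_exp_qOf hr hV s) ((integrable_exp_qOf hr hW s).const_mul _)
      fun a => ?_
    dsimp only
    rw [← Real.exp_add, ← add_div]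
    refine Real.exp_le_exp.2 (div_le_div_of_nonneg_right ?_ hτ.le)
    linarith [h1 a]
  have h3 := Real.log_le_log (partition_pos hr hV s) h2
  rw [Real.log_mul (Real.exp_pos _).ne' (partition_pos hr hW s).ne', Real.log_exp] at h3
  have h4 := mul_le_mul_of_nonneg_left h3 hτ.le
  rw [mul_add, mul_div_cancel₀ _ hτ.ne'] at h4
  linarith

theorem isSupContraction_Tstar (hr : ∀ x, |M.r x| ≤ Rmax) : IsSupContraction M.Tstar M.γ where
  maps V hV := by
    have hτ := M.τ_pos
    have e : M.Tstar V = fun s => M.τ * Real.log (M.partition V s) := funext (Tstar_eq hr hV)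
    obtain ⟨C, hC⟩ := hV.2
    rw [e]
    refine ⟨(measurable_partition hV.1).log.const_mul _, M.τ * (|Real.log (M.Zβ * Real.exp
      (-((Rmax + M.γ * C) / M.τ)))| + |Real.log (M.Zβ * Real.exp ((Rmax + M.γ * C) / M.τ))|),
      fun s => ?_⟩
    rw [abs_mul, abs_of_pos hτ]
    have h := partition_mem_Icc hr hV hC s
    exact mul_le_mul_of_nonneg_left
      (abs_log_le_of_mem_Icc (mul_pos M.Zβ_pos (Real.exp_pos _)) h.1 h.2) hτ.le
  contract V W hV hW C hC s := by
    have h1 := Tstar_le_add hr hV hW (C := C) (fun s => by linarith [(abs_le.1 (hC s)).2]) s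
    have h2 := Tstar_le_add hr hW hV (C := C) (fun s => by linarith [(abs_le.1 (hC s)).1]) s
    rw [abs_le]; constructor <;> linarith

/-- The Gibbs policy makes the one-step objective constant in the action. -/
theorem softReward_gibbsPolicy (hr : ∀ x, |M.r x| ≤ Rmax) {V : S → ℝ} (hV : IsBddMeasurable V)
    (s : S) (a : Act d) : M.softReward (gibbsPolicy hr hV) (s, a) =
      M.Tstar V s - M.γ * M.next V (s, a) := by
  have hτ := M.τ_pos
  have h := log_gibbs hr hV s a
  change M.r (s, a) - M.β / 2 * ‖a‖ ^ 2 - M.τ * Real.log (M.gibbs V s a) = _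
  rw [h, Tstar_eq hr hV, qOf_eq, mul_sub, mul_div_cancel₀ _ hτ.ne']
  ring

theorem hasBddReward_gibbsPolicy (hr : ∀ x, |M.r x| ≤ Rmax) {V : S → ℝ}
    (hV : IsBddMeasurable V) : M.HasBddReward (gibbsPolicy hr hV) := by
  obtain ⟨C, hC⟩ := hV.2
  obtain ⟨D, hD⟩ := ((isSupContraction_Tstar hr).maps V hV).2
  have hb : ∀ s a, ‖M.softReward (gibbsPolicy hr hV) (s, a)‖ ≤ D + M.γ * C := fun s a => by
    rw [softReward_gibbsPolicy]
    refine (norm_sub_le _ _).trans (add_le_add (hD s) ?_)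
    rw [norm_mul, Real.norm_of_nonneg M.γ_pos.le]
    exact mul_le_mul_of_nonneg_left (M.abs_next_le hC _) M.γ_pos.le
  refine ⟨D + M.γ * C, fun s => ⟨Integrable.of_bound ((M.measurable_softReward _).comp
    measurable_prodMk_left).aestronglyMeasurable _ (ae_of_all _ (hb s)), ?_⟩⟩
  exact (le_abs_self _).trans
    (abs_integral_le_of_abs_le fun a => by rw [abs_of_nonneg (norm_nonneg _)]; exact hb s a)

theorem value_gibbsPolicy (hr : ∀ x, |M.r x| ≤ Rmax) {V : S → ℝ} (hV : IsBddMeasurable V)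
    (hf : M.Tstar V = V) : M.value (gibbsPolicy hr hV) = V := by
  refine (hasBddReward_gibbsPolicy hr hV).value_eq hV (funext fun s => ?_)
  simp only [policyOp, softReward_gibbsPolicy, sub_add_cancel]
  simp [hf]

theorem HasBddReward.integrable_Q_sub_log {π : Policy S d} (h : M.HasBddReward π) (s : S) :
    Integrable fun a => (M.Q π s a - M.τ * Real.log (π.density s a)) * π.density s a := by
  obtain ⟨C, hC⟩ := id h
  have hi : Integrable (fun a => M.softReward π (s, a) + M.γ * M.next (M.value π) (s, a))
      (π.kernel s) := (hC s).1.add ((integrable_next_kernel h.isBddMeasurable_value s).const_mul _)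
  refine ((π.integrable_kernel_iff s).1 hi).congr (ae_of_all _ fun a => ?_)
  dsimp only
  rw [Q, qOf_eq, softReward]; ring

/-- The Bellman equation of `π`, written as an integral against its density. -/
theorem HasBddReward.value_eq_integral {π : Policy S d} (h : M.HasBddReward π) (s : S) :
    M.value π s =
      ∫ a, (M.Q π s a - M.τ * Real.log (π.density s a)) * π.density s a := by
  rw [← congrFun h.policyOp_value s, policyOp, π.integral_kernel]
  refine integral_congr_ae (ae_of_all _ fun a => ?_)
  dsimp only
  rw [Q, qOf_eq, softReward]; ring

/-- The value of a policy is a subsolution of the soft optimality equation. -/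
theorem HasBddReward.value_le_Tstar (hr : ∀ x, |M.r x| ≤ Rmax) {π : Policy S d}
    (h : M.HasBddReward π) (s : S) : M.value π s ≤ M.Tstar (M.value π) s :=
  le_csSup (isGreatest_Tstar hr h.isBddMeasurable_value s).bddAbove
    ⟨π.density s, π.measurable_density_right s, π.density_nonneg s, π.lintegral_density s,
      h.integrable_Q_sub_log s, h.value_eq_integral s⟩

/-- The value of a policy is at most the optimal value. -/
theorem HasBddReward.value_le_of_fixed (hr : ∀ x, |M.r x| ≤ Rmax) {π : Policy S d}
    (h : M.HasBddReward π) {Vs : S → ℝ} (hVs : IsBddMeasurable Vs) (hf : M.Tstar Vs = Vs) (s : S) :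
    M.value π s ≤ Vs s := by
  have := nonempty_state M
  have hV := h.isBddMeasurable_value
  have key := le_div_one_sub_of_forall_le (f := fun s => M.value π s - Vs s) (A := 0) M.γ_lt_one
    (by
      obtain ⟨C, hC⟩ := hV.abs_sub_le hVs
      exact ⟨C, by rintro _ ⟨s, rfl⟩; exact (le_abs_self _).trans (hC s)⟩)
    (fun C hC s => by
      have h1 := h.value_le_Tstar hr s
      have h2 := Tstar_le_add hr hV hVs (C := C) (fun s => by linarith [hC s]) s
      rw [hf] at h2
      linarith) s
  rw [zero_div] at key
  linarith

end EntropyMDP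

/-! ### Divergence of vector fields on `ℝ^d` -/

section Divergence

variable {d : ℕ}

theorem fderiv_apply_coord {X : Act d → Act d} {a : Act d} (hX : DifferentiableAt ℝ X a)
    (v : Act d) (i : Fin d) : fderiv ℝ (fun b => X b i) a v = fderiv ℝ X a v i :=
  congrArg (fun L => L v)
    ((EuclideanSpace.proj (𝕜 := ℝ) i).hasFDerivAt.comp a hX.hasFDerivAt).fderiv

theorem continuous_divergence {X : Act d → Act d} (hX : ContDiff ℝ 1 X) :
    Continuous (divergence X) := by
  unfold divergence
  refine continuous_finsetSum _ fun i _ => ?_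
  exact (EuclideanSpace.proj (𝕜 := ℝ) i).continuous.comp
    ((hX.continuous_fderiv one_ne_zero).clm_apply continuous_const)

theorem divergence_smul {f : Act d → ℝ} {F : Act d → Act d} {a : Act d}
    (hf : DifferentiableAt ℝ f a) (hF : DifferentiableAt ℝ F a) :
    divergence (fun b => f b • F b) a = f a * divergence F a + inner ℝ (gradient f a) (F a) := by
  have h : fderiv ℝ (fun b => f b • F b) a = f a • fderiv ℝ F a + (fderiv ℝ f a).smulRight (F a) :=
    fderiv_smul hf hF
  unfold divergence
  rw [h, Finset.mul_sum, PiLp.inner_apply, ← Finset.sum_add_distrib]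
  refine Finset.sum_congr rfl fun i _ => ?_
  have : gradient f a i = fderiv ℝ f a (EuclideanSpace.single i 1) := by
    rw [← inner_gradient_left, EuclideanSpace.inner_single_right]; simp
  simp [this, mul_comm]

theorem divergence_const_smul {F : Act d → Act d} {a : Act d} (c : ℝ)
    (hF : DifferentiableAt ℝ F a) :
    divergence (fun b => c • F b) a = c * divergence F a := by
  rw [divergence_smul (differentiableAt_const c) hF]
  simp [gradient]

theorem contDiff_gradient {f : Act d → ℝ} (hf : ContDiff ℝ 2 f) : ContDiff ℝ 1 (gradient f) :=
  (InnerProductSpace.toDual ℝ (Act d)).symm.contDiff.comp (hf.fderiv_right (by norm_num))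

theorem integral_mul_divergence_eq_neg {χ : Act d → ℝ} {X : Act d → Act d}
    (hχ : ContDiff ℝ 1 χ) (hχc : HasCompactSupport χ) (hX : ContDiff ℝ 1 X) :
    ∫ a, χ a * divergence X a =
      -∫ a, ∑ i, fderiv ℝ χ a (EuclideanSpace.single i 1) * X a i := by
  have hc : ∀ i : Fin d, Continuous fun a => fderiv ℝ X a (EuclideanSpace.single i 1) i := fun i =>
    (EuclideanSpace.proj (𝕜 := ℝ) i).continuous.comp
      ((hX.continuous_fderiv one_ne_zero).clm_apply continuous_const)
  have hXc : ∀ i : Fin d, Continuous fun a => X a i := fun i =>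
    (EuclideanSpace.proj (𝕜 := ℝ) i).continuous.comp hX.continuous
  have hχ' : ∀ i : Fin d, Continuous fun a => fderiv ℝ χ a (EuclideanSpace.single i 1) := fun i =>
    (hχ.continuous_fderiv one_ne_zero).clm_apply continuous_const
  have hχs : ∀ i : Fin d, HasCompactSupport fun a => fderiv ℝ χ a (EuclideanSpace.single i 1) :=
    fun i => hχc.fderiv_apply (𝕜 := ℝ) _
  have i1 : ∀ i : Fin d,
      Integrable fun a => χ a * fderiv ℝ X a (EuclideanSpace.single i 1) i := fun i =>
    (hχ.continuous.mul (hc i)).integrable_of_hasCompactSupport hχc.mul_right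
  have i2 : ∀ i : Fin d,
      Integrable fun a => fderiv ℝ χ a (EuclideanSpace.single i 1) * X a i := fun i =>
    ((hχ' i).mul (hXc i)).integrable_of_hasCompactSupport (hχs i).mul_right
  have i3 : ∀ i : Fin d, Integrable fun a => χ a * X a i := fun i =>
    (hχ.continuous.mul (hXc i)).integrable_of_hasCompactSupport hχc.mul_right
  simp only [divergence, Finset.mul_sum]
  rw [integral_finsetSum _ fun i _ => i1 i, integral_finsetSum _ fun i _ => i2 i,
    ← Finset.sum_neg_distrib]
  refine Finset.sum_congr rfl fun i _ => ?_
  have e : ∀ a, fderiv ℝ (fun b => X b i) a (EuclideanSpace.single i 1) =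
      fderiv ℝ X a (EuclideanSpace.single i 1) i := fun a =>
    fderiv_apply_coord (hX.differentiable one_ne_zero a) _ i
  have := integral_mul_fderiv_eq_neg_fderiv_mul_of_integrable (μ := (volume : Measure (Act d)))
    (f := χ) (g := fun b => X b i) (v := EuclideanSpace.single i 1) (i2 i)
    (by simpa only [e] using i1 i) (i3 i) (fun a _ => hχ.differentiable one_ne_zero a)
    (fun a _ => (EuclideanSpace.proj (𝕜 := ℝ) i).differentiableAt.comp a
      (hX.differentiable one_ne_zero a))
  simpa only [e] using this

/-- The total divergence of an integrable `C¹` field vanishes: test with the dilated cutoffs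
`χ(a / (n + 1))`, whose gradients are of order `1 / n`. -/
theorem integral_divergence_eq_zero {X : Act d → Act d} (hX : ContDiff ℝ 1 X)
    (hi : Integrable X) (hd : Integrable (divergence X)) : ∫ a, divergence X a = 0 := by
  let χ : ContDiffBump (0 : Act d) := default
  have hχ : ContDiff ℝ 1 χ := χ.contDiff (n := 1)
  obtain ⟨C, hC⟩ := (χ.hasCompactSupport.fderiv (𝕜 := ℝ)).exists_bound_of_continuous
    (hχ.continuous_fderiv one_ne_zero)
  let c : ℕ → ℝ := fun n => ((n : ℝ) + 1)⁻¹
  have hcpos : ∀ n, 0 < c n := fun n => by positivity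
  have hc0 : Tendsto c atTop (𝓝 0) :=
    (tendsto_atTop_add_const_right atTop (1 : ℝ) tendsto_natCast_atTop_atTop).inv_tendsto_atTop
  have hχn : ∀ n, ContDiff ℝ 1 fun a => χ (c n • a) := fun n =>
    hχ.comp (contDiff_const_smul (c n))
  have hχcs : ∀ n, HasCompactSupport fun a => χ (c n • a) := fun n =>
    χ.hasCompactSupport.comp_smul (hcpos n).ne'
  have lim1 : Tendsto (fun n => ∫ a, χ (c n • a) * divergence X a) atTop
      (𝓝 (∫ a, divergence X a)) := by
    refine tendsto_integral_of_dominated_convergence (fun a => ‖divergence X a‖) (fun n =>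
      ((hχn n).continuous.mul (continuous_divergence hX)).aestronglyMeasurable) hd.norm
      (fun n => ae_of_all _ fun a => ?_) (ae_of_all _ fun a => ?_)
    · rw [norm_mul, Real.norm_of_nonneg χ.nonneg]
      exact mul_le_of_le_one_left (norm_nonneg _) χ.le_one
    · have h1 : Tendsto (fun n => c n • a) atTop (𝓝 (0 : Act d)) := by
        simpa using hc0.smul_const a
      have h2 : Tendsto (fun n => χ (c n • a)) atTop (𝓝 1) := by
        have := (χ.continuous.tendsto 0).comp h1
        rwa [χ.one_of_mem_closedBall (Metric.mem_closedBall_self χ.rIn_pos.le)] at this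
      simpa using h2.mul_const (divergence X a)
  have bound : ∀ n a, ‖∑ i, fderiv ℝ (fun b => χ (c n • b)) a (EuclideanSpace.single i 1) * X a i‖ ≤
      c n * (d * C * ‖X a‖) := by
    intro n a
    refine (norm_sum_le _ _).trans ?_
    have : ∀ i ∈ (Finset.univ : Finset (Fin d)),
        ‖fderiv ℝ (fun b => χ (c n • b)) a (EuclideanSpace.single i 1) * X a i‖ ≤
          c n * (C * ‖X a‖) := by
      intro i _
      rw [norm_mul, ← mul_assoc, fderiv_comp_smul, smul_apply, norm_smul,
        Real.norm_of_nonneg (hcpos n).le]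
      refine mul_le_mul (mul_le_mul_of_nonneg_left ?_ (hcpos n).le) (PiLp.norm_apply_le _ _)
        (norm_nonneg _) (mul_nonneg (hcpos n).le ((norm_nonneg _).trans (hC 0)))
      refine (ContinuousLinearMap.le_opNorm _ _).trans ?_
      simpa using hC (c n • a)
    refine (Finset.sum_le_card_nsmul _ _ _ this).trans (le_of_eq ?_)
    rw [Finset.card_univ, Fintype.card_fin, nsmul_eq_mul]; ring
  have lim2 : Tendsto (fun n => ∫ a, χ (c n • a) * divergence X a) atTop (𝓝 0) := by
    refine squeeze_zero_norm (a := fun n => c n * ∫ a, d * C * ‖X a‖) (fun n => ?_) ?_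
    · rw [integral_mul_divergence_eq_neg (hχn n) (hχcs n) hX, norm_neg, ← integral_const_mul]
      exact norm_integral_le_of_norm_le ((hi.norm.const_mul _).const_mul _)
        (ae_of_all _ (bound n))
    · simpa using hc0.mul_const (∫ a, d * C * ‖X a‖)
  exact tendsto_nhds_unique lim1 lim2

end Divergence

/-! ### Entropy dissipation along the Wasserstein gradient field -/

namespace EntropyMDP

variable {S : Type*} [MeasurableSpace S] {d : ℕ} {M : EntropyMDP S d} {Rmax : ℝ} {π : Policy S d}

theorem abs_qOf_le (hr : ∀ x, |M.r x| ≤ Rmax) {V : S → ℝ} {C : ℝ} (hC : ∀ s, |V s| ≤ C) (s : S)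
    (a : Act d) : |M.qOf V s a| ≤ Rmax + M.γ * C + M.β / 2 * ‖a‖ ^ 2 := by
  have h := abs_le.1 (abs_reward_add_next_le hr hC (s, a))
  have : 0 ≤ M.β / 2 * ‖a‖ ^ 2 := mul_nonneg (by linarith [M.β_pos]) (sq_nonneg _)
  rw [qOf_eq, abs_le]
  constructor <;> linarith [h.1, h.2]

theorem HasBddReward.logRatio_eq (hr : ∀ x, |M.r x| ≤ Rmax) (h : M.HasBddReward π) {s : S}
    {a : Act d} (hpos : 0 < π.density s a) :
    M.logRatio π s a =
      Real.log (π.density s a) - M.Q π s a / M.τ + Real.log (M.partition (M.value π) s) := by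
  rw [logRatio, Real.log_div hpos.ne' (gibbs_pos hr h.isBddMeasurable_value s a).ne',
    log_gibbs hr h.isBddMeasurable_value, Q]
  ring

/-- The advantage `Q - τ log π` is, up to a constant, `-τ` times the log-ratio to the Gibbs
density. -/
theorem HasBddReward.Q_sub_log_eq (hr : ∀ x, |M.r x| ≤ Rmax) (h : M.HasBddReward π) {s : S}
    {a : Act d} (hpos : 0 < π.density s a) :
    M.Q π s a - M.τ * Real.log (π.density s a) =
      M.τ * Real.log (M.partition (M.value π) s) - M.τ * M.logRatio π s a := by
  rw [h.logRatio_eq hr hpos]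
  field_simp [M.τ_pos.ne']
  ring

theorem contDiff_gibbs {V : S → ℝ} {s : S} (hQ : ContDiff ℝ 2 (M.qOf V s)) :
    ContDiff ℝ 2 (M.gibbs V s) :=
  (hQ.div_const _).exp.div_const _

theorem HasBddReward.contDiff_logRatio (hr : ∀ x, |M.r x| ≤ Rmax) (h : M.HasBddReward π) {s : S}
    (hpos : ∀ a, 0 < π.density s a) (hπ : ContDiff ℝ 2 (π.density s))
    (hQ : ContDiff ℝ 2 (M.Q π s)) : ContDiff ℝ 2 (M.logRatio π s) := by
  have hg := gibbs_pos hr h.isBddMeasurable_value s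
  exact (hπ.div (contDiff_gibbs hQ) fun a => (hg a).ne').log fun a =>
    (div_pos (hpos a) (hg a)).ne'

theorem HasBddReward.flux_eq (hr : ∀ x, |M.r x| ≤ Rmax) (h : M.HasBddReward π) {s : S}
    (hpos : ∀ a, 0 < π.density s a) (hφ : Differentiable ℝ (M.logRatio π s)) (a : Act d) :
    M.flux π s a = -M.τ • (π.density s a • gradient (M.logRatio π s) a) := by
  have e : (fun b => M.Q π s b - M.τ * Real.log (π.density s b)) = fun b =>
      M.τ * Real.log (M.partition (M.value π) s) - M.τ * M.logRatio π s b :=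
    funext fun b => h.Q_sub_log_eq hr (hpos b)
  have hd : HasDerivAt (fun y => M.τ * Real.log (M.partition (M.value π) s) - M.τ * y) (-M.τ)
      (M.logRatio π s a) := by
    simpa using ((hasDerivAt_id (M.logRatio π s a)).const_mul M.τ).const_sub
      (M.τ * Real.log (M.partition (M.value π) s))
  rw [flux, e, hd.gradient_comp (hφ a), smul_comm]

/-- Integration by parts: pairing the log-ratio with the divergence of the flux gives the relative
Fisher information. -/
theorem HasBddReward.integral_logRatio_mul_divergence_flux (hr : ∀ x, |M.r x| ≤ Rmax)
    (h : M.HasBddReward π) {s : S} (hpos : ∀ a, 0 < π.density s a)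
    (hπ : ContDiff ℝ 2 (π.density s)) (hQ : ContDiff ℝ 2 (M.Q π s))
    (hF : Integrable fun a => ‖gradient (M.logRatio π s) a‖ ^ 2 * π.density s a)
    (hD : Integrable fun a =>
      (M.logRatio π s a * π.density s a) • gradient (M.logRatio π s) a)
    (hφ : Integrable fun a => M.logRatio π s a * divergence (M.flux π s) a) :
    ∫ a, M.logRatio π s a * divergence (M.flux π s) a =
      M.τ * ∫ a, ‖gradient (M.logRatio π s) a‖ ^ 2 * π.density s a := by
  have hτ := M.τ_pos
  have c2 := h.contDiff_logRatio hr hpos hπ hQ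
  have c1 : ContDiff ℝ 1 (M.logRatio π s) := c2.of_le (by norm_num)
  have p1 : ContDiff ℝ 1 (π.density s) := hπ.of_le (by norm_num)
  have g1 := contDiff_gradient c2
  have dφ := c1.differentiable one_ne_zero
  have X1 : ContDiff ℝ 1 fun a => π.density s a • gradient (M.logRatio π s) a := p1.smul g1
  have e1 : ∀ a, divergence (M.flux π s) a =
      -M.τ * divergence (fun a => π.density s a • gradient (M.logRatio π s) a) a := fun a => by
    rw [← divergence_const_smul _ (X1.differentiable one_ne_zero a)]
    exact congrArg (fun F => divergence F a) (funext fun b => h.flux_eq hr hpos dφ b)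
  have e2 : ∀ a, divergence
      (fun a => (M.logRatio π s a * π.density s a) • gradient (M.logRatio π s) a) a =
      -M.τ⁻¹ * (M.logRatio π s a * divergence (M.flux π s) a) +
        ‖gradient (M.logRatio π s) a‖ ^ 2 * π.density s a := fun a => by
    have : (fun a => (M.logRatio π s a * π.density s a) • gradient (M.logRatio π s) a) =
        fun a => M.logRatio π s a • π.density s a • gradient (M.logRatio π s) a :=
      funext fun a => mul_smul _ _ _
    rw [this, divergence_smul (dφ a) (X1.differentiable one_ne_zero a), inner_smul_right,
      real_inner_self_eq_norm_sq, e1]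
    field_simp
  have i1 : Integrable fun a => -M.τ⁻¹ * (M.logRatio π s a * divergence (M.flux π s) a) :=
    hφ.const_mul _
  have key := integral_divergence_eq_zero
    (X := fun a => (M.logRatio π s a * π.density s a) • gradient (M.logRatio π s) a)
    ((c1.mul p1).smul g1) hD (by
    refine Integrable.congr (i1.add hF) (ae_of_all _ fun a => (e2 a).symm))
  rw [integral_congr_ae (ae_of_all _ e2), integral_add i1 hF, integral_const_mul] at key
  field_simp at key
  linarith

/-- The Bellman residual is `τ` times the relative entropy with respect to the Gibbs density. -/
theorem HasBddReward.Tstar_sub_value_eq (hr : ∀ x, |M.r x| ≤ Rmax) (h : M.HasBddReward π) {s : S}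
    (hpos : ∀ a, 0 < π.density s a) :
    (Integrable fun a => M.logRatio π s a * π.density s a) ∧
    M.Tstar (M.value π) s - M.value π s = M.τ * ∫ a, M.logRatio π s a * π.density s a := by
  have hτ := M.τ_pos
  have e : ∀ a, M.logRatio π s a * π.density s a =
      Real.log (M.partition (M.value π) s) * π.density s a -
        M.τ⁻¹ * ((M.Q π s a - M.τ * Real.log (π.density s a)) * π.density s a) := fun a => by
    rw [h.Q_sub_log_eq hr (hpos a)]
    field_simp
    ring
  have i1 := (π.integrable_density s).const_mul (Real.log (M.partition (M.value π) s))
  have i2 := (h.integrable_Q_sub_log s).const_mul M.τ⁻¹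
  refine ⟨(i1.sub i2).congr (ae_of_all _ fun a => (e a).symm), ?_⟩
  rw [integral_congr_ae (ae_of_all _ e), integral_sub i1 i2, integral_const_mul,
    integral_const_mul, ← h.value_eq_integral, π.integral_density, Tstar_eq hr
    h.isBddMeasurable_value]
  field_simp

/-- The logarithmic Sobolev inequality for the Gibbs density of a policy with bounded value: a
bounded perturbation of the Gaussian one, with density ratio in a band of width `exp (2 U / τ)`. -/
theorem HasBddReward.integral_logRatio_le (hr : ∀ x, |M.r x| ≤ Rmax) (h : M.HasBddReward π)
    {C : ℝ} (hC : ∀ s, |M.value π s| ≤ C) {s : S} (hpos : ∀ a, 0 < π.density s a)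
    (hπ : ContDiff ℝ 2 (π.density s)) (hQ : ContDiff ℝ 2 (M.Q π s))
    (hF : Integrable fun a => ‖gradient (M.logRatio π s) a‖ ^ 2 * π.density s a) :
    ∫ a, M.logRatio π s a * π.density s a ≤
      Real.exp (2 * (Rmax + M.γ * C) / M.τ) * (M.τ / (2 * M.β)) *
        ∫ a, ‖gradient (M.logRatio π s) a‖ ^ 2 * π.density s a := by
  have hV := h.isBddMeasurable_value
  have hp := partition_pos hr hV s
  have hZ := M.Zβ_pos
  have hg0 := M.gaussDens_pos
  let w : Act d → ℝ := fun a => M.gibbs (M.value π) s a / M.gaussDens a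
  have hwg : ∀ a, w a * M.gaussDens a = M.gibbs (M.value π) s a := fun a =>
    div_mul_cancel₀ _ (hg0 a).ne'
  have hw : ∀ a, w a = M.Zβ / M.partition (M.value π) s * M.tilt (M.value π) s a := fun a => by
    have := (hg0 a).ne'
    simp only [w]
    rw [gibbs_eq, exp_qOf_div]
    field_simp
  have hφ : (fun a => Real.log (π.density s a / (w a * M.gaussDens a))) = M.logRatio π s :=
    funext fun a => by rw [hwg, logRatio]
  have hk : 0 < M.Zβ / M.partition (M.value π) s := div_pos hZ hp
  have key := M.integral_log_div_mul_le_of_perturbation (w := w) (q := π.density s)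
    (m := M.Zβ / M.partition (M.value π) s * Real.exp (-((Rmax + M.γ * C) / M.τ)))
    (B := M.Zβ / M.partition (M.value π) s * Real.exp ((Rmax + M.γ * C) / M.τ))
    (mul_pos hk (Real.exp_pos _))
    (fun a => by
      have := tilt_mem_Icc hr hC s a
      rw [hw]
      exact ⟨mul_le_mul_of_nonneg_left this.1 hk.le, mul_le_mul_of_nonneg_left this.2 hk.le⟩)
    (((contDiff_gibbs hQ).of_le (by norm_num)).div M.contDiff_gaussDens fun a => (hg0 a).ne')
    (by simp only [hwg]; exact integral_gibbs hr hV s)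
    (hπ.of_le (by norm_num)) hpos (π.integrable_density s) (π.integral_density s)
    (by simp only [hwg]; exact (h.Tstar_sub_value_eq hr hpos).1)
    (by rw [hφ]; exact hF)
  rw [hφ] at key
  simp only [hwg] at key
  have hexp : M.Zβ / M.partition (M.value π) s * Real.exp ((Rmax + M.γ * C) / M.τ) /
      (M.Zβ / M.partition (M.value π) s * Real.exp (-((Rmax + M.γ * C) / M.τ))) =
      Real.exp (2 * (Rmax + M.γ * C) / M.τ) := by
    rw [mul_div_mul_left _ _ hk.ne', ← Real.exp_sub]
    congr 1; ring
  rw [hexp] at key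
  exact key

end EntropyMDP

/-! ### The rate of increase of the value along the flow -/

namespace EntropyMDP

variable {S : Type*} [MeasurableSpace S] {d : ℕ} {M : EntropyMDP S d} {Rmax : ℝ}
  {π : ℝ → Policy S d}

/-- Lower bounds in the limit pass through the state-action average, even though the policies vary:
this is Fatou's lemma for the products of the truncated averages with the densities. -/
theorem eventually_le_integral_next {w : ℕ → S → ℝ} {C : ℝ} (hw : ∀ n, Measurable (w n))
    (hC : ∀ n s, |w n s| ≤ C) {ν : ℕ → Policy S d} {ν' : Policy S d} {s : S}
    (hν : ∀ a, Tendsto (fun n => (ν n).density s a) atTop (𝓝 (ν'.density s a))) {K : ℝ}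
    (hK : ∀ s', ∀ c < K, ∀ᶠ n in atTop, c ≤ w n s') {c : ℝ} (hc : c < K) :
    ∀ᶠ n in atTop, c ≤ ∫ a, M.next (w n) (s, a) ∂((ν n).kernel s) := by
  have hC0 : 0 ≤ C := (abs_nonneg _).trans (hC 0 s)
  -- truncation at `K` turns the lower bound into convergence; adding `D` makes it nonnegative
  let h : ℕ → S → ℝ := fun n s' => min (w n s') K
  let D : ℝ := C + |K| + 1
  have hhm : ∀ n, Measurable (h n) := fun n => (hw n).min measurable_const
  have hhD : ∀ n s', |h n s'| ≤ C + |K| := fun n s' => by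
    have := abs_le.1 (hC n s')
    have hK' := abs_le.1 (le_refl |K|)
    exact abs_le.2 ⟨le_min (by linarith) (by linarith), (min_le_right _ _).trans (by linarith)⟩
  have hhb : ∀ n, IsBddMeasurable (h n) := fun n => ⟨hhm n, _, hhD n⟩
  have hhlim : ∀ s', Tendsto (fun n => h n s') atTop (𝓝 K) := fun s' => by
    refine tendsto_order.2 ⟨fun y hy => ?_, fun y hy => Eventually.of_forall fun n =>
      (min_le_right _ _).trans_lt hy⟩
    obtain ⟨z, hyz, hzK⟩ := exists_between hy
    exact (hK s' z hzK).mono fun n hn => lt_min (hyz.trans_le hn) hy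
  have hnext : ∀ a, Tendsto (fun n => M.next (h n) (s, a)) atTop (𝓝 K) := fun a => by
    have := tendsto_integral_of_dominated_convergence (μ := M.P (s, a)) (F := h)
      (f := fun _ => K) (fun _ => C + |K|) (fun n => (hhm n).aestronglyMeasurable)
      (integrable_const _) (fun n => ae_of_all _ fun s' => hhD n s') (ae_of_all _ hhlim)
    simpa [next] using this
  have hnm : ∀ n, Measurable fun a => M.next (h n) (s, a) := fun n =>
    (M.measurable_next (hhm n)).comp measurable_prodMk_left
  have hpos : ∀ n a, 0 ≤ M.next (h n) (s, a) + D := fun n a => by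
    have := (abs_le.1 (M.abs_next_le (hhD n) (s, a))).1
    simp only [D]; linarith
  have hmeas : ∀ n, Measurable fun a =>
      ENNReal.ofReal ((M.next (h n) (s, a) + D) * (ν n).density s a) := fun n =>
    (((hnm n).add_const D).mul ((ν n).measurable_density_right s)).ennreal_ofReal
  have hfatou := lintegral_liminf_le (μ := (volume : Measure (Act d))) (u := atTop) hmeas
  have hl : ∀ a, liminf (fun n => ENNReal.ofReal ((M.next (h n) (s, a) + D) * (ν n).density s a))
      atTop = ENNReal.ofReal ((K + D) * ν'.density s a) := fun a =>
    (ENNReal.tendsto_ofReal (((hnext a).add_const D).mul (hν a))).liminf_eq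
  have hKD : 0 < K + D := by have := neg_abs_le K; simp only [D]; linarith
  have hint : ∀ n, Integrable (fun a => (M.next (h n) (s, a) + D) * (ν n).density s a) := fun n =>
    ((ν n).integrable_kernel_iff s).1
      ((integrable_next_kernel (hhb n) s).add (integrable_const D))
  have hlhs : ∫⁻ a, ENNReal.ofReal ((K + D) * ν'.density s a) = ENNReal.ofReal (K + D) := by
    rw [← ofReal_integral_eq_lintegral_ofReal ((ν'.integrable_density s).const_mul _)
      (ae_of_all _ fun a => mul_nonneg hKD.le (ν'.density_nonneg s a)), integral_const_mul,
      ν'.integral_density, mul_one]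
  have hrhs : ∀ n, ∫⁻ a, ENNReal.ofReal ((M.next (h n) (s, a) + D) * (ν n).density s a) =
      ENNReal.ofReal ((∫ a, M.next (h n) (s, a) ∂((ν n).kernel s)) + D) := fun n => by
    rw [← ofReal_integral_eq_lintegral_ofReal (hint n)
      (ae_of_all _ fun a => mul_nonneg (hpos n a) ((ν n).density_nonneg s a)),
      ← (ν n).integral_kernel s (fun a => M.next (h n) (s, a) + D),
      integral_add (integrable_next_kernel (hhb n) s) (integrable_const D)]
    simp
  simp only [hl, hlhs, hrhs] at hfatou
  have hlt : ENNReal.ofReal (c + D) < liminf (fun n =>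
      ENNReal.ofReal ((∫ a, M.next (h n) (s, a) ∂((ν n).kernel s)) + D)) atTop :=
    ((ENNReal.ofReal_lt_ofReal_iff hKD).2 (by linarith)).trans_le hfatou
  refine (eventually_lt_of_lt_liminf hlt).mono fun n hn => ?_
  have h1 := (ENNReal.ofReal_lt_ofReal_iff'.1 hn).1
  have h2 : ∫ a, M.next (h n) (s, a) ∂((ν n).kernel s) ≤
      ∫ a, M.next (w n) (s, a) ∂((ν n).kernel s) := by
    have hwb : IsBddMeasurable (w n) := ⟨hw n, C, hC n⟩
    refine integral_mono (integrable_next_kernel (hhb n) s) (integrable_next_kernel hwb s)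
      fun a => ?_
    exact integral_mono ((hhb n).integrable _) (hwb.integrable _) fun s' => min_le_left _ _
  linarith

/-- Difference quotients that solve linear Bellman equations with forcing terms converging to a
nonnegative limit stay asymptotically above this limit. The forcing limit need not be bounded in the
state, and the policies converge only pointwise. -/
theorem eventually_le_of_bellman {w b : ℕ → S → ℝ} {b' : S → ℝ} {C : ℝ}
    (hw : ∀ n, Measurable (w n)) (hC : ∀ n s, |w n s| ≤ C)
    {ν : ℕ → Policy S d} {ν' : Policy S d}
    (hν : ∀ s a, Tendsto (fun n => (ν n).density s a) atTop (𝓝 (ν'.density s a)))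
    (hb : ∀ s, Tendsto (fun n => b n s) atTop (𝓝 (b' s))) (hb0 : ∀ s, 0 ≤ b' s)
    (hwb : ∀ n s, w n s = b n s + M.γ * ∫ a, M.next (w n) (s, a) ∂((ν n).kernel s))
    {s : S} {c : ℝ} (hc : c < b' s) : ∀ᶠ n in atTop, c ≤ w n s := by
  have hγ0 := M.γ_pos; have hγ1 := M.γ_lt_one
  have step : ∀ K, (∀ s', ∀ c < K, ∀ᶠ n in atTop, c ≤ w n s') →
      ∀ s', ∀ c < b' s' + M.γ * K, ∀ᶠ n in atTop, c ≤ w n s' := by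
    intro K hK s' c hc
    have hδ : 0 < (b' s' + M.γ * K - c) / 2 := by linarith
    filter_upwards [eventually_le_integral_next (M := M) hw hC (hν s') hK (sub_lt_self K hδ),
      (hb s').eventually_const_le (sub_lt_self (b' s') hδ)] with n h1 h2
    rw [hwb]
    have h3 := mul_le_mul_of_nonneg_left h1 hγ0.le
    nlinarith
  -- the trivial bound `-C` improves by the factor `γ` at each use of the equation
  have iter : ∀ j : ℕ, ∀ s', ∀ c < -(M.γ ^ j * C), ∀ᶠ n in atTop, c ≤ w n s' := by
    intro j
    induction j with
    | zero =>
      intro s' c hc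
      refine Eventually.of_forall fun n => ?_
      have := (abs_le.1 (hC n s')).1
      rw [pow_zero, one_mul] at hc
      linarith
    | succ j ih =>
      intro s' c hc
      refine step _ ih s' c (hc.trans_le ?_)
      have := hb0 s'
      rw [pow_succ]; linarith
  have zero : ∀ s', ∀ c < (0 : ℝ), ∀ᶠ n in atTop, c ≤ w n s' := by
    intro s' c hc
    have : Tendsto (fun j : ℕ => -(M.γ ^ j * C)) atTop (𝓝 0) := by
      simpa using ((tendsto_pow_atTop_nhds_zero_of_lt_one hγ0.le hγ1).mul_const C).neg
    obtain ⟨j, hj⟩ := (this.eventually_const_lt hc).exists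
    exact iter j s' c hj
  exact step 0 zero s c (by simpa using hc)

/-- The Fisher information `∫ ‖∇ log (π / p)‖² π` of a policy relative to the
Gibbs density of its value. -/
noncomputable def fisherInfo (M : EntropyMDP S d) (π : Policy S d) (s : S) : ℝ :=
  ∫ a, ‖gradient (M.logRatio π s) a‖ ^ 2 * π.density s a

theorem fisherInfo_nonneg (π : Policy S d) (s : S) : 0 ≤ M.fisherInfo π s :=
  integral_nonneg fun a => mul_nonneg (sq_nonneg _) (π.density_nonneg s a)

namespace IsSmoothWPGFlow

theorem hasBddReward (hr : ∀ x, |M.r x| ≤ Rmax) (hf : M.IsSmoothWPGFlow π) {t : ℝ} (ht : 0 ≤ t) :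
    M.HasBddReward (π t) :=
  (hf.admissible t ht).hasBddReward hr

theorem deriv_density (hf : M.IsSmoothWPGFlow π) {t : ℝ} (ht : 0 < t) (s : S) (a : Act d) :
    deriv (fun u => (π u).density s a) t = -divergence (M.flux (π t) s) a :=
  (hf.flow_eq t ht s a).deriv

theorem measurable_deriv_density (hr : ∀ x, |M.r x| ≤ Rmax) (hf : M.IsSmoothWPGFlow π) {t : ℝ}
    (ht : 0 < t) (s : S) : Measurable fun a => deriv (fun u => (π u).density s a) t := by
  have h := hf.hasBddReward hr ht.le
  have c2 := h.contDiff_logRatio hr (hf.density_pos t ht s) (hf.contDiff_density t ht s)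
    (hf.contDiff_Q t ht s)
  have e : M.flux (π t) s = fun a => -M.τ • ((π t).density s a • gradient (M.logRatio (π t) s) a) :=
    funext fun a => h.flux_eq hr (hf.density_pos t ht s) (c2.differentiable (by norm_num)) a
  have hX : ContDiff ℝ 1 (M.flux (π t) s) := by
    rw [e]
    exact (((hf.contDiff_density t ht s).of_le (by norm_num)).smul
      (contDiff_gradient c2)).const_smul (-M.τ)
  simp only [hf.deriv_density ht]
  exact (continuous_divergence hX).neg.measurable

/-- Differentiation of `∫ π_u` under the integral sign: the flow conserves mass. -/
theorem integral_deriv_density (hr : ∀ x, |M.r x| ≤ Rmax) (hf : M.IsSmoothWPGFlow π) {t : ℝ}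
    (ht : 0 < t) (s : S) :
    (Integrable fun a => deriv (fun u => (π u).density s a) t) ∧
      ∫ a, deriv (fun u => (π u).density s a) t = 0 := by
  obtain ⟨G, hG, hGb⟩ := hf.action_domination t ht s
  obtain ⟨hi, hd⟩ := hasDerivAt_integral_of_dominated_loc_of_deriv_le
    (μ := (volume : Measure (Act d))) (F := fun u a => (π u).density s a)
    (F' := fun u a => deriv (fun v => (π v).density s a) u) (bound := G) (x₀ := t)
    (inter_mem hGb (Ioi_mem_nhds ht))
    (Eventually.of_forall fun u => ((π u).measurable_density_right s).aestronglyMeasurable)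
    ((π t).integrable_density s) (hf.measurable_deriv_density hr ht s).aestronglyMeasurable
    (ae_of_all _ fun a u hu => by
      refine le_trans ?_ (hu.1 a)
      rw [Real.norm_eq_abs]
      refine le_mul_of_one_le_right (abs_nonneg _) ?_
      have := sq_nonneg ‖a‖
      have := abs_nonneg (Real.log ((π u).density s a))
      linarith) hG
    (ae_of_all _ fun a u hu => (hf.flow_eq u hu.2 s a).differentiableAt.hasDerivAt)
  refine ⟨hi, ?_⟩
  simp only [(π _).integral_density] at hd
  exact hd.unique (hasDerivAt_const t (1 : ℝ))

/-- Integrability of the one-step objective at time `u` with the state-action value of time `t`. -/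
theorem integrable_frozen (hr : ∀ x, |M.r x| ≤ Rmax) (hf : M.IsSmoothWPGFlow π) {t u : ℝ}
    (ht : 0 ≤ t) (hu : 0 ≤ u) (s : S) :
    Integrable fun a => (M.Q (π t) s a - M.τ * Real.log ((π u).density s a)) *
      (π u).density s a := by
  have hVt := (hf.hasBddReward hr ht).isBddMeasurable_value
  have hVu := (hf.hasBddReward hr hu).isBddMeasurable_value
  have i1 := (hf.hasBddReward hr hu).integrable_Q_sub_log s
  have hd : IsBddMeasurable fun s' => M.value (π u) s' - M.value (π t) s' :=
    ⟨hVu.1.sub hVt.1, hVu.abs_sub_le hVt⟩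
  have i2 := ((π u).integrable_kernel_iff s).1
    ((integrable_next_kernel (M := M) hd s).const_mul M.γ)
  refine (i1.sub i2).congr (ae_of_all _ fun a => ?_)
  simp only [Pi.sub_apply, Q, qOf_eq, ← M.next_sub hVu hVt]
  ring

/-- With the state-action value frozen at time `t`, the regularized one-step objective increases at
the rate `τ²` times the relative Fisher information. -/
theorem hasDerivAt_frozen (hr : ∀ x, |M.r x| ≤ Rmax) (hf : M.IsSmoothWPGFlow π) {t : ℝ}
    (ht : 0 < t) (s : S) :
    HasDerivAt (fun u => ∫ a, (M.Q (π t) s a - M.τ * Real.log ((π u).density s a)) *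
      (π u).density s a) (M.τ ^ 2 * M.fisherInfo (π t) s) t := by
  have hτ := M.τ_pos
  have hβ := M.β_pos
  have h := hf.hasBddReward hr ht.le
  have hV := h.isBddMeasurable_value
  obtain ⟨C, hC⟩ := hV.2
  obtain ⟨G, hG, hGb⟩ := hf.action_domination t ht s
  have hU : 0 ≤ Rmax + M.γ * C := by
    have h1 := (abs_nonneg _).trans (hr (s, 0))
    have h2 := mul_nonneg M.γ_pos.le ((abs_nonneg _).trans (hC s))
    linarith
  have hQm : Measurable (M.Q (π t) s) := (measurable_qOf hV.1).comp measurable_prodMk_left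
  -- `K` dominates the coefficients of `1`, `‖a‖²` and `|log π|` in the differentiated integrand
  let K : ℝ := Rmax + M.γ * C + M.β / 2 + M.τ
  obtain ⟨hi, hd⟩ := hasDerivAt_integral_of_dominated_loc_of_deriv_le
    (μ := (volume : Measure (Act d)))
    (F := fun u a => (M.Q (π t) s a - M.τ * Real.log ((π u).density s a)) * (π u).density s a)
    (F' := fun u a => (M.Q (π t) s a - M.τ * Real.log ((π u).density s a) - M.τ) *
      deriv (fun v => (π v).density s a) u) (bound := fun a => K * G a) (x₀ := t)
    (inter_mem hGb (Ioi_mem_nhds ht))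
    ((eventually_gt_nhds ht).mono fun u hu =>
      (hf.integrable_frozen hr ht.le hu.le s).aestronglyMeasurable)
    (hf.integrable_frozen hr ht.le ht.le s)
    (((hQm.sub (((π t).measurable_density_right s).log.const_mul _)).sub_const _).mul
      (hf.measurable_deriv_density hr ht s)).aestronglyMeasurable
    (ae_of_all _ fun a u hu => by
      rw [norm_mul, Real.norm_eq_abs, Real.norm_eq_abs]
      have hb : |M.Q (π t) s a - M.τ * Real.log ((π u).density s a) - M.τ| ≤
          K * (1 + ‖a‖ ^ 2 + |Real.log ((π u).density s a)|) := by
        have h1 := abs_qOf_le hr hC s a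
        have h2 := sq_nonneg ‖a‖
        have h3 := abs_nonneg (Real.log ((π u).density s a))
        have h4 : |M.Q (π t) s a - M.τ * Real.log ((π u).density s a) - M.τ| ≤
            |M.Q (π t) s a| + M.τ * |Real.log ((π u).density s a)| + M.τ := by
          refine (abs_sub _ _).trans ?_
          rw [abs_of_pos hτ]
          refine add_le_add ((abs_sub _ _).trans ?_) le_rfl
          rw [abs_mul, abs_of_pos hτ]
        refine h4.trans ?_
        simp only [K]
        rw [Q]
        nlinarith [mul_nonneg hU h2, mul_nonneg hU h3, mul_nonneg hβ.le h3, mul_nonneg hτ.le h2]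
      calc _ ≤ K * (1 + ‖a‖ ^ 2 + |Real.log ((π u).density s a)|) *
            |deriv (fun v => (π v).density s a) u| :=
            mul_le_mul_of_nonneg_right hb (abs_nonneg _)
        _ = K * (|deriv (fun v => (π v).density s a) u| *
            (1 + ‖a‖ ^ 2 + |Real.log ((π u).density s a)|)) := by ring
        _ ≤ K * G a := mul_le_mul_of_nonneg_left (hu.1 a) (by simp only [K]; linarith))
    (hG.const_mul K)
    (ae_of_all _ fun a u hu => by
      have hp := hf.density_pos u hu.2 s a
      have hg := (hf.flow_eq u hu.2 s a).differentiableAt.hasDerivAt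
      have := (((hg.log hp.ne').const_mul M.τ).const_sub (M.Q (π t) s a)).mul hg
      refine this.congr_deriv ?_
      field_simp
      ring)
  obtain ⟨hi0, hz⟩ := hf.integral_deriv_density hr ht s
  have e : ∀ a, M.logRatio (π t) s a * divergence (M.flux (π t) s) a =
      M.τ⁻¹ * ((M.Q (π t) s a - M.τ * Real.log ((π t).density s a) - M.τ) *
        deriv (fun v => (π v).density s a) t) -
      (Real.log (M.partition (M.value (π t)) s) - 1) *
        deriv (fun v => (π v).density s a) t := fun a => by
    rw [h.Q_sub_log_eq hr (hf.density_pos t ht s a), hf.deriv_density ht]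
    field_simp
    ring
  have i1 := hi.const_mul M.τ⁻¹
  have i2 := hi0.const_mul (Real.log (M.partition (M.value (π t)) s) - 1)
  have key := h.integral_logRatio_mul_divergence_flux hr (hf.density_pos t ht s)
    (hf.contDiff_density t ht s) (hf.contDiff_Q t ht s) (hf.fisher t ht s) (hf.decay t ht s)
    ((i1.sub i2).congr (ae_of_all _ fun a => (e a).symm))
  rw [integral_congr_ae (ae_of_all _ e), integral_sub i1 i2, integral_const_mul,
    integral_const_mul, hz] at key
  refine hd.congr_deriv ?_
  rw [fisherInfo]
  field_simp at key
  linarith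

/-- The change of the value is the change of the frozen one-step objective, plus the discounted
average of the change of the value at the next state. -/
theorem value_sub_value (hr : ∀ x, |M.r x| ≤ Rmax) (hf : M.IsSmoothWPGFlow π) {t u : ℝ}
    (ht : 0 ≤ t) (hu : 0 ≤ u) (s : S) :
    M.value (π u) s - M.value (π t) s =
      (∫ a, (M.Q (π t) s a - M.τ * Real.log ((π u).density s a)) * (π u).density s a) -
      (∫ a, (M.Q (π t) s a - M.τ * Real.log ((π t).density s a)) * (π t).density s a) +
      M.γ * ∫ a, M.next (fun s' => M.value (π u) s' - M.value (π t) s') (s, a)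
        ∂((π u).kernel s) := by
  have hVt := (hf.hasBddReward hr ht).isBddMeasurable_value
  have hVu := (hf.hasBddReward hr hu).isBddMeasurable_value
  rw [← (hf.hasBddReward hr ht).value_eq_integral, (hf.hasBddReward hr hu).value_eq_integral,
    ← integral_const_mul, (π u).integral_kernel, sub_add_eq_add_sub, ← integral_add]
  · congr 1
    refine integral_congr_ae (ae_of_all _ fun a => ?_)
    simp only [Q, qOf_eq, ← M.next_sub hVu hVt]
    ring
  · exact hf.integrable_frozen hr ht hu s
  · exact ((π u).integrable_kernel_iff s).1
      ((integrable_next_kernel (M := M) ⟨hVu.1.sub hVt.1, hVu.abs_sub_le hVt⟩ s).const_mul M.γ)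

/-- At almost every time, wherever the value is differentiable in time it increases at least at the
rate `τ²` times the relative Fisher information. -/
theorem ae_le_of_hasDerivAt (hr : ∀ x, |M.r x| ≤ Rmax) (hf : M.IsSmoothWPGFlow π) :
    ∀ᵐ t, 0 < t → ∀ s ℓ, HasDerivAt (fun u => M.value (π u) s) ℓ t →
      M.τ ^ 2 * M.fisherInfo (π t) s ≤ ℓ := by
  filter_upwards [(ae_restrict_iff' measurableSet_Ioi).1 hf.state_domination] with t hdom ht s ℓ hℓ
  obtain ⟨C, hC⟩ := hdom ht
  obtain ⟨ε, hε, hball⟩ := Metric.eventually_nhds_iff.1 hC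
  -- positive increments below `ε`, so that the bound on difference quotients applies to all of them
  let h : ℕ → ℝ := fun n => ε / ((n : ℝ) + 2)
  have hpos : ∀ n, 0 < h n := fun n => by positivity
  have hlt : ∀ n, h n < ε := fun n => div_lt_self hε (by
    have : (0 : ℝ) ≤ n := n.cast_nonneg
    linarith)
  have h0 : Tendsto h atTop (𝓝 0) :=
    (tendsto_atTop_add_const_right atTop (2 : ℝ) tendsto_natCast_atTop_atTop).const_div_atTop ε
  have hne : Tendsto h atTop (𝓝[≠] 0) :=
    tendsto_nhdsWithin_iff.2 ⟨h0, Eventually.of_forall fun n => (hpos n).ne'⟩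
  have hu : ∀ n, 0 ≤ t + h n := fun n => (add_pos ht (hpos n)).le
  have hV : ∀ u, 0 ≤ u → IsBddMeasurable (M.value (π u)) := fun u hu =>
    (hf.hasBddReward hr hu).isBddMeasurable_value
  let w : ℕ → S → ℝ := fun n s => (h n)⁻¹ * (M.value (π (t + h n)) s - M.value (π t) s)
  let b : ℕ → S → ℝ := fun n s => (h n)⁻¹ *
    ((∫ a, (M.Q (π t) s a - M.τ * Real.log ((π (t + h n)).density s a)) *
      (π (t + h n)).density s a) -
    (∫ a, (M.Q (π t) s a - M.τ * Real.log ((π t).density s a)) * (π t).density s a))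
  have hwm : ∀ n, Measurable (w n) := fun n =>
    ((hV _ (hu n)).1.sub (hV t ht.le).1).const_mul _
  have hwC : ∀ n s, |w n s| ≤ C := fun n s => by
    have h1 := hball (y := h n) (by
      rw [dist_zero_right, Real.norm_of_nonneg (hpos n).le]; exact hlt n) s
    rw [abs_of_pos (hpos n)] at h1
    simp only [w]
    rw [abs_mul, abs_of_pos (inv_pos.2 (hpos n)), inv_mul_le_iff₀ (hpos n), mul_comm]
    exact h1
  have hshift : Tendsto (fun n => t + h n) atTop (𝓝 t) := by simpa using h0.const_add t
  have hbell : ∀ n s, w n s =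
      b n s + M.γ * ∫ a, M.next (w n) (s, a) ∂((π (t + h n)).kernel s) := fun n s => by
    have e : ∀ a, M.next (w n) (s, a) = (h n)⁻¹ *
        M.next (fun s' => M.value (π (t + h n)) s' - M.value (π t) s') (s, a) := fun a => by
      simp only [next, w, integral_const_mul]
    simp only [e, integral_const_mul]
    simp only [w, b]
    rw [hf.value_sub_value hr ht.le (hu n) s]
    ring
  have hblim : ∀ s, Tendsto (fun n => b n s) atTop (𝓝 (M.τ ^ 2 * M.fisherInfo (π t) s)) :=
    fun s => by
      have := (hf.hasDerivAt_frozen hr ht s).tendsto_slope_zero.comp hne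
      simpa [Function.comp_def, smul_eq_mul] using this
  have hwlim : Tendsto (fun n => w n s) atTop (𝓝 ℓ) := by
    have := hℓ.tendsto_slope_zero.comp hne
    simpa [Function.comp_def, smul_eq_mul] using this
  refine le_of_forall_lt fun c hc => ?_
  obtain ⟨c', hc1, hc2⟩ := exists_between hc
  refine hc1.trans_le (ge_of_tendsto hwlim ?_)
  exact eventually_le_of_bellman (M := M) hwm hwC (ν := fun n => π (t + h n)) (ν' := π t)
    (fun s a => ((hf.flow_eq t ht s a).continuousAt.tendsto.comp hshift)) hblim
    (fun s => mul_nonneg (sq_nonneg _) (fisherInfo_nonneg _ s)) hbell hc2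

end IsSmoothWPGFlow

end EntropyMDP

/-! ### A Grönwall inequality for families coupled by their supremum -/

section Gronwall

theorem AbsolutelyContinuousOnInterval.le_of_ae_deriv_nonpos {F : ℝ → ℝ} {T : ℝ} (hT : 0 ≤ T)
    (hF : AbsolutelyContinuousOnInterval F 0 T) (h : ∀ᵐ t, t ∈ Ioo 0 T → deriv F t ≤ 0) :
    F T ≤ F 0 := by
  have h1 := hF.integral_deriv_eq_sub
  rw [intervalIntegral.integral_of_le hT, integral_Ioc_eq_integral_Ioo] at h1
  have h2 : ∫ t in Ioo 0 T, deriv F t ≤ 0 :=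
    integral_nonpos_of_ae ((ae_restrict_iff' measurableSet_Ioo).2 h)
  linarith

/-- A Grönwall inequality for families: if each `δ(·, s)` decays at rate `κ` up to a source `κ γ`
times the supremum of `δ` over all `s`, then the supremum decays at rate `κ (1 - γ)`. -/
theorem exp_mul_le_of_ae_deriv_le {ι : Type*} [Nonempty ι] {δ : ℝ → ι → ℝ} {κ γ T D₀ C : ℝ}
    (hκ : 0 ≤ κ) (hγ0 : 0 ≤ γ) (hγ1 : γ ≤ 1) (hT : 0 ≤ T) (hC0 : 0 ≤ C)
    (hAC : ∀ s, AbsolutelyContinuousOnInterval (fun t => δ t s) 0 T)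
    (hC : ∀ t ∈ Icc 0 T, ∀ s, δ t s ≤ C) (h0 : ∀ s, δ 0 s ≤ D₀)
    (hderiv : ∀ᵐ t, t ∈ Ioo 0 T → ∀ s ℓ D, HasDerivAt (fun u => δ u s) ℓ t →
      (∀ s', δ t s' ≤ D) → ℓ ≤ -κ * (δ t s - γ * D)) (s : ι) :
    Real.exp (κ * (1 - γ) * T) * δ T s ≤ D₀ := by
  let f : Icc 0 T × ι → ℝ := fun x => Real.exp (κ * (1 - γ) * x.1) * δ x.1 x.2
  have hf : BddAbove (range f) := by
    refine ⟨Real.exp (κ * (1 - γ) * T) * C, ?_⟩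
    rintro _ ⟨⟨⟨t, ht⟩, s⟩, rfl⟩
    refine (mul_le_mul_of_nonneg_left (hC t ht s) (Real.exp_pos _).le).trans
      (mul_le_mul_of_nonneg_right (Real.exp_le_exp.2 ?_) hC0)
    exact mul_le_mul_of_nonneg_left ht.2 (mul_nonneg hκ (by linarith))
  have : Nonempty (Icc 0 T) := ⟨⟨0, left_mem_Icc.2 hT⟩⟩
  set B : ℝ := ⨆ x, f x with hB
  have hle : ∀ t ∈ Icc 0 T, ∀ s, δ t s ≤ B * Real.exp (-(κ * (1 - γ) * t)) := fun t ht s => by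
    have h1 : Real.exp (κ * (1 - γ) * t) * δ t s ≤ B := le_ciSup hf (⟨t, ht⟩, s)
    rw [Real.exp_neg, ← div_eq_mul_inv, le_div_iff₀ (Real.exp_pos _), mul_comm]
    exact h1
  -- the supremum `B` enters as a constant, so each state obeys a scalar inequality
  have hmono : ∀ t ∈ Icc 0 T, ∀ s, Real.exp (κ * t) * δ t s - B * Real.exp (κ * γ * t) ≤
      D₀ - B := by
    intro t₁ ht₁ s
    have hexp : ∀ c : ℝ, AbsolutelyContinuousOnInterval (fun t => Real.exp (c * t)) 0 t₁ :=
      fun c => ContDiffOn.absolutelyContinuousOnInterval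
        (contDiff_const.mul contDiff_id).exp.contDiffOn
    have hδ : AbsolutelyContinuousOnInterval (fun t => δ t s) 0 t₁ :=
      (hAC s).mono (by
        rw [uIcc_of_le ht₁.1, uIcc_of_le hT]
        exact Icc_subset_Icc_right ht₁.2)
    have key := AbsolutelyContinuousOnInterval.le_of_ae_deriv_nonpos
      (F := fun t => Real.exp (κ * t) * δ t s - B * Real.exp (κ * γ * t)) ht₁.1
      (((hexp κ).mul hδ).sub ((hexp (κ * γ)).const_mul B)) (by
      filter_upwards [hderiv, hδ.ae_differentiableAt] with t h1 h2 ht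
      have htT : t ∈ Ioo 0 T := ⟨ht.1, ht.2.trans_le ht₁.2⟩
      have hd := (h2 (by rw [uIcc_of_le ht₁.1]; exact Ioo_subset_Icc_self ht)).hasDerivAt
      have h3 := h1 htT s _ _ hd (hle t (Ioo_subset_Icc_self htT))
      have he : ∀ c : ℝ, HasDerivAt (fun t => Real.exp (c * t)) (Real.exp (c * t) * c) t :=
        fun c => by simpa using ((hasDerivAt_id t).const_mul c).exp
      have hF := ((he κ).mul hd).sub ((he (κ * γ)).const_mul B)
      have e1 : Real.exp (κ * γ * t) = Real.exp (κ * t) * Real.exp (-(κ * (1 - γ) * t)) := by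
        rw [← Real.exp_add]; congr 1; ring
      have h4 := mul_le_mul_of_nonneg_left h3 (Real.exp_pos (κ * t)).le
      refine le_trans (le_of_eq hF.deriv) ?_
      rw [e1]
      linarith)
    refine key.trans ?_
    simp only [mul_zero, Real.exp_zero, one_mul, mul_one]
    linarith [h0 s]
  have hBD : B ≤ D₀ := by
    -- if `D₀ < B`, the bound just obtained lies strictly below `B`, uniformly on `[0, T]`
    by_contra! hlt
    have h1 : B ≤ B - (B - D₀) * Real.exp (-(κ * γ * T)) := by
      refine ciSup_le ?_
      rintro ⟨⟨t, ht⟩, s⟩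
      have h2 := mul_le_mul_of_nonneg_left (hmono t ht s) (Real.exp_pos (-(κ * γ * t))).le
      have e1 : Real.exp (-(κ * γ * t)) * Real.exp (κ * t) = Real.exp (κ * (1 - γ) * t) := by
        rw [← Real.exp_add]; congr 1; ring
      have e2 : Real.exp (-(κ * γ * t)) * Real.exp (κ * γ * t) = 1 := by
        rw [← Real.exp_add]; simp
      have h3 : Real.exp (-(κ * γ * T)) ≤ Real.exp (-(κ * γ * t)) :=
        Real.exp_le_exp.2 (neg_le_neg (mul_le_mul_of_nonneg_left ht.2 (mul_nonneg hκ hγ0)))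
      have h4 := mul_le_mul_of_nonneg_left h3 (sub_pos.2 hlt).le
      have h5 : Real.exp (-(κ * γ * t)) * (Real.exp (κ * t) * δ t s - B * Real.exp (κ * γ * t)) =
          Real.exp (κ * (1 - γ) * t) * δ t s - B := by
        rw [mul_sub, ← mul_assoc, e1, mul_left_comm, e2, mul_one]
      rw [h5] at h2
      change Real.exp (κ * (1 - γ) * t) * δ t s ≤ _
      linarith
    have := mul_pos (sub_pos.2 hlt) (Real.exp_pos (-(κ * γ * T)))
    linarith
  exact (le_ciSup hf (⟨T, right_mem_Icc.2 hT⟩, s)).trans hBD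

end Gronwall

/-! ### Convergence of the flow -/

namespace EntropyMDP

variable {S : Type*} [MeasurableSpace S] {d : ℕ} {M : EntropyMDP S d} {Rmax K₀ : ℝ}
  {π : ℝ → Policy S d}

namespace IsSmoothWPGFlow

/-- The value does not decrease along the flow. -/
theorem value_zero_le (hr : ∀ x, |M.r x| ≤ Rmax) (hf : M.IsSmoothWPGFlow π) {t : ℝ} (ht : 0 ≤ t)
    (s : S) : M.value (π 0) s ≤ M.value (π t) s := by
  have hAC := hf.absolutelyContinuous_value s t ht
  have := AbsolutelyContinuousOnInterval.le_of_ae_deriv_nonpos ht hAC.neg (by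
    filter_upwards [hf.ae_le_of_hasDerivAt hr, hAC.ae_differentiableAt] with u h1 h2 hu
    have hd := (h2 (by rw [uIcc_of_le ht]; exact Ioo_subset_Icc_self hu)).hasDerivAt
    have h3 := (mul_nonneg (sq_nonneg M.τ) (fisherInfo_nonneg (M := M) (π u) s)).trans
      (h1 hu.1 s _ hd)
    rw [hd.neg.deriv]
    linarith)
  simpa using this

theorem abs_value_le (hr : ∀ x, |M.r x| ≤ Rmax) (hK₀ : 0 ≤ K₀) (hf : M.IsSmoothWPGFlow π)
    (hKL : ∀ s, InformationTheory.klDiv ((π 0).kernel s) M.gaussRef ≤ ENNReal.ofReal K₀) {t : ℝ}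
    (ht : 0 ≤ t) (s : S) : |M.value (π t) s| ≤ M.Vmax Rmax K₀ := by
  obtain ⟨K, hK, hKt⟩ := (hf.admissible t ht).exists_klDiv_le
  have h1 := value_le_of_klDiv_le hr hK hKt s
  have h2 := neg_value_le_of_klDiv_le hr hK₀ hKL s
  have h3 := hf.value_zero_le hr ht s
  rw [abs_le', Vmax]
  exact ⟨h1.trans (le_max_left _ _), le_trans (by linarith) (h2.trans (le_max_right _ _))⟩

/-- The logarithmic Sobolev inequality bounds the Bellman residual by the Fisher information. -/
theorem lsiConst_mul_Tstar_sub_value_le (hr : ∀ x, |M.r x| ≤ Rmax) (hK₀ : 0 ≤ K₀)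
    (hf : M.IsSmoothWPGFlow π)
    (hKL : ∀ s, InformationTheory.klDiv ((π 0).kernel s) M.gaussRef ≤ ENNReal.ofReal K₀) {t : ℝ}
    (ht : 0 < t) (s : S) :
    2 * M.lsiConst Rmax K₀ * M.τ * (M.Tstar (M.value (π t)) s - M.value (π t) s) ≤
      M.τ ^ 2 * M.fisherInfo (π t) s := by
  have hτ := M.τ_pos
  have hβ := M.β_pos
  have h := hf.hasBddReward hr ht.le
  have hlsi := h.integral_logRatio_le hr (hf.abs_value_le hr hK₀ hKL ht.le)
    (hf.density_pos t ht s) (hf.contDiff_density t ht s) (hf.contDiff_Q t ht s) (hf.fisher t ht s)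
  rw [(h.Tstar_sub_value_eq hr (hf.density_pos t ht s)).2, lsiConst, Umax]
  have e : Real.exp (-2 * (Rmax + M.γ * M.Vmax Rmax K₀) / M.τ) *
      Real.exp (2 * (Rmax + M.γ * M.Vmax Rmax K₀) / M.τ) = 1 := by
    rw [← Real.exp_add, ← add_div, neg_mul, neg_add_cancel, zero_div, Real.exp_zero]
  set E := Real.exp (-2 * (Rmax + M.γ * M.Vmax Rmax K₀) / M.τ)
  set E' := Real.exp (2 * (Rmax + M.γ * M.Vmax Rmax K₀) / M.τ)
  have hE : 0 ≤ E := (Real.exp_pos _).le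
  calc 2 * (M.β / M.τ * E) * M.τ * (M.τ * ∫ a, M.logRatio (π t) s a * (π t).density s a)
      = 2 * M.β * M.τ * E * ∫ a, M.logRatio (π t) s a * (π t).density s a := by field_simp
    _ ≤ 2 * M.β * M.τ * E * (E' * (M.τ / (2 * M.β)) * M.fisherInfo (π t) s) :=
        mul_le_mul_of_nonneg_left hlsi (by positivity)
    _ = E * E' * (M.τ ^ 2 * M.fisherInfo (π t) s) := by field_simp
    _ = _ := by rw [e, one_mul]

theorem lsiConst_pos : 0 < M.lsiConst Rmax K₀ :=
  mul_pos (div_pos M.β_pos M.τ_pos) (Real.exp_pos _)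

/-- Exponential decay of the gap to the optimal value. -/
theorem optimal_sub_value_le (hr : ∀ x, |M.r x| ≤ Rmax) (hK₀ : 0 ≤ K₀)
    (hf : M.IsSmoothWPGFlow π)
    (hKL : ∀ s, InformationTheory.klDiv ((π 0).kernel s) M.gaussRef ≤ ENNReal.ofReal K₀)
    {Vs : S → ℝ} (hVs : IsBddMeasurable Vs) (hfix : M.Tstar Vs = Vs) {D₀ : ℝ}
    (h0 : ∀ s, Vs s - M.value (π 0) s ≤ D₀) {t : ℝ} (ht : 0 ≤ t) (s : S) :
    Real.exp (2 * M.lsiConst Rmax K₀ * M.τ * (1 - M.γ) * t) * (Vs s - M.value (π t) s) ≤ D₀ := by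
  have := M.nonempty_state
  obtain ⟨C, hC⟩ := hVs.2
  have hα : 0 ≤ 2 * M.lsiConst Rmax K₀ * M.τ :=
    mul_nonneg (mul_nonneg two_pos.le lsiConst_pos.le) M.τ_pos.le
  have hb := fun {u} (hu : 0 ≤ u) s => hf.abs_value_le hr hK₀ hKL (t := u) hu s
  refine exp_mul_le_of_ae_deriv_le (δ := fun t s => Vs s - M.value (π t) s)
    (C := C + M.Vmax Rmax K₀) hα M.γ_pos.le M.γ_lt_one.le ht
    (add_nonneg ((abs_nonneg _).trans (hC s)) ((abs_nonneg _).trans (hb le_rfl s)))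
    (fun s => ?_) (fun u hu s => ?_) h0 ?_ s
  · exact (ContDiffOn.absolutelyContinuousOnInterval contDiffOn_const).sub
      (hf.absolutelyContinuous_value s t ht)
  · have h1 := (abs_le.1 (hC s)).2
    have h2 := (abs_le.1 (hb hu.1 s)).1
    linarith
  · filter_upwards [hf.ae_le_of_hasDerivAt hr] with u hu hut s ℓ D hd hD
    have hV : HasDerivAt (fun v => M.value (π v) s) (-ℓ) u := by
      simpa using hd.const_sub (Vs s)
    have h1 := hu hut.1 s _ hV
    have h2 := hf.lsiConst_mul_Tstar_sub_value_le hr hK₀ hKL hut.1 s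
    have h3 := Tstar_le_add hr hVs (hf.hasBddReward hr hut.1.le).isBddMeasurable_value
      (C := D) (fun s' => by linarith [hD s']) s
    rw [hfix] at h3
    have h4 : 2 * M.lsiConst Rmax K₀ * M.τ * (Vs s - M.value (π u) s - M.γ * D) ≤
        2 * M.lsiConst Rmax K₀ * M.τ * (M.Tstar (M.value (π u)) s - M.value (π u) s) :=
      mul_le_mul_of_nonneg_left (by linarith) hα
    linarith

end IsSmoothWPGFlow

end EntropyMDP

theorem mainTheorem3 {S : Type*} [MeasurableSpace S] {d : ℕ} (M : EntropyMDP S d)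
    (Rmax K₀ : ℝ) (hK₀ : 0 ≤ K₀) (hr : ∀ x, |M.r x| ≤ Rmax) :
    ∃ Vstar : S → ℝ,
      M.IsOptimalValue Vstar ∧ (∀ V, M.IsOptimalValue V → V = Vstar) ∧
      ∃ πstar : Policy S d, πstar.density = M.gibbs Vstar ∧ M.HasFiniteValues πstar ∧
        ∀ π : ℝ → Policy S d, M.IsSmoothWPGFlow π →
          (∀ s, InformationTheory.klDiv ((π 0).kernel s) M.gaussRef ≤ ENNReal.ofReal K₀) →
          ∀ t : ℝ, 0 ≤ t →
            M.HasFiniteValues (π t) ∧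
            BddAbove (range fun s => |Vstar s - M.value (π t) s|) ∧
            M.J πstar - M.J (π t) ≤ EntropyMDP.supDist Vstar (M.value (π t)) ∧
            EntropyMDP.supDist Vstar (M.value (π t)) ≤
              Real.exp (-2 * M.lsiConst Rmax K₀ * M.τ * (1 - M.γ) * t) *
                EntropyMDP.supDist Vstar (M.value (π 0)) := by
  have hne := M.nonempty_state
  have hT := EntropyMDP.isSupContraction_Tstar hr
  obtain ⟨Vs, hVs, hfix⟩ := hT.exists_fixed M.γ_pos.le M.γ_lt_one
  refine ⟨Vs, ⟨hVs.1, hVs.2, hfix⟩, fun V hV =>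
    hT.eq_of_fixed M.γ_pos.le M.γ_lt_one ⟨hV.1, hV.2.1⟩ hVs hV.2.2 hfix,
    EntropyMDP.gibbsPolicy hr hVs, rfl,
    (EntropyMDP.hasBddReward_gibbsPolicy hr hVs).hasFiniteValues, ?_⟩
  intro π hf hKL t ht
  have hbdd : ∀ u, 0 ≤ u → BddAbove (range fun s => |Vs s - M.value (π u) s|) := fun u hu => by
    obtain ⟨C, hC⟩ := hVs.abs_sub_le (hf.hasBddReward hr hu).isBddMeasurable_value
    exact ⟨C, forall_mem_range.2 hC⟩
  have h := hf.hasBddReward hr ht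
  refine ⟨h.hasFiniteValues, hbdd t ht, ?_, ?_⟩
  · have hV := h.isBddMeasurable_value
    rw [(EntropyMDP.hasBddReward_gibbsPolicy hr hVs).J_eq, h.J_eq,
      EntropyMDP.value_gibbsPolicy hr hVs hfix,
      ← integral_sub (hVs.integrable _) (hV.integrable _)]
    exact (le_abs_self _).trans
      (abs_integral_le_of_abs_le fun s => le_ciSup (hbdd t ht) s)
  · refine ciSup_le fun s => ?_
    have h1 := hf.optimal_sub_value_le hr hK₀ hKL hVs hfix
      (fun s => (le_abs_self _).trans (le_ciSup (hbdd 0 le_rfl) s)) ht s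
    rw [abs_of_nonneg (sub_nonneg.2 (h.value_le_of_fixed hr hVs hfix s)), neg_mul, neg_mul,
      neg_mul, neg_mul, Real.exp_neg, ← div_eq_inv_mul, le_div_iff₀ (Real.exp_pos _), mul_comm]
    exact h1
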